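/- Let $(\gamma,\sigma,\Pi)$ be the L\'evy triplet of a spectrally negative L\'evy process $X$, where $\gamma\in\mathbb R$, $\sigma\ge 0$, and $\Pi$ is a measure concentrated on $(0,\infty)$ with $\int_{(0,\infty)}(1\wedge z^2)\,\Pi(dz)<\infty$. Its Laplace exponent is $$\psi_X(\theta)=\gamma\theta+\tfrac12\sigma^2\theta^2-\int_{(0,\infty)}\bigl(1-e^{-\theta z}-\theta z1_{\{0<z<1\}}\bigr)\Pi(dz),\qquad \theta\ge 0.$$ Let $q>0$, $\delta>0$ and $S>0$. Put $c=\gamma+\int_{(0,1)}z\,\Pi(dz)$, $\Phi(q)=\sup\{\theta\ge0:\psi_X(\theta)=q\}$ and $\phi(q)=\sup\{\theta\ge 0:\psi_X(\theta)-\delta\theta=q\}$. Let $W^{(q)}:\mathbb R\to[0,\infty)$ be the $q$-scale function of $X$: $W^{(q)}=0$ on $(-\infty,0)$, and $W^{(q)}$ is continuous and strictly increasing on $[0,\infty)$ with $\int_0^\infty e^{-\theta x}W^{(q)}(x)\,dx=1/(\psi_X(\theta)-q)$ for all $\theta>\Phi(q)$. Values at $0$ of derivatives of $W^{(q)}$,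 of $\theta_S$, and of the derivatives of $A_S$ and $\theta_S$ (defined below) are understood as right-hand limits at $0$. Assume that $$\sigma>0,\qquad \phi(q)<\frac{2\delta}{\sigma^2},\qquad \Pi(0,\infty)<\infty,\qquad S<\frac{c}{\Pi(0,\infty)+q},$$ and that $\Pi$ has a completely monotone density, i.e. a nonnegative density $\rho\in C^\infty(0,\infty)$ with $(-1)^n\rho^{(n)}\ge0$ on $(0,\infty)$ for all $n\ge 1$. Define, for $b\ge0$, $$A_S(b)=\frac{\int_b^\infty e^{-\phi(q)y}\bigl(1-S\frac{\sigma^2}{2}W^{(q)\prime\prime}(y)\bigr)dy}{\int_b^\infty e^{-\phi(q)y}W^{(q)\prime}(y)\,dy},\qquad \theta_S(b)=\frac{1-S\frac{\sigma^2}{2}W^{(q)\prime\prime}(b)}{W^{(q)\prime}(b)},$$ let $a^*$ be the largest point of $[0,\infty)$ at which $W^{(q)\prime}$ attains its global infimum, and let, with $\inf\emptyset=\infty$, $$a_S^*=\inf\{b\ge0:\theta_S'(b)\le0\},\qquad b_S^*=\inf\{b\ge0:A_S(b)\le\theta_S(b)\}.$$ Then $b_S^*=\inf\{b\ge0:A_S'(b)\le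 0\}$, and $$b_S^*>0\iff S<\frac{\frac{\delta}{\phi(q)}-\frac{\sigma^2}{2}}{c-\delta+\phi(q)\frac{\sigma^2}{2}}.$$ Moreover, $a^*$ exists (so $a^*<\infty$), and $b_S^*\le a_S^*\le a^*<\infty$. -/

import Mathlib

open MeasureTheory Filter Topology Set
open scoped ContDiff

noncomputable section

/-- The Lévy triplet `(γ, σ, Π)` of a spectrally negative Lévy process `X`. The jump measure `Π`
(here `jump`) is concentrated on `(0, ∞)` and records the sizes of the downward jumps. -/
structure LevyTriplet where
  γ : ℝ
  σ : ℝ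
  jump : Measure ℝ
  sigma_nonneg : 0 ≤ σ
  jump_nonpos : jump (Iic 0) = 0
  jump_levy : ∫⁻ z in Ioi (0 : ℝ), ENNReal.ofReal (min 1 (z ^ 2)) ∂jump < ⊤

namespace LevyTriplet

/-- The Laplace exponent
`ψ_X(θ) = γ θ + σ² θ² / 2 - ∫_{(0,∞)} (1 - e^{-θz} - θ z 1_{0<z<1}) Π(dz)`, for `θ ≥ 0`. -/
def psi (T : LevyTriplet) (θ : ℝ) : ℝ :=
  T.γ * θ + T.σ ^ 2 * θ ^ 2 / 2
    - ∫ z in Ioi (0 : ℝ),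
        (1 - Real.exp (-θ * z) - (Ioo (0 : ℝ) 1).indicator (fun z => θ * z) z) ∂T.jump

/-- The drift `c = γ + ∫_{(0,1)} z Π(dz)`. -/
def drift (T : LevyTriplet) : ℝ :=
  T.γ + ∫ z in Ioo (0 : ℝ) 1, z ∂T.jump

/-- The right inverse `Φ(q) = sup {θ ≥ 0 : ψ_X(θ) = q}`. -/
def Phi (T : LevyTriplet) (q : ℝ) : ℝ :=
  sSup {θ : ℝ | 0 ≤ θ ∧ T.psi θ = q}

/-- The right inverse `φ(q) = sup {θ ≥ 0 : ψ_Y(θ) = q}` of the Laplace exponent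
`ψ_Y(θ) = ψ_X(θ) - δ θ` of `Y_t = X_t - δ t`. -/
def phi (T : LevyTriplet) (δ q : ℝ) : ℝ :=
  sSup {θ : ℝ | 0 ≤ θ ∧ T.psi θ - δ * θ = q}

/-- `Π` has a completely monotone density on `(0, ∞)`. -/
def HasCompletelyMonotoneDensity (T : LevyTriplet) : Prop :=
  ∃ ρ : ℝ → ℝ, ContDiffOn ℝ ∞ ρ (Ioi 0) ∧
    (∀ (n : ℕ) (x : ℝ), 0 < x → 0 ≤ (-1 : ℝ) ^ n * iteratedDeriv n ρ x) ∧
    T.jump = (volume.restrict (Ioi 0)).withDensity (fun x => ENNReal.ofReal (ρ x))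

/-- `W` is the `q`-scale function of `X`: it vanishes on `(-∞, 0)`, is nonnegative, continuous and
strictly increasing on `[0, ∞)`, and has Laplace transform `1 / (ψ_X(θ) - q)` for `θ > Φ(q)`. -/
structure IsScaleFunction (T : LevyTriplet) (q : ℝ) (W : ℝ → ℝ) : Prop where
  eq_zero_of_neg : ∀ x < 0, W x = 0
  nonneg : ∀ x, 0 ≤ W x
  continuousOn : ContinuousOn W (Ici 0)
  strictMonoOn : StrictMonoOn W (Ici 0)
  integrableOn : ∀ θ > T.Phi q, IntegrableOn (fun x => Real.exp (-θ * x) * W x) (Ioi 0)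
  laplace : ∀ θ > T.Phi q,
    ∫ x in Ioi (0 : ℝ), Real.exp (-θ * x) * W x = 1 / (T.psi θ - q)

end LevyTriplet

/-- The function on `[0, ∞)` that is `f` on `(0, ∞)` and whose value at the origin is the right-hand
limit `f(0+)`. -/
def extendAtZero (f : ℝ → ℝ) (x : ℝ) : ℝ :=
  if 0 < x then f x else limUnder (𝓝[>] (0 : ℝ)) f

/-- The `n`-th derivative of `W` on `[0, ∞)`, its value at the origin being the right-hand limit. -/
def scaleDeriv (W : ℝ → ℝ) (n : ℕ) : ℝ → ℝ :=
  extendAtZero (iteratedDeriv n W)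

/-- `A_S(b)`, for `b ≥ 0`. -/
def AFun (T : LevyTriplet) (δ q S : ℝ) (W : ℝ → ℝ) (b : ℝ) : ℝ :=
  (∫ y in Ioi b,
      Real.exp (-(T.phi δ q) * y) * (1 - S * (T.σ ^ 2 / 2) * scaleDeriv W 2 y))
    / ∫ y in Ioi b, Real.exp (-(T.phi δ q) * y) * scaleDeriv W 1 y

/-- `θ_S(b) = (1 - S (σ²/2) W''(b)) / W'(b)` for `b > 0`, and `θ_S(0) = θ_S(0+)`. -/
def thetaFun (T : LevyTriplet) (S : ℝ) (W : ℝ → ℝ) : ℝ → ℝ :=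
  extendAtZero fun b => (1 - S * (T.σ ^ 2 / 2) * scaleDeriv W 2 b) / scaleDeriv W 1 b

/-- The infimum of a set of real numbers, with `inf ∅ = ∞`. -/
def infReal (s : Set ℝ) : EReal := sInf ((fun x : ℝ => (x : EReal)) '' s)

/-- `b*_S = inf {b ≥ 0 : A_S(b) ≤ θ_S(b)}`. -/
def bStar (T : LevyTriplet) (δ q S : ℝ) (W : ℝ → ℝ) : EReal :=
  infReal {b : ℝ | 0 ≤ b ∧ AFun T δ q S W b ≤ thetaFun T S W b}

/-- `a*_S = inf {b ≥ 0 : θ_S'(b) ≤ 0}`, where `θ_S'(0) = θ_S'(0+)`. -/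
def aSStar (T : LevyTriplet) (S : ℝ) (W : ℝ → ℝ) : EReal :=
  infReal {b : ℝ | 0 ≤ b ∧ extendAtZero (deriv (thetaFun T S W)) b ≤ 0}

/-- `a` is `a*`, the largest point of `[0, ∞)` at which `W'` attains its global infimum. -/
def IsAStar (W : ℝ → ℝ) (a : ℝ) : Prop :=
  IsGreatest {x : ℝ | 0 ≤ x ∧ IsMinOn (scaleDeriv W 1) (Ici 0) x} a

end

/-! Write s = σ²/2, κ = S s, Φ = Φ(q), φ = φ(q), A = `AFun`, θ_S = `thetaFun`. A(b) is the average
of θ_S over (b, ∞) with weight e^{-φy} W'(y). Hence A' is a positive multiple of A - θ_S, which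
identifies the two descriptions of b*_S, and A(b) ≤ θ_S(b) as soon as θ_S is nonincreasing beyond b.
The ordering of the thresholds thus rests on unimodality: once θ_S' ≤ 0, it stays so
(`slope_nonpos_of_le`).

The input is convexity of W. As Π is finite with density ρ, ψ(θ) - q factors both as θ (sθ + c -
r̂(θ)) with r(x) = q + ∫ₓ^∞ ρ, and as (θ - Φ)(sθ + c + sΦ - t̂(θ)) with t = `expTail ρ Φ`. Inverting
the transforms, s W' and s (W' - Φ W) solve equations u' = -a u + k ∗ u, u(0) = 1, with k = r/s and
k = t/s. Such a u satisfies u(x+y) = u(x) u(y) + ∫∫ u(x-s) u(y-t) k(s+t) dt ds (`apply_add`). When k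
is a limit of positive mixtures of exponentials, the double integral is a positive semidefinite
kernel, hence so is u(x+y); then u, and also u'', is log-convex. So W' is log-convex, and W''' - Φ
W'' is positive and log-convex. Complete monotonicity of ρ supplies the mixtures through Taylor
expansions, without a representing measure.

For unimodality, θ_S' has the sign of -W'' - κ (W' W''' - W''²), which is nonpositive where W'' ≥ 0.
Where W'' < 0 it amounts to comparing κR with 1, R = (W' W''' - W''²)/(-W''). The sign of R' is that
of g'² - g g'' for g = e^{-Φx} W''; log-convexity of g' keeps this nonnegative once it is, so R
falls and then rises. The bound S < c/(Π(0,∞) + q) says exactly that κR(0) < 1, so κR can reach 1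
only while rising. At the zero of W'' one has θ_S' ≤ 0, whence a*_S ≤ a*. The criterion for b*_S > 0
is θ_S(0) < A(0), with A(0) computed from Laplace transforms at φ. -/

/-- The convolution `∫₀ˣ f(s) g(x - s) ds` of functions on the half-line. -/
noncomputable def causalConv (f g : ℝ → ℝ) (x : ℝ) : ℝ :=
  ∫ s in (0 : ℝ)..x, f s * g (x - s)

/-- The Laplace transform of a function on the half-line. -/
noncomputable def laplaceTransform (f : ℝ → ℝ) (θ : ℝ) : ℝ :=
  ∫ x in Ioi (0 : ℝ), Real.exp (-θ * x) * f x

/-- Absolute convergence of the Laplace integral of `f` at `θ`. -/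
def LaplaceIntegrable (f : ℝ → ℝ) (θ : ℝ) : Prop :=
  IntegrableOn (fun x => Real.exp (-θ * x) * f x) (Ioi 0)

/-! ### Algebra of convolution on the half-line. -/

section CausalConv

variable {f g h : ℝ → ℝ}

@[fun_prop]
theorem causalConv_continuous (hf : Continuous f) (hg : Continuous g) :
    Continuous (causalConv f g) := by
  unfold causalConv
  refine intervalIntegral.continuous_parametric_intervalIntegral_of_continuous
    (f := fun x s => f s * g (x - s)) ?_ continuous_id
  simp only [Function.uncurry_def]
  fun_prop

theorem causalConv_comm (f g : ℝ → ℝ) (x : ℝ) : causalConv f g x = causalConv g f x := by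
  unfold causalConv
  have := intervalIntegral.integral_comp_sub_left (a := 0) (b := x)
    (fun s => f s * g (x - s)) x
  simp only [sub_sub_cancel, sub_self, sub_zero] at this
  rw [← this]
  exact intervalIntegral.integral_congr fun s _ => mul_comm _ _

theorem causalConv_one_left (g : ℝ → ℝ) (x : ℝ) :
    causalConv (fun _ => 1) g x = ∫ s in (0 : ℝ)..x, g s := by
  rw [causalConv_comm]; simp [causalConv]

theorem causalConv_congr {f₁ f₂ g₁ g₂ : ℝ → ℝ} {x : ℝ} (hx : 0 ≤ x)
    (hf : ∀ s, 0 ≤ s → f₁ s = f₂ s) (hg : ∀ s, 0 ≤ s → g₁ s = g₂ s) :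
    causalConv f₁ g₁ x = causalConv f₂ g₂ x := by
  refine intervalIntegral.integral_congr fun s hs => ?_
  rw [uIcc_of_le hx] at hs
  simp only [hf s hs.1, hg (x - s) (sub_nonneg.2 hs.2)]

theorem causalConv_add_right (hf : Continuous f) (hg : Continuous g) (hh : Continuous h) (x : ℝ) :
    causalConv f (fun s => g s + h s) x = causalConv f g x + causalConv f h x := by
  unfold causalConv
  rw [← intervalIntegral.integral_add]
  · exact intervalIntegral.integral_congr fun s _ => mul_add _ _ _
  · exact Continuous.intervalIntegrable (by fun_prop) _ _
  · exact Continuous.intervalIntegrable (by fun_prop) _ _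

theorem causalConv_smul_right (f g : ℝ → ℝ) (a x : ℝ) :
    causalConv f (fun s => a * g s) x = a * causalConv f g x := by
  unfold causalConv
  rw [← intervalIntegral.integral_const_mul]
  exact intervalIntegral.integral_congr fun s _ => by ring

theorem causalConv_smul_left (f g : ℝ → ℝ) (a x : ℝ) :
    causalConv (fun s => a * f s) g x = a * causalConv f g x := by
  rw [causalConv_comm, causalConv_smul_right, causalConv_comm]

/-- Fubini on the triangle `0 < s ≤ t ≤ x`. -/
theorem integral_triangle_swap {k : ℝ → ℝ → ℝ} (hk : Continuous (Function.uncurry k)) {x : ℝ}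
    (hx : 0 ≤ x) :
    ∫ t in (0 : ℝ)..x, ∫ s in (0 : ℝ)..t, k t s = ∫ s in (0 : ℝ)..x, ∫ t in s..x, k t s := by
  set μ := (volume : Measure ℝ).restrict (Ioc 0 x)
  have hint : Integrable (Function.uncurry fun t s => ({p : ℝ × ℝ | p.2 ≤ p.1}).indicator
      (Function.uncurry k) (t, s)) (μ.prod μ) := by
    have h1 : IntegrableOn (Function.uncurry k) (Icc 0 x ×ˢ Icc 0 x)
        ((volume : Measure ℝ).prod volume) :=
      hk.continuousOn.integrableOn_compact (isCompact_Icc.prod isCompact_Icc)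
    have h2 : Integrable (Function.uncurry k) (μ.prod μ) := by
      rw [Measure.prod_restrict]
      exact h1.mono_set (prod_mono Ioc_subset_Icc_self Ioc_subset_Icc_self)
    exact h2.indicator (measurableSet_le measurable_snd measurable_fst)
  have hL : ∫ t in (0 : ℝ)..x, ∫ s in (0 : ℝ)..t, k t s
      = ∫ t, ∫ s, ({p : ℝ × ℝ | p.2 ≤ p.1}).indicator (Function.uncurry k) (t, s) ∂μ ∂μ := by
    rw [intervalIntegral.integral_of_le hx]
    refine setIntegral_congr_fun measurableSet_Ioc fun t ht => ?_
    rw [intervalIntegral.integral_of_le ht.1.le]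
    have : (fun s => ({p : ℝ × ℝ | p.2 ≤ p.1}).indicator (Function.uncurry k) (t, s))
        = (Iic t).indicator (k t) := by
      ext s; simp [indicator, Function.uncurry]
    rw [this, integral_indicator measurableSet_Iic, Measure.restrict_restrict measurableSet_Iic]
    congr 2
    ext s; simp only [mem_inter_iff, mem_Iic, mem_Ioc]
    constructor
    · intro h; exact ⟨h.2, h.1, h.2.trans ht.2⟩
    · intro h; exact ⟨h.2.1, h.1⟩
  have hR : ∫ s in (0 : ℝ)..x, ∫ t in s..x, k t s
      = ∫ s, ∫ t, ({p : ℝ × ℝ | p.2 ≤ p.1}).indicator (Function.uncurry k) (t, s) ∂μ ∂μ := by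
    rw [intervalIntegral.integral_of_le hx]
    refine setIntegral_congr_fun measurableSet_Ioc fun s hs => ?_
    rw [intervalIntegral.integral_of_le hs.2, ← integral_Icc_eq_integral_Ioc]
    have : (fun t => ({p : ℝ × ℝ | p.2 ≤ p.1}).indicator (Function.uncurry k) (t, s))
        = (Ici s).indicator (fun t => k t s) := by
      ext t; simp [indicator, Function.uncurry]
    rw [this, integral_indicator measurableSet_Ici, Measure.restrict_restrict measurableSet_Ici]
    congr 2
    ext t; simp only [mem_inter_iff, mem_Ici, mem_Ioc, mem_Icc]
    constructor
    · intro h; exact ⟨h.1, hs.1.trans_le h.1, h.2⟩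
    · intro h; exact ⟨h.1, h.2.2⟩
  rw [hL, hR]
  exact integral_integral_swap hint

theorem causalConv_assoc (hf : Continuous f) (hg : Continuous g) (hh : Continuous h) {x : ℝ}
    (hx : 0 ≤ x) :
    causalConv (causalConv f g) h x = causalConv f (causalConv g h) x := by
  have h1 := integral_triangle_swap (k := fun t s => f s * g (t - s) * h (x - t))
    (by simp only [Function.uncurry_def]; fun_prop) hx
  unfold causalConv
  calc _ = ∫ t in (0 : ℝ)..x, ∫ s in (0 : ℝ)..t, f s * g (t - s) * h (x - t) := by
        refine intervalIntegral.integral_congr fun t _ => ?_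
        exact (intervalIntegral.integral_mul_const _ _).symm
    _ = _ := h1
    _ = _ := by
        refine intervalIntegral.integral_congr fun s _ => ?_
        rw [← intervalIntegral.integral_const_mul]
        have := intervalIntegral.integral_comp_sub_right (a := s) (b := x)
          (fun t => f s * (g t * h (x - s - t))) s
        simp only [sub_self] at this
        rw [← this]
        refine intervalIntegral.integral_congr fun t _ => ?_
        simp only [sub_sub_sub_cancel_right]
        ring

/-- Taking a primitive is convolution with 1, so this is associativity and commutativity. -/
theorem causalConv_integral (hf : Continuous f) (hg : Continuous g) {x : ℝ} (hx : 0 ≤ x) :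
    causalConv f (fun y => ∫ s in (0 : ℝ)..y, g s) x = ∫ s in (0 : ℝ)..x, causalConv f g s := by
  have hg' : (fun y => ∫ s in (0 : ℝ)..y, g s) = causalConv g (fun _ => 1) := by
    ext y; rw [causalConv_comm, causalConv_one_left]
  rw [hg', ← causalConv_assoc hf hg continuous_const hx, causalConv_comm, causalConv_one_left]

end CausalConv

@[fun_prop]
theorem continuous_integral_zero {g : ℝ → ℝ} (hg : Continuous g) :
    Continuous fun x => ∫ s in (0 : ℝ)..x, g s :=
  intervalIntegral.continuous_primitive (fun _ _ => hg.intervalIntegrable _ _) 0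

/-! ### Laplace transforms and their injectivity. -/

section Laplace

variable {f g : ℝ → ℝ} {θ : ℝ}

theorem laplace_causalConv_aux (x : ℝ) :
    Real.exp (-θ * x) * causalConv f g x
      = ∫ t in (0 : ℝ)..x, ContinuousLinearMap.mul ℝ ℝ (Real.exp (-θ * t) * f t)
          (Real.exp (-θ * (x - t)) * g (x - t)) := by
  unfold causalConv
  rw [← intervalIntegral.integral_const_mul]
  refine intervalIntegral.integral_congr fun t _ => ?_
  simp only [ContinuousLinearMap.mul_apply']
  have : Real.exp (-θ * x) = Real.exp (-θ * t) * Real.exp (-θ * (x - t)) := by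
    rw [← Real.exp_add]; congr 1; ring
  rw [this]; ring

theorem LaplaceIntegrable.causalConv (hf : LaplaceIntegrable f θ) (hg : LaplaceIntegrable g θ) :
    LaplaceIntegrable (causalConv f g) θ := by
  have := integrable_posConvolution (μ := volume) (ν := volume) hf hg (ContinuousLinearMap.mul ℝ ℝ)
  unfold posConvolution at this
  rw [integrable_indicator_iff measurableSet_Ioi] at this
  exact this.congr_fun (fun x _ => (laplace_causalConv_aux x).symm) measurableSet_Ioi

theorem laplaceTransform_causalConv (hf : LaplaceIntegrable f θ) (hg : LaplaceIntegrable g θ) :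
    laplaceTransform (causalConv f g) θ = laplaceTransform f θ * laplaceTransform g θ := by
  have := integral_posConvolution (μ := volume) (ν := volume) hf hg (ContinuousLinearMap.mul ℝ ℝ)
  rw [ContinuousLinearMap.mul_apply'] at this
  unfold laplaceTransform
  rw [← this]
  exact integral_congr_ae (Eventually.of_forall fun x => laplace_causalConv_aux x)

theorem laplaceIntegrable_one (hθ : 0 < θ) : LaplaceIntegrable (fun _ => 1) θ := by
  have := exp_neg_integrableOn_Ioi 0 hθ
  simpa [LaplaceIntegrable] using this

theorem laplaceTransform_one (hθ : 0 < θ) : laplaceTransform (fun _ => 1) θ = 1 / θ := by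
  have := integral_exp_mul_Ioi (neg_lt_zero.2 hθ) 0
  simp only [laplaceTransform, mul_one]
  rw [this]; simp

theorem LaplaceIntegrable.add (hf : LaplaceIntegrable f θ) (hg : LaplaceIntegrable g θ) :
    LaplaceIntegrable (fun x => f x + g x) θ := by
  have : IntegrableOn (fun x => Real.exp (-θ * x) * f x + Real.exp (-θ * x) * g x) (Ioi 0) :=
    Integrable.add hf hg
  simpa only [LaplaceIntegrable, mul_add] using this

theorem LaplaceIntegrable.const_mul (hf : LaplaceIntegrable f θ) (c : ℝ) :
    LaplaceIntegrable (fun x => c * f x) θ := by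
  have : IntegrableOn (fun x => c * (Real.exp (-θ * x) * f x)) (Ioi 0) :=
    Integrable.const_mul hf c
  simpa only [LaplaceIntegrable, mul_left_comm] using this

theorem laplaceTransform_add (hf : LaplaceIntegrable f θ) (hg : LaplaceIntegrable g θ) :
    laplaceTransform (fun x => f x + g x) θ = laplaceTransform f θ + laplaceTransform g θ := by
  unfold laplaceTransform
  rw [← integral_add hf hg]
  simp only [mul_add]

theorem laplaceTransform_const_mul (c : ℝ) :
    laplaceTransform (fun x => c * f x) θ = c * laplaceTransform f θ := by
  unfold laplaceTransform
  rw [← integral_const_mul]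
  simp only [mul_left_comm]

/-- **Lerch's theorem** for continuous functions. -/
theorem eq_zero_of_laplaceTransform_eq_zero {θ₀ : ℝ} (hf : Continuous f)
    (hint : ∀ θ > θ₀, LaplaceIntegrable f θ) (hzero : ∀ θ > θ₀, laplaceTransform f θ = 0)
    {x : ℝ} (hx : 0 ≤ x) : f x = 0 := by
  -- Tilting by e^{-ηx} makes the function integrable; the transform at η + n becomes the n-th
  -- moment in the variable e^{-x}, so all polynomials in e^{-x} integrate to zero against it.
  set η := θ₀ + 1 with hη
  set k : ℝ → ℝ := fun x => Real.exp (-η * x) * f x with hk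
  have hkc : Continuous k := by fun_prop
  have hkint : IntegrableOn k (Ioi 0) := hint η (by linarith)
  have hmono (n : ℕ) : ∫ x in Ioi (0 : ℝ), Real.exp (-x) ^ n * k x = 0 := by
    have hn : (0 : ℝ) ≤ n := n.cast_nonneg
    refine Eq.trans ?_ (hzero (η + n) (by linarith))
    refine integral_congr_ae (Eventually.of_forall fun x => ?_)
    simp only [hk]
    rw [← mul_assoc, ← Real.exp_nat_mul, ← Real.exp_add]
    congr 2; ring
  have hbd {c : ℝ → ℝ} (hc : Continuous c) {C : ℝ} (hC : ∀ x ∈ Ioi (0 : ℝ), |c x| ≤ C) :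
      IntegrableOn (fun x => c x * k x) (Ioi 0) := by
    refine Integrable.bdd_mul (c := C) hkint hc.aestronglyMeasurable ?_
    exact (ae_restrict_iff' measurableSet_Ioi).2 (Eventually.of_forall hC)
  have hexp1 : ∀ x ∈ Ioi (0 : ℝ), Real.exp (-x) ∈ Icc (0 : ℝ) 1 := fun x hx =>
    ⟨(Real.exp_pos _).le, Real.exp_le_one_iff.2 (by simpa using (mem_Ioi.1 hx).le)⟩
  have hpoly (p : Polynomial ℝ) : ∫ x in Ioi (0 : ℝ), p.eval (Real.exp (-x)) * k x = 0 := by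
    have h1 : ∀ x, p.eval (Real.exp (-x)) * k x
        = ∑ i ∈ Finset.range (p.natDegree + 1), p.coeff i * (Real.exp (-x) ^ i * k x) := by
      intro x
      rw [Polynomial.eval_eq_sum_range, Finset.sum_mul]
      exact Finset.sum_congr rfl fun i _ => by ring
    simp_rw [h1]
    rw [integral_finsetSum]
    · exact Finset.sum_eq_zero fun i _ => by rw [integral_const_mul, hmono, mul_zero]
    · intro i _
      refine Integrable.const_mul (hbd (c := fun x => Real.exp (-x) ^ i) (by fun_prop) (C := 1) ?_) _
      intro x hx
      rw [abs_of_nonneg (pow_nonneg (hexp1 x hx).1 _)]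
      exact pow_le_one₀ (hexp1 x hx).1 (hexp1 x hx).2
  have htest (φ : ℝ → ℝ) (hφ : Continuous φ) (hcs : HasCompactSupport φ)
      (hsub : tsupport φ ⊆ Ioi 0) : ∫ x in Ioi (0 : ℝ), φ x * k x = 0 := by
    -- In the variable y = e^{-x} the test function lives on [0, 1], where Weierstrass approximation
    -- applies. At y = 0 the convention log 0 = 0 yields φ(0) = 0, which agrees with the limit
    -- because φ has compact support inside (0, ∞).
    have hcont : ContinuousOn (fun y => φ (-Real.log y)) (Icc 0 1) := by
      intro y hy
      rcases eq_or_lt_of_le hy.1 with h0 | h0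
      · subst h0
        obtain ⟨R, hR⟩ := hcs.isCompact.bddAbove
        have hev : (fun y => φ (-Real.log y)) =ᶠ[𝓝[Icc 0 1] 0] fun _ => 0 := by
          have : Icc (0 : ℝ) 1 ∩ Iio (Real.exp (-R)) ∈ 𝓝[Icc 0 1] (0 : ℝ) :=
            inter_mem_nhdsWithin _ (Iio_mem_nhds (Real.exp_pos _))
          filter_upwards [this] with z hz
          by_contra hne
          have hmem : -Real.log z ∈ tsupport φ := subset_tsupport _ hne
          have h1 := hR hmem
          rcases eq_or_lt_of_le hz.1.1 with h2 | h2
          · rw [← h2] at hmem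
            simpa using hsub hmem
          · have := (Real.log_lt_iff_lt_exp h2).2 hz.2
            linarith
        refine (continuousWithinAt_const (b := (0 : ℝ))).congr_of_eventuallyEq hev ?_
        have : φ 0 = 0 := by
          by_contra hne
          have := hsub (subset_tsupport φ hne)
          simp at this
        simpa using this
      · exact (hφ.continuousAt.comp (Real.continuousAt_log h0.ne').neg).continuousWithinAt
    set I := ∫ x in Ioi (0 : ℝ), |k x| with hI
    have hI0 : 0 ≤ I := integral_nonneg fun _ => abs_nonneg _
    obtain ⟨C, hC⟩ := hcs.exists_bound_of_continuous hφ
    have hle : ∀ ε > 0, |∫ x in Ioi (0 : ℝ), φ x * k x| ≤ ε * I := by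
      intro ε hε
      obtain ⟨p, hp⟩ := exists_polynomial_near_of_continuousOn 0 1 _ hcont ε hε
      have hp' : ∀ x ∈ Ioi (0 : ℝ), |φ x - p.eval (Real.exp (-x))| ≤ ε := by
        intro x hx
        have := hp _ (hexp1 x hx)
        rw [Real.log_exp, neg_neg, abs_sub_comm] at this
        exact this.le
      have hpint : IntegrableOn (fun x => p.eval (Real.exp (-x)) * k x) (Ioi 0) := by
        refine hbd (C := C + ε) (by fun_prop) fun x hx => ?_
        have h1 := hp' x hx
        have h2 : |φ x| ≤ C := hC x
        have h3 := abs_sub_abs_le_abs_sub (p.eval (Real.exp (-x))) (φ x)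
        rw [abs_sub_comm] at h3
        linarith
      have heq : ∫ x in Ioi (0 : ℝ), φ x * k x
          = ∫ x in Ioi (0 : ℝ), (φ x - p.eval (Real.exp (-x))) * k x := by
        simp_rw [sub_mul]
        rw [integral_sub (hbd hφ fun x _ => hC x) hpint, hpoly, sub_zero]
      rw [heq, hI, ← integral_const_mul, ← Real.norm_eq_abs]
      refine norm_integral_le_of_norm_le (hkint.abs.const_mul ε) ?_
      refine (ae_restrict_iff' measurableSet_Ioi).2 (Eventually.of_forall fun x hx => ?_)
      rw [norm_mul]
      exact mul_le_mul_of_nonneg_right (hp' x hx) (abs_nonneg _)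
    by_contra hne
    have hpos : 0 < |∫ x in Ioi (0 : ℝ), φ x * k x| := abs_pos.2 hne
    have := hle (|∫ x in Ioi (0 : ℝ), φ x * k x| / (2 * (I + 1))) (by positivity)
    rw [div_mul_eq_mul_div, le_div_iff₀ (by positivity)] at this
    nlinarith
  have hae : ∀ᵐ x ∂(volume : Measure ℝ), x ∈ Ioi (0 : ℝ) → k x = 0 := by
    refine isOpen_Ioi.ae_eq_zero_of_integral_contDiff_smul_eq_zero
      (hkc.locallyIntegrable.locallyIntegrableOn _) fun φ hφ hcs hsub => ?_
    rw [← htest φ hφ.continuous hcs hsub, setIntegral_eq_integral_of_forall_compl_eq_zero]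
    · rfl
    · intro x hx
      rw [image_eq_zero_of_notMem_tsupport fun h => hx (hsub h), zero_mul]
  have heq : EqOn k (fun _ => 0) (Ici 0) := by
    refine Measure.eqOn_of_ae_eq (μ := volume) ?_ hkc.continuousOn continuousOn_const ?_
    · rw [EventuallyEq, ← restrict_Ioi_eq_restrict_Ici, ae_restrict_iff' measurableSet_Ioi]
      exact hae
    · rw [interior_Ici, closure_Ioi]
  have := heq hx
  simpa [hk, (Real.exp_pos _).ne'] using this

end Laplace

theorem hasDerivAt_of_eq_integral {f g : ℝ → ℝ} {c : ℝ} (hg : Continuous g)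
    (h : ∀ x, 0 ≤ x → f x = c + ∫ s in (0 : ℝ)..x, g s) {x : ℝ} (hx : 0 < x) :
    HasDerivAt f (g x) x := by
  have h1 : HasDerivAt (fun y => c + ∫ s in (0 : ℝ)..y, g s) (g x) x :=
    (hg.integral_hasStrictDerivAt 0 x).hasDerivAt.const_add c
  exact h1.congr_of_eventuallyEq ((eventually_gt_nhds hx).mono fun y hy => h y hy.le)

/-- Right-sided derivatives are compared, so that x = 0 is included. -/
theorem eq_of_integral_eq {f g : ℝ → ℝ} (hf : Continuous f) (hg : Continuous g)
    (h : ∀ x, 0 ≤ x → ∫ s in (0 : ℝ)..x, f s = ∫ s in (0 : ℝ)..x, g s) {x : ℝ} (hx : 0 ≤ x) :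
    f x = g x := by
  have h1 := ((hf.integral_hasStrictDerivAt 0 x).hasDerivAt).hasDerivWithinAt (s := Ici x)
  have h2 := ((hg.integral_hasStrictDerivAt 0 x).hasDerivAt).hasDerivWithinAt (s := Ici x)
  exact (uniqueDiffOn_Ici x x self_mem_Ici).eq_deriv _ h1
    (h2.congr (fun y hy => h y (hx.trans hy)) (h x hx))

/-! ### Memory equations and kernels of positive type. -/

/-- `u` solves `u' = -a u + r ∗ u` on `[0, ∞)` with `u(0) = 1`. -/
structure IsMemorySolution (a : ℝ) (r u : ℝ → ℝ) : Prop where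
  continuous : Continuous u
  eq : ∀ x, 0 ≤ x → u x = 1 + ∫ s in (0 : ℝ)..x, (-a * u s + causalConv r u s)

/-- The bilinear form `∫₀ˣ ∫₀ʸ u(x - s) u(y - t) f(s + t) dt ds`. -/
noncomputable def hankelForm (f u : ℝ → ℝ) (x y : ℝ) : ℝ :=
  ∫ s in (0 : ℝ)..x, ∫ t in (0 : ℝ)..y, u (x - s) * u (y - t) * f (s + t)

/-- The matrices `k(xᵢ, xⱼ)` with `xᵢ ≥ 0` are positive semidefinite. -/
def IsPosKernel (k : ℝ → ℝ → ℝ) : Prop :=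
  ∀ (n : ℕ) (c x : Fin n → ℝ), (∀ i, 0 ≤ x i) → 0 ≤ ∑ i, ∑ j, c i * c j * k (x i) (x j)

theorem IsPosKernel.congr {k l : ℝ → ℝ → ℝ} (hk : IsPosKernel k)
    (h : ∀ x y, 0 ≤ x → 0 ≤ y → l x y = k x y) : IsPosKernel l := by
  intro n c x hx
  simp_rw [fun i j => h (x i) (x j) (hx i) (hx j)]
  exact hk n c x hx

theorem IsPosKernel.add {k l : ℝ → ℝ → ℝ} (hk : IsPosKernel k) (hl : IsPosKernel l) :
    IsPosKernel fun x y => k x y + l x y := by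
  intro n c x hx
  simp_rw [mul_add, Finset.sum_add_distrib]
  exact add_nonneg (hk n c x hx) (hl n c x hx)

theorem IsPosKernel.const_mul {k : ℝ → ℝ → ℝ} (hk : IsPosKernel k) {a : ℝ} (ha : 0 ≤ a) :
    IsPosKernel fun x y => a * k x y := by
  intro n c x hx
  have : ∑ i, ∑ j, c i * c j * (a * k (x i) (x j)) = a * ∑ i, ∑ j, c i * c j * k (x i) (x j) := by
    simp_rw [Finset.mul_sum]
    exact Finset.sum_congr rfl fun i _ => Finset.sum_congr rfl fun j _ => by ring
  rw [this]
  exact mul_nonneg ha (hk n c x hx)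

theorem isPosKernel_mul_self (f : ℝ → ℝ) : IsPosKernel fun x y => f x * f y := by
  intro n c x _
  have : ∑ i, ∑ j, c i * c j * (f (x i) * f (x j)) = (∑ i, c i * f (x i)) ^ 2 := by
    rw [sq, Finset.sum_mul_sum]
    exact Finset.sum_congr rfl fun i _ => Finset.sum_congr rfl fun j _ => by ring
  rw [this]
  positivity

theorem isPosKernel_zero : IsPosKernel fun _ _ => 0 := by
  intro n c x _; simp

theorem IsPosKernel.of_tendsto {ι : Type*} {l : Filter ι} [l.NeBot] {k : ι → ℝ → ℝ → ℝ}
    {k' : ℝ → ℝ → ℝ} (hk : ∀ᶠ i in l, IsPosKernel (k i))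
    (h : ∀ x y, 0 ≤ x → 0 ≤ y → Tendsto (fun i => k i x y) l (𝓝 (k' x y))) : IsPosKernel k' := by
  intro n c x hx
  refine ge_of_tendsto (tendsto_finsetSum _ fun i _ => tendsto_finsetSum _ fun j _ =>
    (h (x i) (x j) (hx i) (hx j)).const_mul (c i * c j)) ?_
  filter_upwards [hk] with m hm using hm n c x hx

/-- Second differences of a kernel `f(x + y)` of positive type converge to `f''`, which is
therefore log-convex. -/
theorem tendsto_second_difference {f f₁ f₂ : ℝ → ℝ}
    (h₁ : ∀ x > 0, HasDerivAt f (f₁ x) x) (h₂ : ∀ x > 0, HasDerivAt f₁ (f₂ x) x)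
    (hc : ContinuousOn f₂ (Ioi 0)) {z : ℝ} (hz : 0 < z) :
    Tendsto (fun h => (f (z + 2 * h) - 2 * f (z + h) + f z) / h ^ 2) (𝓝[>] 0) (𝓝 (f₂ z)) := by
  -- The mean value theorem is applied twice: to f(· + h) - f on an interval of length h, then to
  -- f₁.
  have key : ∀ h > 0, ∃ ξ ∈ Ioo z (z + 2 * h), (f (z + 2 * h) - 2 * f (z + h) + f z) / h ^ 2
      = f₂ ξ := by
    intro h hh
    have hD : ∀ y > 0, HasDerivAt (fun y => f (y + h) - f y) (f₁ (y + h) - f₁ y) y := fun y hy =>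
      ((h₁ (y + h) (by positivity)).comp_add_const y h).sub (h₁ y hy)
    obtain ⟨η, hη, e1⟩ := exists_hasDerivAt_eq_slope (fun y => f (y + h) - f y)
      (fun y => f₁ (y + h) - f₁ y) (show z < z + h by linarith)
      (fun y hy => (hD y (hz.trans_le hy.1)).continuousAt.continuousWithinAt)
      (fun y hy => hD y (hz.trans hy.1))
    have hη0 : 0 < η := hz.trans hη.1
    obtain ⟨ξ, hξ, e2⟩ := exists_hasDerivAt_eq_slope f₁ f₂ (show η < η + h by linarith)
      (fun y hy => (h₂ y (hη0.trans_le hy.1)).continuousAt.continuousWithinAt)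
      (fun y hy => h₂ y (hη0.trans hy.1))
    refine ⟨ξ, ⟨hη.1.trans hξ.1, by linarith [hξ.2, hη.2]⟩, ?_⟩
    rw [e2, e1]
    have : z + h + h = z + 2 * h := by ring
    rw [this, add_sub_cancel_left, add_sub_cancel_left, div_div, ← sq]
    ring
  have hcz : ContinuousAt f₂ z := hc.continuousAt (Ioi_mem_nhds hz)
  rw [Metric.tendsto_nhds]
  intro ε hε
  obtain ⟨d, hd, hd'⟩ := Metric.continuousAt_iff.1 hcz ε hε
  have hm : Ioo (0 : ℝ) (d / 2) ∈ 𝓝[>] (0 : ℝ) := Ioo_mem_nhdsGT (by positivity)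
  filter_upwards [hm] with h hh
  obtain ⟨ξ, hξ, e⟩ := key h hh.1
  rw [e]
  refine hd' ?_
  rw [Real.dist_eq, abs_lt]
  constructor <;> linarith [hξ.1, hξ.2, hh.2]

theorem sq_le_mul_of_quadratic_nonneg {A B C : ℝ}
    (h : ∀ α β : ℝ, 0 ≤ α ^ 2 * A + 2 * (α * β) * B + β ^ 2 * C) : 0 ≤ A ∧ B ^ 2 ≤ A * C := by
  refine ⟨by simpa using h 1 0, ?_⟩
  have := discrim_le_zero (a := A) (b := 2 * B) (c := C) fun x => by
    have := h x 1; nlinarith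
  rw [discrim] at this
  nlinarith

theorem IsPosKernel.nonneg_and_sq_le {f : ℝ → ℝ} (hf : IsPosKernel fun x y => f (x + y))
    {x y : ℝ} (hx : 0 ≤ x) (hy : 0 ≤ y) :
    0 ≤ f (x + x) ∧ f (x + y) ^ 2 ≤ f (x + x) * f (y + y) := by
  refine sq_le_mul_of_quadratic_nonneg fun α β => ?_
  have := hf 2 ![α, β] ![x, y] (fun i => by fin_cases i <;> simpa)
  simp only [Fin.sum_univ_two, Matrix.cons_val_zero, Matrix.cons_val_one] at this
  rw [add_comm y x] at this
  linarith

/-- Testing positivity at x + h, x, y + h, y with coefficients α, -α, β, -β gives a quadratic form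
in α, β whose entries are second differences of f at 2x, x + y, 2y. Divide by h² and let h tend to
0. -/
theorem IsPosKernel.second_deriv {f f₁ f₂ : ℝ → ℝ} (hf : IsPosKernel fun x y => f (x + y))
    (h₁ : ∀ x > 0, HasDerivAt f (f₁ x) x) (h₂ : ∀ x > 0, HasDerivAt f₁ (f₂ x) x)
    (hc : ContinuousOn f₂ (Ioi 0)) {x y : ℝ} (hx : 0 < x) (hy : 0 < y) :
    0 ≤ f₂ (x + x) ∧ f₂ (x + y) ^ 2 ≤ f₂ (x + x) * f₂ (y + y) := by
  have hlim := fun z (hz : 0 < z) => tendsto_second_difference h₁ h₂ hc hz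
  refine sq_le_mul_of_quadratic_nonneg fun α β => ?_
  refine ge_of_tendsto ((((hlim (x + x) (by positivity)).const_mul (α ^ 2)).add
    ((hlim (x + y) (by positivity)).const_mul (2 * (α * β)))).add
    ((hlim (y + y) (by positivity)).const_mul (β ^ 2))) ?_
  filter_upwards [self_mem_nhdsWithin] with h hh
  have hh' : 0 < h := hh
  have := hf 4 ![α, -α, β, -β] ![x + h, x, y + h, y]
    (fun i => by fin_cases i <;> simp <;> positivity)
  simp only [Fin.sum_univ_four, Matrix.cons_val_zero, Matrix.cons_val_one, Matrix.cons_val] at this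
  have e1 : x + h + (x + h) = x + x + 2 * h := by ring
  have e2 : x + h + x = x + x + h := by ring
  have e3 : x + h + (y + h) = x + y + 2 * h := by ring
  have e4 : x + h + y = x + y + h := by ring
  have e5 : x + (x + h) = x + x + h := by ring
  have e6 : x + (y + h) = x + y + h := by ring
  have e7 : y + h + (x + h) = x + y + 2 * h := by ring
  have e8 : y + h + x = x + y + h := by ring
  have e9 : y + h + (y + h) = y + y + 2 * h := by ring
  have e10 : y + h + y = y + y + h := by ring
  have e11 : y + (x + h) = x + y + h := by ring
  have e12 : y + x = x + y := by ring
  have e13 : y + (y + h) = y + y + h := by ring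
  rw [e1, e2, e3, e4, e5, e6, e7, e8, e9, e10, e11, e12, e13] at this
  have : 0 ≤ (α ^ 2 * (f (x + x + 2 * h) - 2 * f (x + x + h) + f (x + x))
      + 2 * (α * β) * (f (x + y + 2 * h) - 2 * f (x + y + h) + f (x + y))
      + β ^ 2 * (f (y + y + 2 * h) - 2 * f (y + y + h) + f (y + y))) / h ^ 2 := by
    apply div_nonneg _ (by positivity)
    linarith
  refine this.trans_eq ?_
  ring

namespace IsMemorySolution

variable {a : ℝ} {r u : ℝ → ℝ}

theorem apply_zero (hu : IsMemorySolution a r u) : u 0 = 1 := by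
  simpa using hu.eq 0 le_rfl

/-- Integrating the memory term once turns the equation into u = 1 + κ ∗ u with κ = -a + ∫ r, which
makes u a resolvent. -/
theorem eq_causalConv (hu : IsMemorySolution a r u) (hr : Continuous r) {x : ℝ} (hx : 0 ≤ x) :
    u x = 1 + causalConv (fun z => -a + ∫ s in (0 : ℝ)..z, r s) u x := by
  have hu' := hu.continuous
  have hrc : Continuous fun z => ∫ s in (0 : ℝ)..z, r s := by fun_prop
  rw [hu.eq x hx, causalConv_comm, causalConv_add_right hu' continuous_const hrc,
    causalConv_integral hu' hr hx,
    intervalIntegral.integral_add (Continuous.intervalIntegrable (by fun_prop) _ _)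
      (Continuous.intervalIntegrable (by fun_prop) _ _)]
  congr 2
  · simp [causalConv, mul_comm]
  · exact intervalIntegral.integral_congr fun s _ => causalConv_comm _ _ _

/-- The shift F = u(· + y) solves the same Volterra equation as u, with the source 1 replaced by
u(y) + ∫ g, where g records the memory of the interval [0, y]. Variation of constants with u as
resolvent gives F = u(y) u + u ∗ g. -/
theorem apply_add (hu : IsMemorySolution a r u) (hr : Continuous r) {x y : ℝ} (hx : 0 ≤ x)
    (hy : 0 ≤ y) : u (x + y) = u x * u y + hankelForm r u x y := by
  have hu' := hu.continuous
  set κ : ℝ → ℝ := fun z => -a + ∫ s in (0 : ℝ)..z, r s with hκ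
  have hκc : Continuous κ := by fun_prop
  set F : ℝ → ℝ := fun z => u (z + y) with hF
  have hFc : Continuous F := by fun_prop
  set g : ℝ → ℝ := fun z => ∫ t in (0 : ℝ)..y, r (z + t) * u (y - t) with hg
  have hgc : Continuous g := by
    refine intervalIntegral.continuous_parametric_intervalIntegral_of_continuous
      (f := fun z t => r (z + t) * u (y - t)) ?_ continuous_const
    simp only [Function.uncurry_def]
    fun_prop
  have hGc : Continuous fun z => ∫ s in (0 : ℝ)..z, g s := by fun_prop
  -- The convolution κ ∗ u at z + y is cut at z; in the remaining piece κ(z + t) - κ(t) is the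
  -- integral of r over [t, t + z].
  have hsplit : ∀ z, 0 ≤ z →
      F z = (u y + ∫ s in (0 : ℝ)..z, g s) + causalConv κ F z := by
    intro z hz
    have h1 := hu.eq_causalConv hr (add_nonneg hz hy)
    have h2 := hu.eq_causalConv hr hy
    rw [← hκ] at h1 h2
    have hi : ∀ p q, IntervalIntegrable (fun s => κ s * u (z + y - s)) volume p q := fun p q =>
      Continuous.intervalIntegrable (by fun_prop) _ _
    have h3 : causalConv κ u (z + y)
        = causalConv κ F z + ∫ t in (0 : ℝ)..y, κ (z + t) * u (y - t) := by
      unfold causalConv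
      rw [← intervalIntegral.integral_add_adjacent_intervals (hi 0 z) (hi z (z + y))]
      congr 1
      · refine intervalIntegral.integral_congr fun s _ => ?_
        simp only [hF]
        congr 2; ring
      · have := intervalIntegral.integral_comp_add_left (a := 0) (b := y)
          (fun s => κ s * u (z + y - s)) z
        rw [add_zero] at this
        rw [← this]
        refine intervalIntegral.integral_congr fun s _ => ?_
        congr 2; ring
    have h4 : ∫ t in (0 : ℝ)..y, κ (z + t) * u (y - t)
        = causalConv κ u y + ∫ s in (0 : ℝ)..z, g s := by
      have hswap : ∫ s in (0 : ℝ)..z, g s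
          = ∫ t in (0 : ℝ)..y, ∫ s in (0 : ℝ)..z, r (s + t) * u (y - t) := by
        refine intervalIntegral_intervalIntegral_swap ?_
        refine (ContinuousOn.integrableOn_compact (isCompact_uIcc.prod isCompact_uIcc) ?_).mono_set
          (prod_mono uIoc_subset_uIcc uIoc_subset_uIcc)
        simp only [Function.uncurry_def]
        fun_prop
      rw [hswap, causalConv, ← intervalIntegral.integral_add]
      · refine intervalIntegral.integral_congr fun t _ => ?_
        rw [intervalIntegral.integral_mul_const, ← add_mul]
        congr 1
        simp only [hκ]
        rw [intervalIntegral.integral_comp_add_right (fun s => r s), zero_add, add_assoc,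
          intervalIntegral.integral_add_adjacent_intervals (hr.intervalIntegrable _ _)
            (hr.intervalIntegrable _ _)]
      · exact Continuous.intervalIntegrable (by fun_prop) _ _
      · refine Continuous.intervalIntegrable ?_ _ _
        refine intervalIntegral.continuous_parametric_intervalIntegral_of_continuous
          (f := fun t s => r (s + t) * u (y - t)) ?_ continuous_const
        simp only [Function.uncurry_def]
        fun_prop
    simp only [hF]
    rw [h1, h3, h4]
    linarith
  -- Convolving the equation for F with u and using u = 1 + κ ∗ u, the term u ∗ (κ ∗ F) appears on
  -- both sides; after cancelling, only the primitive of F remains.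
  have hint : ∀ z, 0 ≤ z → ∫ s in (0 : ℝ)..z, F s
      = ∫ s in (0 : ℝ)..z, (u y * u s + causalConv u g s) := by
    intro z hz
    have h1 : causalConv u F z = causalConv u (fun z => u y + ∫ s in (0 : ℝ)..z, g s) z
        + causalConv u (causalConv κ F) z := by
      rw [← causalConv_add_right hu' (by fun_prop) (by fun_prop)]
      exact causalConv_congr hz (fun _ _ => rfl) hsplit
    have h2 : causalConv u F z = (∫ s in (0 : ℝ)..z, F s) + causalConv u (causalConv κ F) z := by
      rw [← causalConv_assoc hu' hκc hFc hz, causalConv_comm (causalConv u κ), ← causalConv_one_left,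
        causalConv_comm (fun _ => (1 : ℝ)) F,
        ← causalConv_add_right hFc (by fun_prop) (by fun_prop), causalConv_comm]
      refine causalConv_congr hz (fun _ _ => rfl) fun s hs => ?_
      rw [causalConv_comm]
      exact hu.eq_causalConv hr hs
    have h3 : causalConv u (fun z => u y + ∫ s in (0 : ℝ)..z, g s) z
        = ∫ s in (0 : ℝ)..z, (u y * u s + causalConv u g s) := by
      rw [causalConv_add_right hu' continuous_const hGc, causalConv_integral hu' hgc hz,
        intervalIntegral.integral_add (Continuous.intervalIntegrable (by fun_prop) _ _)
        (Continuous.intervalIntegrable (by fun_prop) _ _)]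
      congr 1
      simp [causalConv, mul_comm]
    linarith
  have hfin : u (x + y) = u y * u x + causalConv u g x :=
    eq_of_integral_eq hFc (g := fun s => u y * u s + causalConv u g s) (by fun_prop) hint hx
  rw [hfin, mul_comm (u y), causalConv_comm]
  congr 1
  unfold causalConv hankelForm
  refine intervalIntegral.integral_congr fun s _ => ?_
  simp only [hg]
  rw [← intervalIntegral.integral_mul_const]
  exact intervalIntegral.integral_congr fun t _ => by ring

/-- By `apply_add` the kernel is a rank-one kernel plus the Hankel form of r. -/
theorem isPosKernel (hu : IsMemorySolution a r u) (hr : Continuous r)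
    (hpos : IsPosKernel (hankelForm r u)) : IsPosKernel fun x y => u (x + y) :=
  ((isPosKernel_mul_self u).add hpos).congr fun _ _ hx hy => hu.apply_add hr hx hy

end IsMemorySolution

/-! ### Regularity of solutions and inversion of the Laplace transform. -/

section Regularity

variable {a : ℝ} {r u : ℝ → ℝ}

theorem hasDerivAt_causalConv {f g g' : ℝ → ℝ} {c : ℝ} (hf : Continuous f) (hg' : Continuous g')
    (hg : ∀ x, 0 ≤ x → g x = c + ∫ s in (0 : ℝ)..x, g' s) {x : ℝ} (hx : 0 < x) :
    HasDerivAt (causalConv f g) (c * f x + causalConv f g' x) x := by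
  refine hasDerivAt_of_eq_integral (c := 0) (g := fun x => c * f x + causalConv f g' x)
    (by fun_prop) (fun y hy => ?_) hx
  rw [causalConv_congr (f₂ := f) hy (fun _ _ => rfl) hg,
    causalConv_add_right hf (by fun_prop) (by fun_prop), causalConv_integral hf hg' hy,
    intervalIntegral.integral_add (Continuous.intervalIntegrable (by fun_prop) _ _)
      (Continuous.intervalIntegrable (by fun_prop) _ _)]
  simp [causalConv, mul_comm]

theorem eq_add_integral_of_hasDerivAt {f f' : ℝ → ℝ} (hf : Continuous f) (hf' : Continuous f')
    (h : ∀ x > 0, HasDerivAt f (f' x) x) {x : ℝ} (hx : 0 ≤ x) :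
    f x = f 0 + ∫ s in (0 : ℝ)..x, f' s := by
  rw [intervalIntegral.integral_eq_sub_of_hasDerivAt_of_le hx hf.continuousOn
    (fun y hy => h y hy.1) (hf'.intervalIntegrable _ _)]
  ring

theorem causalConv_zero (f g : ℝ → ℝ) : causalConv f g 0 = 0 := by simp [causalConv]

/-- Solutions of the memory equation are twice continuously differentiable up to the origin, and
three times differentiable away from it if `r` is differentiable there. -/
theorem IsMemorySolution.exists_derivs (hu : IsMemorySolution a r u) (hr : Continuous r)
    {r' : ℝ → ℝ} (hr' : ∀ x > 0, HasDerivAt r (r' x) x) :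
    ∃ u₁ u₂ u₃ : ℝ → ℝ, Continuous u₁ ∧ Continuous u₂ ∧ u₁ 0 = -a ∧ u₂ 0 = a ^ 2 + r 0 ∧
      (∀ x > 0, HasDerivAt u (u₁ x) x) ∧ (∀ x > 0, HasDerivAt u₁ (u₂ x) x) ∧
      ∀ x > 0, HasDerivAt u₂ (u₃ x) x := by
  have hu' := hu.continuous
  set u₁ : ℝ → ℝ := fun x => -a * u x + causalConv r u x with h₁
  have hc₁ : Continuous u₁ := by fun_prop
  set u₂ : ℝ → ℝ := fun x => -a * u₁ x + (1 * r x + causalConv r u₁ x) with h₂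
  have hc₂ : Continuous u₂ := by fun_prop
  have hd : ∀ x > 0, HasDerivAt u (u₁ x) x := fun x hx =>
    hasDerivAt_of_eq_integral hc₁ hu.eq hx
  have hd₁ : ∀ x > 0, HasDerivAt u₁ (u₂ x) x := fun x hx =>
    ((hd x hx).const_mul (-a)).add (hasDerivAt_causalConv hr hc₁ hu.eq hx)
  have e₁ : u₁ 0 = -a := by simp [h₁, causalConv_zero, hu.apply_zero]
  -- Convolutions are differentiated through the solution and never through r, whose derivative may
  -- be singular at 0; r' enters only as a pointwise term.
  refine ⟨u₁, u₂, fun x => -a * u₂ x + (1 * r' x + (u₁ 0 * r x + causalConv r u₂ x)), hc₁, hc₂, e₁,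
    ?_, hd, hd₁, fun x hx => ?_⟩
  · simp only [h₂, e₁, causalConv_zero]; ring
  · exact ((hd₁ x hx).const_mul (-a)).add (((hr' x hx).const_mul 1).add
      (hasDerivAt_causalConv hr hc₂
        (fun y hy => eq_add_integral_of_hasDerivAt hc₁ hc₂ hd₁ hy) hx))

/-- A solution of `s w + c ∫ w = x + ∫ (r ∗ w)` is `s⁻¹ ∫ u` for a solution `u` of the memory
equation. -/
theorem exists_isMemorySolution {w : ℝ → ℝ} {s c : ℝ} (hs : 0 < s) (hw : Continuous w)
    (hr : Continuous r)
    (h : ∀ x, 0 ≤ x → s * w x + c * ∫ y in (0 : ℝ)..x, w y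
      = x + ∫ y in (0 : ℝ)..x, causalConv r w y) :
    ∃ u, IsMemorySolution (c / s) (fun x => s⁻¹ * r x) u ∧
      ∀ x, 0 ≤ x → w x = s⁻¹ * ∫ y in (0 : ℝ)..x, u y := by
  -- This is what s w' must be, read off by formally differentiating the equation.
  set u : ℝ → ℝ := fun x => 1 - c * w x + causalConv r w x with hu
  have huc : Continuous u := by fun_prop
  have hwu : ∀ x, 0 ≤ x → w x = s⁻¹ * ∫ y in (0 : ℝ)..x, u y := by
    intro x hx
    have h1 : ∫ y in (0 : ℝ)..x, u y
        = x - c * (∫ y in (0 : ℝ)..x, w y) + ∫ y in (0 : ℝ)..x, causalConv r w y := by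
      simp only [hu]
      rw [intervalIntegral.integral_add (Continuous.intervalIntegrable (by fun_prop) _ _)
        (Continuous.intervalIntegrable (by fun_prop) _ _),
        intervalIntegral.integral_sub (Continuous.intervalIntegrable (by fun_prop) _ _)
        (Continuous.intervalIntegrable (by fun_prop) _ _), intervalIntegral.integral_const_mul]
      simp
    rw [h1, eq_inv_mul_iff_mul_eq₀ hs.ne']
    linarith [h x hx]
  refine ⟨u, ⟨huc, fun x hx => ?_⟩, hwu⟩
  have h2 : causalConv r w x = s⁻¹ * ∫ y in (0 : ℝ)..x, causalConv r u y := by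
    rw [causalConv_congr (f₂ := r) hx (fun _ _ => rfl) hwu, causalConv_smul_right,
      causalConv_integral hr huc hx]
  rw [intervalIntegral.integral_add (Continuous.intervalIntegrable (by fun_prop) _ _)
    (Continuous.intervalIntegrable (by fun_prop) _ _)]
  simp_rw [causalConv_smul_left]
  rw [intervalIntegral.integral_const_mul, intervalIntegral.integral_const_mul, ← h2]
  have : u x = 1 - c * w x + causalConv r w x := rfl
  rw [this, hwu x hx]
  field_simp
  ring

/-- Inversion of the Laplace transform `ŵ(θ) = 1 / (θ (s θ + c - r̂(θ)))`. -/
theorem integral_equation_of_laplaceTransform {w : ℝ → ℝ} {s c θ₀ : ℝ} (hθ₀ : 0 ≤ θ₀)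
    (hw : Continuous w) (hr : Continuous r) (hwi : ∀ θ > θ₀, LaplaceIntegrable w θ)
    (hri : ∀ θ > θ₀, LaplaceIntegrable r θ)
    (h : ∀ θ > θ₀, (s * θ + c - laplaceTransform r θ) * laplaceTransform w θ = 1 / θ)
    {x : ℝ} (hx : 0 ≤ x) :
    s * w x + c * ∫ y in (0 : ℝ)..x, w y = x + ∫ y in (0 : ℝ)..x, causalConv r w y := by
  set one : ℝ → ℝ := fun _ => 1 with hone
  -- The difference of the two sides of the claim, written with convolutions so that its transform
  -- is computed term by term; it vanishes beyond θ₀.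
  set G : ℝ → ℝ := fun x => (s * w x + c * causalConv one w x)
    + ((-1) * causalConv one one x + (-1) * causalConv one (causalConv r w) x) with hG
  have hoc : Continuous one := continuous_const
  have hGc : Continuous G := by fun_prop
  have hint : ∀ θ > θ₀, LaplaceIntegrable G θ ∧ laplaceTransform G θ = 0 := by
    intro θ hθ
    have hθ' : 0 < θ := hθ₀.trans_lt hθ
    have i1 : LaplaceIntegrable one θ := laplaceIntegrable_one hθ'
    have iw := hwi θ hθ
    have ir := hri θ hθ
    have j1 := iw.const_mul s
    have j2 := (i1.causalConv iw).const_mul c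
    have j3 := (i1.causalConv i1).const_mul (-1)
    have j4 := (i1.causalConv (ir.causalConv iw)).const_mul (-1)
    refine ⟨(j1.add j2).add (j3.add j4), ?_⟩
    simp only [hG]
    rw [laplaceTransform_add (j1.add j2) (j3.add j4), laplaceTransform_add j1 j2,
      laplaceTransform_add j3 j4]
    simp only [laplaceTransform_const_mul]
    rw [laplaceTransform_causalConv i1 iw, laplaceTransform_causalConv i1 i1,
      laplaceTransform_causalConv i1 (ir.causalConv iw), laplaceTransform_causalConv ir iw,
      laplaceTransform_one hθ']
    have := h θ hθ
    field_simp at this ⊢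
    linarith
  have := eq_zero_of_laplaceTransform_eq_zero hGc (fun θ hθ => (hint θ hθ).1)
    (fun θ hθ => (hint θ hθ).2) hx
  simp only [hG, hone, causalConv_one_left] at this
  simp at this
  linarith

end Regularity

/-! ### Taylor expansion of completely monotone functions. -/

/-- `ρ` is completely monotone on `(0, ∞)`. -/
structure IsCompletelyMonotone (ρ : ℝ → ℝ) : Prop where
  contDiffOn : ContDiffOn ℝ ∞ ρ (Ioi 0)
  nonneg_iteratedDeriv : ∀ (n : ℕ) (x : ℝ), 0 < x → 0 ≤ (-1 : ℝ) ^ n * iteratedDeriv n ρ x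

namespace IsCompletelyMonotone

variable {ρ : ℝ → ℝ}

theorem nonneg (hρ : IsCompletelyMonotone ρ) {x : ℝ} (hx : 0 < x) : 0 ≤ ρ x := by
  simpa using hρ.nonneg_iteratedDeriv 0 x hx

theorem contDiffAt (hρ : IsCompletelyMonotone ρ) {x : ℝ} (hx : 0 < x) : ContDiffAt ℝ ∞ ρ x :=
  hρ.contDiffOn.contDiffAt (Ioi_mem_nhds hx)

theorem continuousOn (hρ : IsCompletelyMonotone ρ) : ContinuousOn ρ (Ioi 0) :=
  hρ.contDiffOn.continuousOn

theorem antitoneOn (hρ : IsCompletelyMonotone ρ) : AntitoneOn ρ (Ioi 0) := by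
  refine antitoneOn_of_deriv_nonpos (convex_Ioi 0) hρ.continuousOn ?_ ?_
  · rw [interior_Ioi]
    exact hρ.contDiffOn.differentiableOn (by simp)
  · intro x hx
    rw [interior_Ioi] at hx
    have := hρ.nonneg_iteratedDeriv 1 x hx
    rw [iteratedDeriv_one] at this
    linarith

/-- The expansion is centred at the right end L: powers of L - y absorb the alternating signs, so
every term and the remainder are nonnegative. -/
theorem taylor_remainder (hρ : IsCompletelyMonotone ρ) {y L : ℝ} (hy : 0 < y) (hyL : y < L)
    (n : ℕ) :
    ρ y - ∑ k ∈ Finset.range (n + 1),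
        ((-1) ^ k * iteratedDeriv k ρ L / k.factorial) * (L - y) ^ k
      = ∫ t in y..L, ((-1) ^ (n + 1) * iteratedDeriv (n + 1) ρ t) * ((t - y) ^ n / n.factorial) := by
  have hsub : uIcc L y ⊆ Ioi 0 := by
    rw [uIcc_of_ge hyL.le]; intro t ht; exact hy.trans_le ht.1
  have hu : UniqueDiffOn ℝ (uIcc L y) := uniqueDiffOn_uIcc hyL.ne'
  have hcd : ContDiffOn ℝ (n + 1 : ℕ) ρ (uIcc L y) :=
    (hρ.contDiffOn.mono hsub).of_le (by exact_mod_cast le_top)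
  have hder (k : ℕ) {t : ℝ} (ht : t ∈ uIcc L y) :
      iteratedDerivWithin k ρ (uIcc L y) t = iteratedDeriv k ρ t :=
    iteratedDerivWithin_eq_iteratedDeriv hu
      ((hρ.contDiffAt (hsub ht)).of_le (by exact_mod_cast le_top)) ht
  have h := taylor_integral_remainder hcd
  rw [taylor_within_apply] at h
  have e1 : ∑ k ∈ Finset.range (n + 1),
      ((k.factorial : ℝ)⁻¹ * (y - L) ^ k) • iteratedDerivWithin k ρ (uIcc L y) L
      = ∑ k ∈ Finset.range (n + 1),
        ((-1) ^ k * iteratedDeriv k ρ L / k.factorial) * (L - y) ^ k := by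
    refine Finset.sum_congr rfl fun k _ => ?_
    rw [hder k left_mem_uIcc, show y - L = (-1) * (L - y) by ring, mul_pow, smul_eq_mul]
    ring
  rw [e1] at h
  rw [h, intervalIntegral.integral_symm, ← intervalIntegral.integral_neg]
  refine intervalIntegral.integral_congr fun t ht => ?_
  rw [uIcc_comm] at ht
  rw [hder (n + 1) ht, show y - t = (-1) * (t - y) by ring, mul_pow, smul_eq_mul]
  ring

theorem remainder_integrable (hρ : IsCompletelyMonotone ρ) {y z L : ℝ} (hy : 0 < y) (hyL : y ≤ L)
    (n : ℕ) : IntervalIntegrable (fun t => ((-1) ^ (n + 1) * iteratedDeriv (n + 1) ρ t) *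
      ((t - z) ^ n / n.factorial)) volume y L := by
  refine ContinuousOn.intervalIntegrable ?_
  have : ContinuousOn (iteratedDeriv (n + 1) ρ) (uIcc y L) := by
    have h := (hρ.contDiffOn.continuousOn_iteratedDerivWithin (m := n + 1)
      (by exact_mod_cast le_top) (uniqueDiffOn_Ioi 0)).congr
        (iteratedDerivWithin_of_isOpen isOpen_Ioi).symm
    refine h.mono ?_
    rw [uIcc_of_le hyL]
    exact fun t ht => hy.trans_le ht.1
  fun_prop

theorem sum_le (hρ : IsCompletelyMonotone ρ) {y L : ℝ} (hy : 0 < y) (hyL : y < L) (n : ℕ) :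
    ∑ k ∈ Finset.range (n + 1),
        ((-1) ^ k * iteratedDeriv k ρ L / k.factorial) * (L - y) ^ k ≤ ρ y := by
  rw [← sub_nonneg, hρ.taylor_remainder hy hyL]
  refine intervalIntegral.integral_nonneg hyL.le fun t ht => ?_
  exact mul_nonneg (hρ.nonneg_iteratedDeriv _ _ (hy.trans_le ht.1))
    (div_nonneg (pow_nonneg (sub_nonneg.2 ht.1) _) (Nat.cast_nonneg _))

theorem sum_nonneg (hρ : IsCompletelyMonotone ρ) {y L : ℝ} (hy : 0 < y) (hyL : y ≤ L) (n : ℕ) :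
    0 ≤ ∑ k ∈ Finset.range (n + 1),
        ((-1) ^ k * iteratedDeriv k ρ L / k.factorial) * (L - y) ^ k :=
  Finset.sum_nonneg fun k _ => mul_nonneg
    (div_nonneg (hρ.nonneg_iteratedDeriv k L (hy.trans_le hyL)) (Nat.cast_nonneg _))
    (pow_nonneg (sub_nonneg.2 hyL) _)

/-- The Taylor series of a completely monotone function converges to it on the left of the centre
(S. Bernstein). -/
theorem tendsto_taylor (hρ : IsCompletelyMonotone ρ) {y L : ℝ} (hy : 0 < y) (hyL : y ≤ L) :
    Tendsto (fun n : ℕ => ∑ k ∈ Finset.range (n + 1),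
        ((-1) ^ k * iteratedDeriv k ρ L / k.factorial) * (L - y) ^ k) atTop (𝓝 (ρ y)) := by
  rcases hyL.eq_or_lt with rfl | hyL
  · refine tendsto_const_nhds.congr fun n => ?_
    rw [Finset.sum_eq_single 0]
    · simp
    · intro k _ hk; simp [hk]
    · simp
  -- An auxiliary point left of y. On [y, L] one has t - y ≤ p (t - z) with p = (L - y)/(L - z) < 1,
  -- so the n-th remainder at y is at most pⁿ times the one at z, which is at most ρ(z).
  set z := y / 2 with hz
  have hz0 : 0 < z := by positivity
  have hzy : z < y := by linarith
  set p := (L - y) / (L - z) with hp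
  have hp0 : 0 ≤ p := div_nonneg (by linarith) (by linarith)
  have hp1 : p < 1 := by rw [hp, div_lt_one (by linarith)]; linarith
  have hb : ∀ n : ℕ, ρ y - ∑ k ∈ Finset.range (n + 1),
        ((-1) ^ k * iteratedDeriv k ρ L / k.factorial) * (L - y) ^ k ≤ p ^ n * ρ z := by
    intro n
    rw [hρ.taylor_remainder hy hyL]
    have hpt : ∀ t ∈ Icc y L,
        ((-1) ^ (n + 1) * iteratedDeriv (n + 1) ρ t) * ((t - y) ^ n / n.factorial)
        ≤ p ^ n * (((-1) ^ (n + 1) * iteratedDeriv (n + 1) ρ t) *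
          ((t - z) ^ n / n.factorial)) := by
      intro t ht
      have h1 := hρ.nonneg_iteratedDeriv (n + 1) t (hy.trans_le ht.1)
      have h2 : t - y ≤ p * (t - z) := by
        rw [hp, div_mul_eq_mul_div, le_div_iff₀ (by linarith)]
        nlinarith [ht.1, ht.2]
      have h3 : (t - y) ^ n ≤ p ^ n * (t - z) ^ n := by
        rw [← mul_pow]
        exact pow_le_pow_left₀ (sub_nonneg.2 ht.1) h2 n
      calc _ ≤ ((-1) ^ (n + 1) * iteratedDeriv (n + 1) ρ t) *
            ((p ^ n * (t - z) ^ n) / n.factorial) := by gcongr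
        _ = _ := by ring
    calc _ ≤ ∫ t in y..L, p ^ n * (((-1) ^ (n + 1) * iteratedDeriv (n + 1) ρ t) *
          ((t - z) ^ n / n.factorial)) :=
          intervalIntegral.integral_mono_on hyL.le (hρ.remainder_integrable hy hyL.le n)
            ((hρ.remainder_integrable hy hyL.le n).const_mul _) hpt
      _ = p ^ n * ∫ t in y..L, (((-1) ^ (n + 1) * iteratedDeriv (n + 1) ρ t) *
          ((t - z) ^ n / n.factorial)) := intervalIntegral.integral_const_mul _ _
      _ ≤ p ^ n * ∫ t in z..L, (((-1) ^ (n + 1) * iteratedDeriv (n + 1) ρ t) *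
          ((t - z) ^ n / n.factorial)) := by
          refine mul_le_mul_of_nonneg_left ?_ (pow_nonneg hp0 n)
          refine intervalIntegral.integral_mono_interval hzy.le hyL.le le_rfl ?_
            (hρ.remainder_integrable hz0 (hzy.trans hyL).le n)
          refine (ae_restrict_iff' measurableSet_Ioc).2 (Eventually.of_forall fun t ht => ?_)
          exact mul_nonneg (hρ.nonneg_iteratedDeriv _ _ (hz0.trans ht.1))
            (div_nonneg (pow_nonneg (sub_nonneg.2 ht.1.le) _) (Nat.cast_nonneg _))
      _ ≤ p ^ n * ρ z := by
          refine mul_le_mul_of_nonneg_left ?_ (pow_nonneg hp0 n)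
          rw [← hρ.taylor_remainder hz0 (hzy.trans hyL)]
          linarith [hρ.sum_nonneg hz0 (hzy.trans hyL).le n]
  have hlim : Tendsto (fun n : ℕ => ρ y - p ^ n * ρ z) atTop (𝓝 (ρ y)) := by
    simpa using ((tendsto_pow_atTop_nhds_zero_of_lt_one hp0 hp1).mul_const (ρ z)).const_sub (ρ y)
  exact tendsto_of_tendsto_of_tendsto_of_le_of_le hlim tendsto_const_nhds
    (fun n => by have := hb n; simp only; linarith) (fun n => hρ.sum_le hy hyL n)

end IsCompletelyMonotone

/-! ### Positivity of Hankel forms of mixtures of exponentials. -/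

section HankelForm

variable {u : ℝ → ℝ}

/-- An exponential of s + t factors, so its Hankel form has rank one. -/
theorem hankelForm_exp (u : ℝ → ℝ) (b x y : ℝ) :
    hankelForm (fun z => Real.exp (-b * z)) u x y
      = (∫ s in (0 : ℝ)..x, u (x - s) * Real.exp (-b * s))
        * ∫ s in (0 : ℝ)..y, u (y - s) * Real.exp (-b * s) := by
  unfold hankelForm
  rw [← intervalIntegral.integral_mul_const]
  refine intervalIntegral.integral_congr fun s _ => ?_
  rw [← intervalIntegral.integral_const_mul]
  refine intervalIntegral.integral_congr fun t _ => ?_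
  simp only
  rw [show -b * (s + t) = -b * s + -b * t by ring, Real.exp_add]
  ring

theorem continuous_hankelForm_integrand {f : ℝ → ℝ} (hf : Continuous f) (hu : Continuous u)
    (x y : ℝ) : Continuous fun s => ∫ t in (0 : ℝ)..y, u (x - s) * u (y - t) * f (s + t) := by
  refine intervalIntegral.continuous_parametric_intervalIntegral_of_continuous
    (f := fun s t => u (x - s) * u (y - t) * f (s + t)) ?_ continuous_const
  simp only [Function.uncurry_def]
  fun_prop

theorem hankelForm_add {f g : ℝ → ℝ} (hf : Continuous f) (hg : Continuous g) (hu : Continuous u)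
    (x y : ℝ) : hankelForm (fun z => f z + g z) u x y = hankelForm f u x y + hankelForm g u x y := by
  unfold hankelForm
  rw [← intervalIntegral.integral_add
    ((continuous_hankelForm_integrand hf hu x y).intervalIntegrable _ _)
    ((continuous_hankelForm_integrand hg hu x y).intervalIntegrable _ _)]
  refine intervalIntegral.integral_congr fun s _ => ?_
  simp only
  rw [← intervalIntegral.integral_add (Continuous.intervalIntegrable (by fun_prop) _ _)
    (Continuous.intervalIntegrable (by fun_prop) _ _)]
  exact intervalIntegral.integral_congr fun t _ => mul_add _ _ _

theorem hankelForm_const_mul (f u : ℝ → ℝ) (a x y : ℝ) :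
    hankelForm (fun z => a * f z) u x y = a * hankelForm f u x y := by
  unfold hankelForm
  simp only [← intervalIntegral.integral_const_mul]
  exact intervalIntegral.integral_congr fun s _ =>
    intervalIntegral.integral_congr fun t _ => by ring

theorem isPosKernel_hankelForm_exp (u : ℝ → ℝ) (b : ℝ) :
    IsPosKernel (hankelForm (fun z => Real.exp (-b * z)) u) :=
  (isPosKernel_mul_self _).congr fun x y _ _ => hankelForm_exp u b x y

theorem isPosKernel_hankelForm_sum (hu : Continuous u) {d : ℕ → ℝ} (hd : ∀ k, 0 ≤ d k) (b : ℝ)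
    (n : ℕ) : IsPosKernel
      (hankelForm (fun z => ∑ k ∈ Finset.range n, d k * Real.exp (-b * z) ^ k) u) := by
  induction n with
  | zero => exact isPosKernel_zero.congr fun x y _ _ => by simp [hankelForm]
  | succ n ih =>
    refine (ih.add ((isPosKernel_hankelForm_exp u (n * b)).const_mul (hd n))).congr
      fun x y _ _ => ?_
    simp only [Finset.sum_range_succ]
    rw [hankelForm_add (by fun_prop) (by fun_prop) hu, hankelForm_const_mul]
    congr 3
    ext z
    rw [← Real.exp_nat_mul]
    congr 1; ring

theorem tendsto_hankelForm {ι : Type*} {l : Filter ι} [l.IsCountablyGenerated] {F : ι → ℝ → ℝ}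
    {f : ℝ → ℝ} {C : ℝ} (hu : Continuous u) (hF : ∀ᶠ i in l, Continuous (F i))
    (hC : ∀ᶠ i in l, ∀ z, 0 ≤ z → |F i z| ≤ C)
    (hlim : ∀ z, 0 ≤ z → Tendsto (fun i => F i z) l (𝓝 (f z))) {x y : ℝ} (hx : 0 ≤ x)
    (hy : 0 ≤ y) : Tendsto (fun i => hankelForm (F i) u x y) l (𝓝 (hankelForm f u x y)) := by
  have hbd (s : ℝ) (i : ι) (hi : ∀ z, 0 ≤ z → |F i z| ≤ C) (hs : 0 ≤ s) :
      ∀ t ∈ uIoc (0 : ℝ) y, ‖u (x - s) * u (y - t) * F i (s + t)‖ ≤ |u (x - s)| * |u (y - t)| * C := by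
    intro t ht
    rw [uIoc_of_le hy] at ht
    rw [norm_mul, norm_mul]
    exact mul_le_mul_of_nonneg_left (hi _ (add_nonneg hs ht.1.le)) (by positivity)
  unfold hankelForm
  refine intervalIntegral.tendsto_integral_filter_of_dominated_convergence
    (fun s => ∫ t in (0 : ℝ)..y, |u (x - s)| * |u (y - t)| * C) ?_ ?_ ?_ ?_
  · filter_upwards [hF] with i hi
    exact (continuous_hankelForm_integrand hi hu x y).aestronglyMeasurable
  · filter_upwards [hC] with i hi
    refine Eventually.of_forall fun s hs => ?_
    rw [uIoc_of_le hx] at hs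
    refine intervalIntegral.norm_integral_le_of_norm_le hy ?_
      (Continuous.intervalIntegrable (by fun_prop) _ _)
    refine Eventually.of_forall fun t ht => hbd s i hi hs.1.le t ?_
    rwa [uIoc_of_le hy]
  · refine Continuous.intervalIntegrable ?_ _ _
    refine intervalIntegral.continuous_parametric_intervalIntegral_of_continuous
      (f := fun s t => |u (x - s)| * |u (y - t)| * C) ?_ continuous_const
    simp only [Function.uncurry_def]
    fun_prop
  · refine Eventually.of_forall fun s hs => ?_
    rw [uIoc_of_le hx] at hs
    refine intervalIntegral.tendsto_integral_filter_of_dominated_convergence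
      (fun t => |u (x - s)| * |u (y - t)| * C) ?_ ?_ ?_ ?_
    · filter_upwards [hF] with i hi
      exact Continuous.aestronglyMeasurable (by fun_prop)
    · filter_upwards [hC] with i hi
      exact Eventually.of_forall fun t ht => hbd s i hi hs.1.le t ht
    · exact Continuous.intervalIntegrable (by fun_prop) _ _
    · refine Eventually.of_forall fun t ht => ?_
      rw [uIoc_of_le hy] at ht
      exact (hlim _ (add_nonneg hs.1.le ht.1.le)).const_mul _

/-- Shifts of completely monotone functions are of positive type. They are approximated by
`z ↦ ρ(τ + L (1 - e^{-z/L}))`, a mixture of exponentials by Taylor's formula at `τ + L`. -/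
theorem IsCompletelyMonotone.isPosKernel_hankelForm {ρ : ℝ → ℝ} (hρ : IsCompletelyMonotone ρ)
    (hu : Continuous u) {τ : ℝ} (hτ : 0 < τ) : IsPosKernel (hankelForm (fun z => ρ (τ + z)) u) := by
  -- The `max z 0` keeps the argument of ρ at or above τ for all real z, so the approximants are
  -- continuous on the whole line; Hankel forms at nonnegative points only see z ≥ 0.
  have hstep : ∀ L > 0, IsPosKernel
      (hankelForm (fun z => ρ (τ + L * (1 - Real.exp (-L⁻¹ * max z 0)))) u) := by
    intro L hL
    have hy : ∀ z, 0 ≤ z → τ ≤ τ + L * (1 - Real.exp (-L⁻¹ * z)) ∧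
        τ + L * (1 - Real.exp (-L⁻¹ * z)) < τ + L := by
      intro z hz
      have h1 : Real.exp (-L⁻¹ * z) ≤ 1 := by
        rw [Real.exp_le_one_iff, neg_mul, neg_nonpos]; positivity
      have h2 := Real.exp_pos (-L⁻¹ * z)
      constructor <;> nlinarith
    have hterm : ∀ (n : ℕ) (z : ℝ), ∑ k ∈ Finset.range (n + 1),
        ((-1) ^ k * iteratedDeriv k ρ (τ + L) / k.factorial * L ^ k) * Real.exp (-L⁻¹ * z) ^ k
        = ∑ k ∈ Finset.range (n + 1), ((-1) ^ k * iteratedDeriv k ρ (τ + L) / k.factorial)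
          * (τ + L - (τ + L * (1 - Real.exp (-L⁻¹ * z)))) ^ k := by
      intro n z
      refine Finset.sum_congr rfl fun k _ => ?_
      rw [show τ + L - (τ + L * (1 - Real.exp (-L⁻¹ * z))) = L * Real.exp (-L⁻¹ * z) by ring,
        mul_pow]
      ring
    refine IsPosKernel.of_tendsto (l := atTop) (k := fun n : ℕ => hankelForm (fun z =>
      ∑ k ∈ Finset.range (n + 1), ((-1) ^ k * iteratedDeriv k ρ (τ + L) / k.factorial * L ^ k)
        * Real.exp (-L⁻¹ * z) ^ k) u) ?_ fun x y hx hy' => ?_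
    · refine Eventually.of_forall fun n => isPosKernel_hankelForm_sum hu (fun k => ?_) _ _
      exact mul_nonneg (div_nonneg (hρ.nonneg_iteratedDeriv _ _ (by positivity))
        (Nat.cast_nonneg _)) (by positivity)
    · refine tendsto_hankelForm (C := ρ τ) hu (Eventually.of_forall fun n => by fun_prop)
        (Eventually.of_forall fun n z hz => ?_) (fun z hz => ?_) hx hy'
      · obtain ⟨h1, h2⟩ := hy z hz
        rw [hterm, abs_of_nonneg (hρ.sum_nonneg (hτ.trans_le h1) h2.le n)]
        exact (hρ.sum_le (hτ.trans_le h1) h2 n).trans (hρ.antitoneOn hτ (hτ.trans_le h1) h1)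
      · simp_rw [hterm]
        rw [max_eq_left hz]
        exact hρ.tendsto_taylor (hτ.trans_le (hy z hz).1) (hy z hz).2.le
  have harg : ∀ L > 0, ∀ z, τ ≤ τ + L * (1 - Real.exp (-L⁻¹ * max z 0)) := by
    intro L hL z
    have h1 : Real.exp (-L⁻¹ * max z 0) ≤ 1 := by
      rw [Real.exp_le_one_iff, neg_mul, neg_nonpos]; positivity
    nlinarith
  refine IsPosKernel.of_tendsto (l := atTop)
    (k := fun L : ℝ => hankelForm (fun z => ρ (τ + L * (1 - Real.exp (-L⁻¹ * max z 0)))) u)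
    ((eventually_gt_atTop 0).mono hstep) fun x y hx hy => ?_
  refine tendsto_hankelForm (C := ρ τ) hu ?_ ?_ (fun z hz => ?_) hx hy
  · filter_upwards [eventually_gt_atTop 0] with L hL
    exact hρ.continuousOn.comp_continuous (by fun_prop) fun z => hτ.trans_le (harg L hL z)
  · filter_upwards [eventually_gt_atTop 0] with L hL z _
    have h := harg L hL z
    rw [abs_of_nonneg (hρ.nonneg (hτ.trans_le h))]
    exact hρ.antitoneOn hτ (hτ.trans_le h) h
  · have hc : ContinuousAt ρ (τ + z) := (hρ.contDiffAt (by positivity)).continuousAt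
    refine hc.tendsto.comp (tendsto_const_nhds.add ?_)
    rw [max_eq_left hz]
    -- L (1 - e^{-z/L}) tends to z: it is minus a difference quotient of t ↦ e^{-tz} at 0, with step
    -- 1/L.
    have hd : HasDerivAt (fun t : ℝ => Real.exp (-t * z)) (-z) 0 := by
      have := ((hasDerivAt_neg (0 : ℝ)).mul_const z).exp
      simpa using this
    have h1 := hd.tendsto_slope_zero_right
    simp only [zero_add, neg_zero, zero_mul, Real.exp_zero, smul_eq_mul] at h1
    have h2 := (h1.comp tendsto_inv_atTop_nhdsGT_zero).neg
    rw [neg_neg] at h2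
    refine h2.congr fun L => ?_
    simp only [Function.comp_apply, inv_inv]
    ring

end HankelForm

/-! ### Exponentially weighted tails of the jump density. -/

/-- The function `x ↦ e^{βx} ∫ₓ^∞ e^{-βt} ρ(t) dt` on `[0, ∞)`, constant on `(-∞, 0]`. -/
noncomputable def expTail (ρ : ℝ → ℝ) (β x : ℝ) : ℝ :=
  Real.exp (β * max x 0) * ∫ t in Ioi (max x 0), Real.exp (-β * t) * ρ t

section ExpTail

variable {ρ : ℝ → ℝ} {β θ x : ℝ}

theorem laplaceIntegrable_of_integrableOn (hint : IntegrableOn ρ (Ioi 0)) (hβ : 0 ≤ β) :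
    LaplaceIntegrable ρ β := by
  refine Integrable.bdd_mul (c := 1) hint (Continuous.aestronglyMeasurable (by fun_prop)) ?_
  refine (ae_restrict_iff' measurableSet_Ioi).2 (Eventually.of_forall fun t ht => ?_)
  rw [Real.norm_eq_abs, abs_of_pos (Real.exp_pos _), Real.exp_le_one_iff, neg_mul, neg_nonpos]
  exact mul_nonneg hβ (le_of_lt ht)

theorem setIntegral_Ioi_add (f : ℝ → ℝ) (z : ℝ) :
    ∫ t in Ioi (0 : ℝ), f (t + z) = ∫ t in Ioi z, f t := by
  have := (measurePreserving_add_right (volume : Measure ℝ) z).setIntegral_preimage_emb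
    (MeasurableEquiv.addRight z).measurableEmbedding f (Ioi z)
  simpa using this

/-- This exhibits the tail as a positive mixture of shifts ρ(τ + ·), the form in which positivity
passes to it. -/
theorem expTail_eq (hx : 0 ≤ x) :
    expTail ρ β x = ∫ τ in Ioi (0 : ℝ), Real.exp (-β * τ) * ρ (τ + x) := by
  rw [expTail, max_eq_left hx, ← setIntegral_Ioi_add, ← integral_const_mul]
  refine integral_congr_ae (Eventually.of_forall fun τ => ?_)
  simp only
  rw [← mul_assoc, ← Real.exp_add]
  congr 2; ring

theorem expTail_zero : expTail ρ β 0 = laplaceTransform ρ β := by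
  simp [expTail, laplaceTransform]

theorem integral_Ioi_max (hint : IntegrableOn ρ (Ioi 0)) (hβ : 0 ≤ β) (x : ℝ) :
    ∫ t in Ioi (max x 0), Real.exp (-β * t) * ρ t = laplaceTransform ρ β
      - ∫ t in (0 : ℝ)..max x 0, (Ioi 0).indicator (fun t => Real.exp (-β * t) * ρ t) t := by
  have h := intervalIntegral.integral_Ioi_sub_Ioi (laplaceIntegrable_of_integrableOn hint hβ)
    (le_max_right x 0)
  have h2 : ∫ t in (0 : ℝ)..max x 0, (Ioi 0).indicator (fun t => Real.exp (-β * t) * ρ t) t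
      = ∫ t in (0 : ℝ)..max x 0, Real.exp (-β * t) * ρ t := by
    rw [intervalIntegral.integral_of_le (le_max_right x 0),
      intervalIntegral.integral_of_le (le_max_right x 0)]
    exact setIntegral_congr_fun measurableSet_Ioc fun t ht => indicator_of_mem (mem_Ioi.2 ht.1) _
  rw [h2, ← h, laplaceTransform]
  ring

theorem expTail_continuous (hint : IntegrableOn ρ (Ioi 0)) (hβ : 0 ≤ β) :
    Continuous (expTail ρ β) := by
  have hi : Integrable ((Ioi 0).indicator fun t => Real.exp (-β * t) * ρ t) :=
    (integrable_indicator_iff measurableSet_Ioi).2 (laplaceIntegrable_of_integrableOn hint hβ)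
  have hc := intervalIntegral.continuous_primitive (fun a b => hi.intervalIntegrable (a := a) (b := b)) 0
  unfold expTail
  simp_rw [integral_Ioi_max hint hβ]
  have := hc.comp (continuous_id.max (continuous_const (y := (0 : ℝ))))
  simp only [Function.comp_def, id] at this
  fun_prop

theorem expTail_hasDerivAt (hint : IntegrableOn ρ (Ioi 0)) (hc : ContinuousOn ρ (Ioi 0))
    (hβ : 0 ≤ β) (hx : 0 < x) : HasDerivAt (expTail ρ β) (β * expTail ρ β x - ρ x) x := by
  have hi : Integrable ((Ioi 0).indicator fun t => Real.exp (-β * t) * ρ t) :=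
    (integrable_indicator_iff measurableSet_Ioi).2 (laplaceIntegrable_of_integrableOn hint hβ)
  have hnhds : Ioi (0 : ℝ) ∈ 𝓝 x := Ioi_mem_nhds hx
  have hcx : ContinuousAt (fun t => Real.exp (-β * t) * ρ t) x :=
    ContinuousAt.mul (by fun_prop) (hc.continuousAt hnhds)
  have heq : (Ioi 0).indicator (fun t => Real.exp (-β * t) * ρ t) =ᶠ[𝓝 x]
      fun t => Real.exp (-β * t) * ρ t :=
    eventually_of_mem hnhds fun t ht => indicator_of_mem ht _
  have h1 := intervalIntegral.integral_hasDerivAt_right (a := 0) (b := x) hi.intervalIntegrable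
    hi.aestronglyMeasurable.stronglyMeasurableAtFilter (hcx.congr heq.symm)
  rw [heq.eq_of_nhds] at h1
  have h2 := ((hasDerivAt_id x).const_mul β).exp.mul (h1.const_sub (laplaceTransform ρ β))
  have h3 : expTail ρ β =ᶠ[𝓝 x] fun y => Real.exp (β * y) * (laplaceTransform ρ β
      - ∫ t in (0 : ℝ)..y, (Ioi 0).indicator (fun t => Real.exp (-β * t) * ρ t) t) := by
    filter_upwards [hnhds] with y hy
    rw [expTail, integral_Ioi_max hint hβ, max_eq_left (le_of_lt hy)]
  refine (h2.congr_of_eventuallyEq h3).congr_deriv ?_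
  rw [h3.eq_of_nhds]
  simp only [id, mul_one]
  have : Real.exp (β * x) * Real.exp (-β * x) = 1 := by
    rw [← Real.exp_add]; simp
  linear_combination (- ρ x) * this

theorem expTail_nonneg (hρ : ∀ t > 0, 0 ≤ ρ t) (x : ℝ) : 0 ≤ expTail ρ β x := by
  refine mul_nonneg (Real.exp_pos _).le (setIntegral_nonneg measurableSet_Ioi fun t ht => ?_)
  exact mul_nonneg (Real.exp_pos _).le (hρ t ((le_max_right x 0).trans_lt ht))

theorem expTail_le (hint : IntegrableOn ρ (Ioi 0)) (hρ : ∀ t > 0, 0 ≤ ρ t) (hβ : 0 ≤ β) (x : ℝ) :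
    expTail ρ β x ≤ ∫ t in Ioi (0 : ℝ), ρ t := by
  have hsub : Ioi (max x 0) ⊆ Ioi (0 : ℝ) := Ioi_subset_Ioi (le_max_right x 0)
  rw [expTail, ← integral_const_mul]
  refine le_trans ?_ (setIntegral_mono_set (s := Ioi (max x 0)) hint ?_ hsub.eventuallyLE)
  · refine setIntegral_mono_on
      (((laplaceIntegrable_of_integrableOn hint hβ).mono_set hsub).const_mul _)
      (hint.mono_set hsub) measurableSet_Ioi fun t ht => ?_
    rw [← mul_assoc, ← Real.exp_add]
    refine mul_le_of_le_one_left (hρ t (hsub ht)) ?_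
    rw [Real.exp_le_one_iff]
    nlinarith [mem_Ioi.1 ht]
  · exact (ae_restrict_iff' measurableSet_Ioi).2 (Eventually.of_forall fun t ht => hρ t ht)

theorem laplaceIntegrable_of_bounded {f : ℝ → ℝ} (hf : Continuous f) {C : ℝ} (hC : ∀ x, |f x| ≤ C)
    (hθ : 0 < θ) : LaplaceIntegrable f θ := by
  have h := laplaceIntegrable_one hθ
  simp only [LaplaceIntegrable, mul_one] at h
  refine Integrable.mul_bdd (c := C) h hf.aestronglyMeasurable ?_
  exact Eventually.of_forall hC

theorem expTail_laplaceIntegrable (hint : IntegrableOn ρ (Ioi 0)) (hρ : ∀ t > 0, 0 ≤ ρ t)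
    (hβ : 0 ≤ β) (hθ : 0 < θ) : LaplaceIntegrable (expTail ρ β) θ :=
  laplaceIntegrable_of_bounded (expTail_continuous hint hβ) (fun x => by
    rw [abs_of_nonneg (expTail_nonneg hρ x)]
    exact expTail_le hint hρ hβ x) hθ

/-- Since f = `expTail ρ β` satisfies f' = β f - ρ, integrate the derivative of e^{-θx} f over the
half-line. The transform of f is the divided difference of ρ̂, and this is what remains of the jump
part when a root of ψ - q, or θ, is divided out. -/
theorem laplaceTransform_expTail (hint : IntegrableOn ρ (Ioi 0)) (hc : ContinuousOn ρ (Ioi 0))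
    (hρ : ∀ t > 0, 0 ≤ ρ t) (hβ : 0 ≤ β) (hθ : 0 < θ) :
    (θ - β) * laplaceTransform (expTail ρ β) θ = laplaceTransform ρ β - laplaceTransform ρ θ := by
  have hi := expTail_laplaceIntegrable hint hρ hβ hθ
  have hi' := laplaceIntegrable_of_integrableOn hint hθ.le
  have hd : ∀ x ∈ Ioi (0 : ℝ), HasDerivAt (fun x => Real.exp (-θ * x) * expTail ρ β x)
      ((β - θ) * (Real.exp (-θ * x) * expTail ρ β x) - Real.exp (-θ * x) * ρ x) x := by
    intro x hx
    refine (((hasDerivAt_id x).const_mul (-θ)).exp.mul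
      (expTail_hasDerivAt hint hc hβ hx)).congr_deriv ?_
    simp only [id]; ring
  have hlim : Tendsto (fun x => Real.exp (-θ * x) * expTail ρ β x) atTop (𝓝 0) := by
    have h1 : Tendsto (fun x => Real.exp (-θ * x)) atTop (𝓝 0) := by
      refine Real.tendsto_exp_atBot.comp ?_
      exact tendsto_id.const_mul_atTop_of_neg (neg_lt_zero.2 hθ)
    refine h1.zero_mul_isBoundedUnder_le ⟨∫ t in Ioi (0 : ℝ), ρ t, ?_⟩
    refine eventually_map.2 (Eventually.of_forall fun x => ?_)
    simp only [Function.comp_apply, Real.norm_eq_abs]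
    rw [abs_of_nonneg (expTail_nonneg hρ x)]
    exact expTail_le hint hρ hβ x
  have hcont : Continuous fun x => Real.exp (-θ * x) * expTail ρ β x := by
    have := expTail_continuous hint hβ
    fun_prop
  have h := integral_Ioi_of_hasDerivAt_of_tendsto hcont.continuousWithinAt hd
    ((Integrable.const_mul hi (β - θ)).sub hi') hlim
  rw [integral_sub (Integrable.const_mul hi (β - θ)) hi', integral_const_mul] at h
  simp only [mul_zero, Real.exp_zero, one_mul, expTail_zero] at h
  unfold laplaceTransform at h ⊢
  linarith

theorem hankelForm_eq_setIntegral {f u : ℝ → ℝ} (hf : ContinuousOn f (Ici 0)) (hu : Continuous u)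
    {x y : ℝ} (hx : 0 ≤ x) (hy : 0 ≤ y) : hankelForm f u x y
      = ∫ p in Ioc 0 x ×ˢ Ioc 0 y, u (x - p.1) * u (y - p.2) * f (p.1 + p.2) := by
  rw [Measure.volume_eq_prod, setIntegral_prod, hankelForm, intervalIntegral.integral_of_le hx]
  · exact setIntegral_congr_fun measurableSet_Ioc fun s _ => intervalIntegral.integral_of_le hy
  · refine IntegrableOn.mono_set (t := Icc 0 x ×ˢ Icc 0 y) ?_
      (prod_mono Ioc_subset_Icc_self Ioc_subset_Icc_self)
    refine ContinuousOn.integrableOn_compact (isCompact_Icc.prod isCompact_Icc) ?_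
    refine ContinuousOn.mul (by fun_prop) (hf.comp (by fun_prop) fun p hp => ?_)
    exact add_nonneg hp.1.1 hp.2.1

/-- Fubini. Although ρ may blow up at 0, it is nonincreasing, so ρ(τ + s + t) ≤ ρ(τ), which provides
an integrable majorant. -/
theorem hankelForm_expTail (hρ : IsCompletelyMonotone ρ) (hint : IntegrableOn ρ (Ioi 0))
    (hβ : 0 ≤ β) {u : ℝ → ℝ} (hu : Continuous u) {x y : ℝ} (hx : 0 ≤ x) (hy : 0 ≤ y) :
    IntegrableOn (fun τ => Real.exp (-β * τ) * hankelForm (fun z => ρ (τ + z)) u x y) (Ioi 0) ∧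
      hankelForm (expTail ρ β) u x y
        = ∫ τ in Ioi (0 : ℝ), Real.exp (-β * τ) * hankelForm (fun z => ρ (τ + z)) u x y := by
  have hcτ : ∀ τ > 0, ContinuousOn (fun z => ρ (τ + z)) (Ici 0) := fun τ hτ =>
    hρ.continuousOn.comp (by fun_prop) fun z hz => add_pos_of_pos_of_nonneg hτ hz
  rw [hankelForm_eq_setIntegral (expTail_continuous hint hβ).continuousOn hu hx hy]
  set G : ℝ × ℝ → ℝ → ℝ := fun p τ =>
    u (x - p.1) * u (y - p.2) * (Real.exp (-β * τ) * ρ (τ + (p.1 + p.2))) with hG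
  have hms : MeasurableSet (Ioc 0 x ×ˢ Ioc 0 y) := measurableSet_Ioc.prod measurableSet_Ioc
  have hGint : Integrable (Function.uncurry G)
      ((volume.restrict (Ioc 0 x ×ˢ Ioc 0 y)).prod (volume.restrict (Ioi (0 : ℝ)))) := by
    obtain ⟨C, hC⟩ := (isCompact_Icc (a := 0) (b := x)).prod (isCompact_Icc (a := 0) (b := y))
      |>.exists_bound_of_continuousOn (f := fun p : ℝ × ℝ => u (x - p.1) * u (y - p.2)) (by fun_prop)
    have : IsFiniteMeasure ((volume : Measure (ℝ × ℝ)).restrict (Ioc 0 x ×ˢ Ioc 0 y)) := by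
      refine ⟨?_⟩
      rw [Measure.restrict_apply_univ, Measure.volume_eq_prod, Measure.prod_prod]
      simp [ENNReal.mul_lt_top]
    have hdom : Integrable (fun z : (ℝ × ℝ) × ℝ => C * ρ z.2)
        ((volume.restrict (Ioc 0 x ×ˢ Ioc 0 y)).prod (volume.restrict (Ioi (0 : ℝ)))) :=
      (Integrable.const_mul hint C).comp_snd _
    rw [Measure.prod_restrict] at hdom ⊢
    refine hdom.mono' ?_ ?_
    · refine ContinuousOn.aestronglyMeasurable ?_ (hms.prod measurableSet_Ioi)
      simp only [Function.uncurry_def, hG]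
      refine ContinuousOn.mul (by fun_prop) (ContinuousOn.mul (by fun_prop)
        (hρ.continuousOn.comp (by fun_prop) ?_))
      rintro ⟨p, τ⟩ ⟨⟨hp1, hp2⟩, hτ⟩
      exact add_pos hτ (add_pos hp1.1 hp2.1)
    · refine (ae_restrict_iff' (hms.prod measurableSet_Ioi)).2 (Eventually.of_forall ?_)
      rintro ⟨p, τ⟩ ⟨⟨hp1, hp2⟩, hτ⟩
      have hτ' : (0 : ℝ) < τ := hτ
      have hpos : 0 < p.1 + p.2 := add_pos hp1.1 hp2.1
      have h1 := hC p ⟨Ioc_subset_Icc_self hp1, Ioc_subset_Icc_self hp2⟩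
      have h2 : Real.exp (-β * τ) ≤ 1 := by
        rw [Real.exp_le_one_iff, neg_mul, neg_nonpos]; positivity
      have h3 : 0 ≤ ρ (τ + (p.1 + p.2)) := hρ.nonneg (by positivity)
      have h4 : ρ (τ + (p.1 + p.2)) ≤ ρ τ :=
        hρ.antitoneOn hτ (mem_Ioi.2 (by positivity)) (by linarith)
      simp only [Function.uncurry_apply_pair, hG]
      rw [norm_mul]
      refine mul_le_mul h1 ?_ (norm_nonneg _) ((norm_nonneg _).trans h1)
      rw [Real.norm_eq_abs, abs_of_nonneg (mul_nonneg (Real.exp_pos _).le h3)]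
      exact (mul_le_of_le_one_left h3 h2).trans h4
  have hswap : ∀ τ ∈ Ioi (0 : ℝ), ∫ p in Ioc 0 x ×ˢ Ioc 0 y, G p τ
      = Real.exp (-β * τ) * hankelForm (fun z => ρ (τ + z)) u x y := by
    intro τ hτ
    rw [hankelForm_eq_setIntegral (hcτ τ hτ) hu hx hy, ← integral_const_mul]
    refine integral_congr_ae (Eventually.of_forall fun p => ?_)
    simp only [hG]; ring
  refine ⟨IntegrableOn.congr_fun hGint.integral_prod_right hswap measurableSet_Ioi, ?_⟩
  calc _ = ∫ p in Ioc 0 x ×ˢ Ioc 0 y, ∫ τ in Ioi (0 : ℝ), G p τ := by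
        refine setIntegral_congr_fun hms fun p hp => ?_
        simp only [hG]
        rw [expTail_eq (add_nonneg hp.1.1.le hp.2.1.le), ← integral_const_mul]
    _ = ∫ τ in Ioi (0 : ℝ), ∫ p in Ioc 0 x ×ˢ Ioc 0 y, G p τ := integral_integral_swap hGint
    _ = _ := setIntegral_congr_fun measurableSet_Ioi hswap

theorem isPosKernel_hankelForm_expTail (hρ : IsCompletelyMonotone ρ)
    (hint : IntegrableOn ρ (Ioi 0)) (hβ : 0 ≤ β) {u : ℝ → ℝ} (hu : Continuous u) :
    IsPosKernel (hankelForm (expTail ρ β) u) := by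
  intro n c x hx
  have h := fun i j => hankelForm_expTail hρ hint hβ hu (hx i) (hx j)
  have hi := fun i j => (h i j).1.const_mul (c i * c j)
  simp_rw [fun i j => (h i j).2, ← integral_const_mul]
  simp_rw [← integral_finsetSum _ fun j _ => hi _ j]
  rw [← integral_finsetSum _ fun i _ => integrable_finsetSum _ fun j _ => hi i j]
  refine setIntegral_nonneg measurableSet_Ioi fun τ hτ => ?_
  have := mul_nonneg (Real.exp_pos (-β * τ)).le (hρ.isPosKernel_hankelForm hu hτ n c x hx)
  simp_rw [Finset.mul_sum] at this
  refine this.trans_eq ?_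
  exact Finset.sum_congr rfl fun i _ => Finset.sum_congr rfl fun j _ => by ring

end ExpTail

/-! ### Midpoint log-convexity. -/

/-- The excess over the chord vanishes at both ends. At a maximum m, take the midpoint of the nearer
end and its reflection in m: the maximum is at most half the value at the reflected point, hence at
most half of itself. -/
theorem convexOn_of_midpoint {g : ℝ → ℝ} {s : Set ℝ} (hs : Convex ℝ s) (hg : ContinuousOn g s)
    (hm : ∀ x ∈ s, ∀ y ∈ s, g ((x + y) / 2) ≤ (g x + g y) / 2) : ConvexOn ℝ s g := by
  refine ⟨hs, fun x hx y hy a b ha hb hab => ?_⟩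
  simp only [smul_eq_mul]
  set ℓ : ℝ → ℝ := fun t => (1 - t) * x + t * y with hℓ
  set φ : ℝ → ℝ := fun t => g (ℓ t) - ((1 - t) * g x + t * g y) with hφ
  have hmem : ∀ t ∈ Icc (0 : ℝ) 1, ℓ t ∈ s := fun t ht =>
    hs hx hy (sub_nonneg.2 ht.2) ht.1 (by ring)
  have hc : ContinuousOn φ (Icc 0 1) :=
    (hg.comp (by fun_prop) hmem).sub (by fun_prop)
  have hmid : ∀ p ∈ Icc (0 : ℝ) 1, ∀ r ∈ Icc (0 : ℝ) 1, φ ((p + r) / 2) ≤ (φ p + φ r) / 2 := by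
    intro p hp r hr
    have := hm _ (hmem p hp) _ (hmem r hr)
    rw [show (ℓ p + ℓ r) / 2 = ℓ ((p + r) / 2) by simp only [hℓ]; ring] at this
    simp only [hφ]; linarith
  have h0 : φ 0 = 0 := by simp [hφ, hℓ]
  have h1 : φ 1 = 0 := by simp [hφ, hℓ]
  obtain ⟨m, hmI, hmax⟩ := isCompact_Icc.exists_isMaxOn (nonempty_Icc.2 zero_le_one) hc
  have hle : φ m ≤ 0 := by
    rcases le_total m (1 / 2) with h | h
    · have h2 : 2 * m ∈ Icc (0 : ℝ) 1 := ⟨by linarith [hmI.1], by linarith⟩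
      have h3 := hmid 0 (by simp) (2 * m) h2
      rw [show (0 + 2 * m) / 2 = m by ring, h0] at h3
      have : φ (2 * m) ≤ φ m := hmax h2
      linarith
    · have h2 : 2 * m - 1 ∈ Icc (0 : ℝ) 1 := ⟨by linarith, by linarith [hmI.2]⟩
      have h3 := hmid (2 * m - 1) h2 1 (by simp)
      rw [show (2 * m - 1 + 1) / 2 = m by ring, h1] at h3
      have : φ (2 * m - 1) ≤ φ m := hmax h2
      linarith
  have hbI : b ∈ Icc (0 : ℝ) 1 := ⟨hb, by linarith⟩
  have := (hmax hbI).trans hle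
  obtain rfl : a = 1 - b := by linarith
  simp only [hφ, hℓ] at this
  linarith

/-- The logarithmic derivative of a midpoint log-convex function is monotone. -/
theorem deriv_mul_le_of_sq_le {K K' : ℝ → ℝ} (hpos : ∀ x > 0, 0 < K x)
    (hd : ∀ x > 0, HasDerivAt K (K' x) x)
    (hm : ∀ x > 0, ∀ y > 0, K (x + y) ^ 2 ≤ K (x + x) * K (y + y)) {x y : ℝ} (hx : 0 < x)
    (hxy : x ≤ y) : K' x * K y ≤ K' y * K x := by
  have hdl : ∀ z > 0, HasDerivAt (fun z => Real.log (K z)) (K' z / K z) z := fun z hz =>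
    (hd z hz).log (hpos z hz).ne'
  have hconv : ConvexOn ℝ (Ioi 0) fun z => Real.log (K z) := by
    refine convexOn_of_midpoint (convex_Ioi 0)
      (fun z hz => (hdl z hz).continuousAt.continuousWithinAt) fun a ha b hb => ?_
    have ha' : (0 : ℝ) < a := ha
    have hb' : (0 : ℝ) < b := hb
    have := hm (a / 2) (by positivity) (b / 2) (by positivity)
    rw [add_halves, add_halves, ← add_div] at this
    have h2 := Real.log_le_log (pow_pos (hpos _ (by positivity)) 2) this
    rw [Real.log_mul (hpos a ha').ne' (hpos b hb').ne', Real.log_pow] at h2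
    push_cast at h2
    linarith
  have hmono := hconv.monotoneOn_deriv fun z hz => (hdl z hz).differentiableAt
  have hy : 0 < y := hx.trans_le hxy
  have := hmono hx hy hxy
  rw [(hdl x hx).deriv, (hdl y hy).deriv, div_le_div_iff₀ (hpos x hx) (hpos y hy)] at this
  exact this

theorem sq_deriv_le_of_log_convex {K K' K'' : ℝ → ℝ} (hpos : ∀ x > 0, 0 < K x)
    (hd : ∀ x > 0, HasDerivAt K (K' x) x) (hd' : ∀ x > 0, HasDerivAt K' (K'' x) x)
    (hm : ∀ x > 0, ∀ y > 0, K (x + y) ^ 2 ≤ K (x + x) * K (y + y)) {x : ℝ} (hx : 0 < x) :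
    K' x ^ 2 ≤ K x * K'' x := by
  have hmono : MonotoneOn (fun z => K' z / K z) (Ioi 0) := fun a ha b hb hab => by
    rw [div_le_div_iff₀ (hpos a ha) (hpos b hb)]
    exact deriv_mul_le_of_sq_le hpos hd hm ha hab
  have h1 : HasDerivWithinAt (fun z => K' z / K z) _ (Ioi 0) x :=
    ((hd' x hx).div (hd x hx) (hpos x hx).ne').hasDerivWithinAt
  have h2 := hmono.derivWithin_nonneg (x := x)
  rw [h1.derivWithin (uniqueDiffOn_Ioi 0 x hx)] at h2
  have := mul_nonneg h2 (pow_pos (hpos x hx) 2).le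
  rw [div_mul_cancel₀ _ (pow_pos (hpos x hx) 2).ne'] at this
  linarith

/-- A positive definite function that is positive at the origin has no zeros. -/
theorem pos_of_sq_le {K : ℝ → ℝ} (hc : Continuous K) (h0 : 0 < K 0)
    (hm : ∀ x ≥ 0, ∀ y ≥ 0, 0 ≤ K (x + x) ∧ K (x + y) ^ 2 ≤ K (x + x) * K (y + y)) {x : ℝ}
    (hx : 0 ≤ x) : 0 < K x := by
  have hnn : ∀ y ≥ 0, 0 ≤ K y := fun y hy => by
    have := (hm (y / 2) (by positivity) 0 le_rfl).1
    rwa [add_halves] at this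
  refine (hnn x hx).lt_of_ne fun hne => ?_
  -- A zero at x forces one at x/2, because K(x/2)² ≤ K(x) K(0); the zeros then accumulate at the
  -- origin.
  have hz : ∀ n : ℕ, K (x / 2 ^ n) = 0 := by
    intro n
    induction n with
    | zero => simpa using hne.symm
    | succ n ih =>
      have := (hm (x / 2 ^ n / 2) (by positivity) 0 le_rfl).2
      rw [add_halves, ih, zero_mul, add_zero, div_div, ← pow_succ] at this
      exact pow_eq_zero_iff two_ne_zero |>.1 (le_antisymm this (sq_nonneg _))
  have hlim : Tendsto (fun n : ℕ => x / 2 ^ n) atTop (𝓝 0) := by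
    have := (tendsto_pow_atTop_nhds_zero_of_lt_one (r := (1 / 2 : ℝ)) (by norm_num)
      (by norm_num)).const_mul x
    simpa [div_eq_mul_inv] using this
  have h1 := (hc.tendsto 0).comp hlim
  have h2 : Tendsto (K ∘ fun n : ℕ => x / 2 ^ n) atTop (𝓝 0) :=
    tendsto_const_nhds.congr fun n => (hz n).symm
  exact h0.ne' (tendsto_nhds_unique h1 h2)

/-! ### Unimodality of the ratio `thetaFun`. -/

/-- A scale function `W` with its first derivatives `p, p₁, p₂, p₃`; `p₂ - Φ p₁` is log-convex. -/
structure IsRegularScale (Φ : ℝ) (W p p₁ p₂ p₃ : ℝ → ℝ) : Prop where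
  Phi_pos : 0 < Φ
  continuousOn : ContinuousOn W (Ici 0)
  apply_zero : W 0 = 0
  cont₀ : Continuous p
  cont₁ : Continuous p₁
  cont₂ : Continuous p₂
  deriv₀ : ∀ x > 0, HasDerivAt W (p x) x
  deriv₁ : ∀ x > 0, HasDerivAt p (p₁ x) x
  deriv₂ : ∀ x > 0, HasDerivAt p₁ (p₂ x) x
  deriv₃ : ∀ x > 0, HasDerivAt p₂ (p₃ x) x
  pos : ∀ x, 0 ≤ x → 0 < p x
  log_convex : ∀ x, 0 < x → p₁ x ^ 2 ≤ p x * p₂ x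
  defect_pos : ∀ x, 0 < x → 0 < p₂ x - Φ * p₁ x
  defect_log_convex : ∀ x, 0 < x → ∀ y, x ≤ y →
    (p₃ x - Φ * p₂ x) * (p₂ y - Φ * p₁ y) ≤ (p₃ y - Φ * p₂ y) * (p₂ x - Φ * p₁ x)
  laplaceIntegrable : ∀ θ > Φ, LaplaceIntegrable W θ
  deriv_zero_neg : p₁ 0 < 0
  exists_deriv_pos : ∃ x > 0, 0 < p₁ x

namespace IsRegularScale

variable {Φ : ℝ} {W p p₁ p₂ p₃ : ℝ → ℝ}

theorem exp_mul_hasDerivAt (h : IsRegularScale Φ W p p₁ p₂ p₃) {x : ℝ} (hx : 0 < x) :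
    HasDerivAt (fun x => Real.exp (-Φ * x) * p₁ x) (Real.exp (-Φ * x) * (p₂ x - Φ * p₁ x)) x := by
  refine (((hasDerivAt_id x).const_mul (-Φ)).exp.mul (h.deriv₂ x hx)).congr_deriv ?_
  simp only [id]; ring

theorem exp_mul_defect_hasDerivAt (h : IsRegularScale Φ W p p₁ p₂ p₃) {x : ℝ} (hx : 0 < x) :
    HasDerivAt (fun x => Real.exp (-Φ * x) * (p₂ x - Φ * p₁ x))
      (Real.exp (-Φ * x) * ((p₃ x - Φ * p₂ x) - Φ * (p₂ x - Φ * p₁ x))) x := by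
  refine (((hasDerivAt_id x).const_mul (-Φ)).exp.mul
    ((h.deriv₃ x hx).sub ((h.deriv₂ x hx).const_mul Φ))).congr_deriv ?_
  simp only [id, Pi.sub_apply]; ring

/-- Its derivative is e^{-Φx} (p₂ - Φ p₁) > 0. As a consequence p₁ = W'' changes sign at most once,
from negative to positive. -/
theorem exp_mul_strictMonoOn (h : IsRegularScale Φ W p p₁ p₂ p₃) :
    StrictMonoOn (fun x => Real.exp (-Φ * x) * p₁ x) (Ici 0) := by
  have := h.cont₁
  refine strictMonoOn_of_deriv_pos (convex_Ici 0) (Continuous.continuousOn (by fun_prop)) ?_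
  intro x hx
  rw [interior_Ici] at hx
  rw [(h.exp_mul_hasDerivAt hx).deriv]
  exact mul_pos (Real.exp_pos _) (h.defect_pos x hx)

theorem deriv_neg_of_le (h : IsRegularScale Φ W p p₁ p₂ p₃) {x y : ℝ} (hx : 0 ≤ x) (hxy : x ≤ y)
    (hy : p₁ y < 0) : p₁ x < 0 := by
  have := h.exp_mul_strictMonoOn.monotoneOn hx (hx.trans hxy) hxy
  by_contra hn
  have h1 := mul_nonneg (Real.exp_pos (-Φ * x)).le (not_lt.1 hn)
  have h2 := mul_neg_of_pos_of_neg (Real.exp_pos (-Φ * y)) hy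
  linarith

theorem deriv_pos_of_lt (h : IsRegularScale Φ W p p₁ p₂ p₃) {x y : ℝ} (hx : 0 ≤ x) (hxy : x < y)
    (h0 : 0 ≤ p₁ x) : 0 < p₁ y := by
  have := h.exp_mul_strictMonoOn hx (hx.trans hxy.le) hxy
  have h1 := mul_nonneg (Real.exp_pos (-Φ * x)).le h0
  exact pos_of_mul_pos_right (h1.trans_lt this) (Real.exp_pos _).le

theorem second_nonneg (h : IsRegularScale Φ W p p₁ p₂ p₃) {x : ℝ} (hx : 0 < x) : 0 ≤ p₂ x :=
  nonneg_of_mul_nonneg_right ((sq_nonneg _).trans (h.log_convex x hx)) (h.pos x hx.le)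

/-- The numerator of the derivative of `(1 - κ p₁) / p`. -/
def slope (κ : ℝ) (p p₁ p₂ : ℝ → ℝ) (x : ℝ) : ℝ := -p₁ x - κ * (p x * p₂ x - p₁ x ^ 2)

/-- The function `(1 - κ p₁) / p` is unimodal if it increases at the origin. -/
theorem slope_nonpos_of_le (h : IsRegularScale Φ W p p₁ p₂ p₃) {κ : ℝ} (hκ : 0 < κ)
    (h0 : 0 < slope κ p p₁ p₂ 0) {b y : ℝ} (hb : 0 < b) (hby : b ≤ y)
    (hslope : slope κ p p₁ p₂ b ≤ 0) : slope κ p p₁ p₂ y ≤ 0 := by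
  have hy : 0 < y := hb.trans_le hby
  rcases le_or_gt 0 (p₁ y) with hp | hp
  · have := mul_nonneg hκ.le (sub_nonneg.2 (h.log_convex y hy))
    unfold slope; linarith
  have hneg : ∀ x ∈ Icc 0 y, p₁ x < 0 := fun x hx => h.deriv_neg_of_le hx.1 hx.2 hp
  -- With p₁ < 0 on [0, y], dividing by -p₁ turns the sign of the slope into a comparison of κR with
  -- the constant 1, so only the monotonicity of R matters.
  set R : ℝ → ℝ := fun x => (p x * p₂ x - p₁ x ^ 2) / (-p₁ x) with hR
  have hslopeR : ∀ x ∈ Icc 0 y, (slope κ p p₁ p₂ x ≤ 0 ↔ 1 ≤ κ * R x) := by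
    intro x hx
    have := hneg x hx
    simp only [hR, slope]
    rw [← mul_div_assoc, le_div_iff₀ (by linarith)]
    constructor <;> intro <;> linarith
  have hRc : ContinuousOn R (Icc 0 y) := by
    have h0 := h.cont₀
    have h1 := h.cont₁
    have h2 := h.cont₂
    exact ContinuousOn.div (by fun_prop) (by fun_prop) fun x hx => (neg_pos.2 (hneg x hx)).ne'
  have hRd : ∀ x ∈ Ioc 0 y, HasDerivAt R (p x * (p₂ x ^ 2 - p₁ x * p₃ x) / p₁ x ^ 2) x := by
    intro x hx
    have hx' := (hneg x ⟨hx.1.le, hx.2⟩).ne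
    refine ((((h.deriv₁ x hx.1).mul (h.deriv₃ x hx.1)).sub ((h.deriv₂ x hx.1).pow 2)).div
      (h.deriv₂ x hx.1).neg (neg_ne_zero.2 hx')).congr_deriv ?_
    simp only [Pi.sub_apply, Pi.mul_apply, Pi.pow_apply, Pi.neg_apply]
    rw [neg_sq]
    congr 1
    push_cast
    ring
  -- For g = e^{-Φt} p₁ the quantity p₂² - p₁ p₃ equals e^{2Φt} (g'² - g g''), and g''/g' is
  -- nondecreasing. Once nonnegative, this quantity stays so as long as g < 0.
  have hup : ∀ x ∈ Ioc 0 y, ∀ z ∈ Icc x y, 0 ≤ p₂ x ^ 2 - p₁ x * p₃ x →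
      0 ≤ p₂ z ^ 2 - p₁ z * p₃ z := by
    intro x hx z hz hq
    have hz0 : 0 < z := hx.1.trans_le hz.1
    have hnx := h.defect_pos x hx.1
    have hnz := h.defect_pos z hz0
    -- m is -g''/g' at x, which makes the derivative of g' + m g nonnegative to the right of x. At
    -- x, nonnegativity of g' + m g is equivalent to the assumption.
    set m := Φ - (p₃ x - Φ * p₂ x) / (p₂ x - Φ * p₁ x) with hm
    have hmx : m * (p₂ x - Φ * p₁ x) = Φ * (p₂ x - Φ * p₁ x) - (p₃ x - Φ * p₂ x) := by
      rw [hm, sub_mul, div_mul_cancel₀ _ hnx.ne']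
    have hmono : MonotoneOn (fun t => Real.exp (-Φ * t) * (p₂ t - Φ * p₁ t)
        + m * (Real.exp (-Φ * t) * p₁ t)) (Icc x z) := by
      have hd : ∀ t ∈ Icc x z, HasDerivAt (fun t => Real.exp (-Φ * t) * (p₂ t - Φ * p₁ t)
          + m * (Real.exp (-Φ * t) * p₁ t)) (Real.exp (-Φ * t) *
          ((p₃ t - Φ * p₂ t) - (Φ - m) * (p₂ t - Φ * p₁ t))) t := by
        intro t ht
        have ht0 : 0 < t := hx.1.trans_le ht.1
        refine ((h.exp_mul_defect_hasDerivAt ht0).add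
          ((h.exp_mul_hasDerivAt ht0).const_mul m)).congr_deriv ?_
        ring
      refine monotoneOn_of_deriv_nonneg (convex_Icc x z)
        (fun t ht => (hd t ht).continuousAt.continuousWithinAt)
        (fun t ht => (hd t (interior_subset ht)).differentiableAt.differentiableWithinAt)
        fun t ht => ?_
      have ht' := interior_subset ht
      rw [(hd t ht').deriv]
      refine mul_nonneg (Real.exp_pos _).le ?_
      have h1 := h.defect_log_convex x hx.1 t ht'.1
      rw [sub_nonneg]
      refine le_of_mul_le_mul_right ?_ hnx
      have h2 : (Φ - m) * (p₂ x - Φ * p₁ x) = p₃ x - Φ * p₂ x := by rw [sub_mul, hmx]; ring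
      rw [← h2] at h1
      linarith
    have hle := hmono (left_mem_Icc.2 hz.1) (right_mem_Icc.2 hz.1) hz.1
    simp only at hle
    have hx2 : 0 ≤ (p₂ x - Φ * p₁ x) + m * p₁ x := by
      refine nonneg_of_mul_nonneg_right ?_ hnx
      have : (p₂ x - Φ * p₁ x) * (p₂ x - Φ * p₁ x + m * p₁ x) = p₂ x ^ 2 - p₁ x * p₃ x := by
        linear_combination p₁ x * hmx
      rw [this]; exact hq
    have hz2 : 0 ≤ (p₂ z - Φ * p₁ z) + m * p₁ z := by
      have h1 := mul_nonneg (Real.exp_pos (-Φ * x)).le hx2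
      have h2 : 0 ≤ Real.exp (-Φ * z) * ((p₂ z - Φ * p₁ z) + m * p₁ z) := by linarith
      exact nonneg_of_mul_nonneg_right h2 (Real.exp_pos _)
    have hmz : Φ * (p₂ z - Φ * p₁ z) - (p₃ z - Φ * p₂ z) ≤ m * (p₂ z - Φ * p₁ z) := by
      have h1 := h.defect_log_convex x hx.1 z hz.1
      refine le_of_mul_le_mul_right ?_ hnx
      have : m * (p₂ z - Φ * p₁ z) * (p₂ x - Φ * p₁ x)
          = (Φ * (p₂ x - Φ * p₁ x) - (p₃ x - Φ * p₂ x)) * (p₂ z - Φ * p₁ z) := by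
        rw [← hmx]; ring
      rw [this]; linarith
    have h3 := mul_le_mul_of_nonpos_left hmz (hneg z ⟨hz0.le, hz.2⟩).le
    have h4 := mul_nonneg hnz.le hz2
    have e : p₂ z ^ 2 - p₁ z * p₃ z = (p₂ z - Φ * p₁ z) * (p₂ z - Φ * p₁ z)
        + p₁ z * (Φ * (p₂ z - Φ * p₁ z) - (p₃ z - Φ * p₂ z)) := by ring
    rw [e]; linarith
  rw [hslopeR y ⟨hy.le, le_rfl⟩]
  have hRb := (hslopeR b ⟨hb.le, hby⟩).1 hslope
  rcases le_or_gt 0 (p₂ b ^ 2 - p₁ b * p₃ b) with hq | hq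
  · have hmono : MonotoneOn R (Icc b y) := by
      have hd : ∀ t ∈ Icc b y, HasDerivAt R _ t := fun t ht => hRd t ⟨hb.trans_le ht.1, ht.2⟩
      refine monotoneOn_of_deriv_nonneg (convex_Icc b y)
        (fun t ht => (hd t ht).continuousAt.continuousWithinAt)
        (fun t ht => (hd t (interior_subset ht)).differentiableAt.differentiableWithinAt)
        fun t ht => ?_
      have ht' := interior_subset ht
      rw [(hd t ht').deriv]
      exact div_nonneg (mul_nonneg (h.pos t (hb.le.trans ht'.1)).le (hup b ⟨hb, hby⟩ t ht' hq))
        (sq_nonneg _)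
    have := mul_le_mul_of_nonneg_left
      (hmono (left_mem_Icc.2 hby) (right_mem_Icc.2 hby) hby) hκ.le
    linarith
  -- If R were still falling at b, it would have fallen on all of [0, b]; then κR(0) ≥ κR(b) ≥ 1,
  -- contrary to the positive slope at the origin.
  · exfalso
    have hanti : AntitoneOn R (Icc 0 b) := by
      have hd : ∀ t ∈ Ioo 0 b, HasDerivAt R _ t := fun t ht => hRd t ⟨ht.1, ht.2.le.trans hby⟩
      refine antitoneOn_of_deriv_nonpos (convex_Icc 0 b)
        (hRc.mono (Icc_subset_Icc_right hby)) ?_ ?_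
      · intro t ht
        rw [interior_Icc] at ht
        exact (hd t ht).differentiableAt.differentiableWithinAt
      · intro t ht
        rw [interior_Icc] at ht
        rw [(hd t ht).deriv]
        refine div_nonpos_of_nonpos_of_nonneg (mul_nonpos_of_nonneg_of_nonpos
          (h.pos t ht.1.le).le ?_) (sq_nonneg _)
        by_contra hcon
        exact hq.not_ge (hup t ⟨ht.1, ht.2.le.trans hby⟩ b ⟨ht.2.le, hby⟩ (not_le.1 hcon).le)
    have h1 := mul_le_mul_of_nonneg_left
      (hanti (left_mem_Icc.2 hb.le) (right_mem_Icc.2 hb.le) hb.le) hκ.le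
    exact h0.not_ge ((hslopeR 0 ⟨le_rfl, hy.le⟩).2 (hRb.trans h1))

end IsRegularScale

theorem extendAtZero_eq {f g : ℝ → ℝ} (hg : ContinuousWithinAt g (Ici 0) 0)
    (h : ∀ x > 0, f x = g x) {x : ℝ} (hx : 0 ≤ x) : extendAtZero f x = g x := by
  unfold extendAtZero
  split_ifs with h0
  · exact h x h0
  · obtain rfl : x = 0 := le_antisymm (not_lt.1 h0) hx
    refine Tendsto.limUnder_eq ?_
    refine (hg.mono Ioi_subset_Ici_self).tendsto.congr' ?_
    filter_upwards [self_mem_nhdsWithin] with y hy using (h y hy).symm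

theorem infReal_le {s : Set ℝ} {x : ℝ} (hx : x ∈ s) : infReal s ≤ x :=
  sInf_le (mem_image_of_mem _ hx)

/-! ### Growth of the scale function and transforms of its derivatives. -/

/-- `f` grows at most like `e^{θx}` for every `θ > Φ`. -/
def ExpBounded (Φ : ℝ) (f : ℝ → ℝ) : Prop :=
  ∀ θ > Φ, ∃ C, ∀ x, 0 ≤ x → |f x| ≤ C * Real.exp (θ * x)

namespace ExpBounded

variable {Φ θ : ℝ} {f f' : ℝ → ℝ}

theorem laplaceIntegrable (hf : ExpBounded Φ f) (hc : ContinuousOn f (Ici 0)) (hθ : Φ < θ) :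
    LaplaceIntegrable f θ := by
  obtain ⟨η, h1, h2⟩ := exists_between hθ
  obtain ⟨C, hC⟩ := hf η h1
  have hi : IntegrableOn (fun x => C * Real.exp (-(θ - η) * x)) (Ioi 0) :=
    Integrable.const_mul (exp_neg_integrableOn_Ioi 0 (sub_pos.2 h2)) C
  refine Integrable.mono' hi ?_ ?_
  · refine ContinuousOn.aestronglyMeasurable ?_ measurableSet_Ioi
    have := hc.mono Ioi_subset_Ici_self
    fun_prop
  · refine (ae_restrict_iff' measurableSet_Ioi).2 (Eventually.of_forall fun x hx => ?_)
    rw [norm_mul, Real.norm_eq_abs, Real.norm_eq_abs, abs_of_pos (Real.exp_pos _)]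
    refine (mul_le_mul_of_nonneg_left (hC x (le_of_lt hx)) (Real.exp_pos _).le).trans_eq ?_
    rw [mul_left_comm, ← Real.exp_add]
    congr 2; ring

theorem tendsto_zero (hf : ExpBounded Φ f) (hθ : Φ < θ) :
    Tendsto (fun x => Real.exp (-θ * x) * f x) atTop (𝓝 0) := by
  obtain ⟨η, h1, h2⟩ := exists_between hθ
  obtain ⟨C, hC⟩ := hf η h1
  have hlim : Tendsto (fun x => C * Real.exp (-(θ - η) * x)) atTop (𝓝 0) := by
    have : Tendsto (fun x => Real.exp (-(θ - η) * x)) atTop (𝓝 0) :=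
      Real.tendsto_exp_atBot.comp
        (tendsto_id.const_mul_atTop_of_neg (neg_lt_zero.2 (sub_pos.2 h2)))
    simpa using this.const_mul C
  refine squeeze_zero_norm' ?_ hlim
  filter_upwards [eventually_ge_atTop 0] with x hx
  rw [norm_mul, Real.norm_eq_abs, Real.norm_eq_abs, abs_of_pos (Real.exp_pos _)]
  refine (mul_le_mul_of_nonneg_left (hC x hx) (Real.exp_pos _).le).trans_eq ?_
  rw [mul_left_comm, ← Real.exp_add]
  congr 2; ring

theorem laplaceTransform_deriv (hf : ExpBounded Φ f) (hf' : ExpBounded Φ f')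
    (hc : ContinuousOn f (Ici 0)) (hc' : ContinuousOn f' (Ici 0))
    (hd : ∀ x > 0, HasDerivAt f (f' x) x) (hθ : Φ < θ) :
    laplaceTransform f' θ = θ * laplaceTransform f θ - f 0 := by
  have hi := hf.laplaceIntegrable hc hθ
  have hi' := hf'.laplaceIntegrable hc' hθ
  have hd' : ∀ x ∈ Ioi (0 : ℝ), HasDerivAt (fun x => Real.exp (-θ * x) * f x)
      (Real.exp (-θ * x) * f' x - θ * (Real.exp (-θ * x) * f x)) x := by
    intro x hx
    refine (((hasDerivAt_id x).const_mul (-θ)).exp.mul (hd x hx)).congr_deriv ?_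
    simp only [id]; ring
  have hcont : ContinuousOn (fun x => Real.exp (-θ * x) * f x) (Ici 0) := by fun_prop
  have h := integral_Ioi_of_hasDerivAt_of_tendsto (hcont 0 self_mem_Ici) hd'
    (Integrable.sub hi' (Integrable.const_mul hi θ)) (hf.tendsto_zero hθ)
  rw [integral_sub hi' (Integrable.const_mul hi θ), integral_const_mul] at h
  simp only [mul_zero, Real.exp_zero, one_mul] at h
  unfold laplaceTransform
  linarith

end ExpBounded

theorem integral_Ioi_eq_sub {g : ℝ → ℝ} (hi : IntegrableOn g (Ioi 0)) {b : ℝ} (hb : 0 ≤ b) :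
    ∫ y in Ioi b, g y = (∫ y in Ioi 0, g y) - ∫ y in (0 : ℝ)..b, g y := by
  rw [← intervalIntegral.integral_Ioi_sub_Ioi hi hb]; ring

theorem hasDerivAt_integral_Ioi {g : ℝ → ℝ} (hg : Continuous g) (hi : IntegrableOn g (Ioi 0))
    {b : ℝ} (hb : 0 < b) : HasDerivAt (fun b => ∫ y in Ioi b, g y) (-g b) b := by
  have h1 := (hg.integral_hasStrictDerivAt 0 b).hasDerivAt.const_sub (∫ y in Ioi 0, g y)
  exact h1.congr_of_eventuallyEq
    ((eventually_gt_nhds hb).mono fun y hy => integral_Ioi_eq_sub hi hy.le)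

theorem continuousOn_integral_Ioi {g : ℝ → ℝ} (hg : Continuous g) (hi : IntegrableOn g (Ioi 0)) :
    ContinuousOn (fun b => ∫ y in Ioi b, g y) (Ici 0) := by
  have : Continuous fun b => (∫ y in Ioi 0, g y) - ∫ y in (0 : ℝ)..b, g y := by fun_prop
  exact this.continuousOn.congr fun b hb => integral_Ioi_eq_sub hi hb

namespace IsRegularScale

variable {Φ : ℝ} {W p p₁ p₂ p₃ : ℝ → ℝ}

theorem monotoneOn (h : IsRegularScale Φ W p p₁ p₂ p₃) : MonotoneOn W (Ici 0) := by
  refine monotoneOn_of_deriv_nonneg (convex_Ici 0) h.continuousOn ?_ ?_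
  · intro x hx
    rw [interior_Ici] at hx
    exact (h.deriv₀ x hx).differentiableAt.differentiableWithinAt
  · intro x hx
    rw [interior_Ici] at hx
    rw [(h.deriv₀ x hx).deriv]
    exact (h.pos x (le_of_lt hx)).le

theorem nonneg (h : IsRegularScale Φ W p p₁ p₂ p₃) {x : ℝ} (hx : 0 ≤ x) : 0 ≤ W x := by
  rw [← h.apply_zero]; exact h.monotoneOn self_mem_Ici hx hx

/-- W is nondecreasing, so e^{-θ(x+1)} W(x) is at most the Laplace integral over (x, x + 1], hence
at most the whole transform. -/
theorem expBounded (h : IsRegularScale Φ W p p₁ p₂ p₃) : ExpBounded Φ W := by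
  intro θ hθ
  have hθ0 : 0 < θ := h.Phi_pos.trans hθ
  have hi := h.laplaceIntegrable θ hθ
  refine ⟨Real.exp θ * laplaceTransform W θ, fun x hx => ?_⟩
  have hsub : Ioc x (x + 1) ⊆ Ioi 0 := fun t ht => hx.trans_lt ht.1
  have h1 : ∫ t in Ioc x (x + 1), Real.exp (-θ * (x + 1)) * W x
      ≤ ∫ t in Ioc x (x + 1), Real.exp (-θ * t) * W t := by
    refine setIntegral_mono_on (integrableOn_const (by simp)) (hi.mono_set hsub) measurableSet_Ioc
      fun t ht => ?_
    refine mul_le_mul (Real.exp_le_exp.2 ?_) (h.monotoneOn hx (hx.trans ht.1.le) ht.1.le)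
      (h.nonneg hx) (Real.exp_pos _).le
    nlinarith [ht.2]
  have h2 : ∫ t in Ioc x (x + 1), Real.exp (-θ * t) * W t ≤ laplaceTransform W θ := by
    refine setIntegral_mono_set hi ?_ hsub.eventuallyLE
    exact (ae_restrict_iff' measurableSet_Ioi).2 (Eventually.of_forall fun t ht =>
      mul_nonneg (Real.exp_pos _).le (h.nonneg (le_of_lt ht)))
  have h3 : ∫ t in Ioc x (x + 1), Real.exp (-θ * (x + 1)) * W x = Real.exp (-θ * (x + 1)) * W x := by
    simp
  rw [h3] at h1
  rw [abs_of_nonneg (h.nonneg hx)]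
  have h4 := mul_le_mul_of_nonneg_left (h1.trans h2) (Real.exp_pos (θ * (x + 1))).le
  rw [← mul_assoc, ← Real.exp_add] at h4
  simp only [neg_mul, add_neg_cancel, Real.exp_zero, one_mul] at h4
  refine h4.trans_eq ?_
  rw [mul_add, mul_one, Real.exp_add]; ring

theorem deriv_ge (h : IsRegularScale Φ W p p₁ p₂ p₃) {x : ℝ} (hx : 0 ≤ x) : p₁ 0 ≤ p₁ x := by
  have hmono : MonotoneOn p₁ (Ici 0) := by
    refine monotoneOn_of_deriv_nonneg (convex_Ici 0) h.cont₁.continuousOn ?_ ?_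
    · intro x hx
      rw [interior_Ici] at hx
      exact (h.deriv₂ x hx).differentiableAt.differentiableWithinAt
    · intro x hx
      rw [interior_Ici] at hx
      rw [(h.deriv₂ x hx).deriv]
      exact h.second_nonneg hx
  exact hmono self_mem_Ici hx hx

theorem deriv_mono (h : IsRegularScale Φ W p p₁ p₂ p₃) {x y : ℝ} (hx : 0 ≤ x) (hxy : x ≤ y) :
    p₁ x ≤ p₁ y := by
  rcases hx.eq_or_lt with rfl | hx
  · exact h.deriv_ge hxy
  refine monotoneOn_of_deriv_nonneg (convex_Icc x y) h.cont₁.continuousOn ?_ ?_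
    (left_mem_Icc.2 hxy) (right_mem_Icc.2 hxy) hxy
  · intro z hz
    rw [interior_Icc] at hz
    exact (h.deriv₂ z (hx.trans hz.1)).differentiableAt.differentiableWithinAt
  · intro z hz
    rw [interior_Icc] at hz
    rw [(h.deriv₂ z (hx.trans hz.1)).deriv]
    exact h.second_nonneg (hx.trans hz.1)

theorem expBounded_of_le_shift {f g : ℝ → ℝ} {a : ℝ} (ha : 0 ≤ a) (hΦ : 0 < Φ)
    (hg : ExpBounded Φ g) (hfg : ∀ x, 0 ≤ x → |f x| ≤ |g (x + 1)| + a) : ExpBounded Φ f := by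
  intro θ hθ
  obtain ⟨C, hC⟩ := hg θ hθ
  refine ⟨C * Real.exp θ + a, fun x hx => (hfg x hx).trans ?_⟩
  have h1 := hC (x + 1) (by linarith)
  have h2 : 1 ≤ Real.exp (θ * x) := Real.one_le_exp (mul_nonneg (hΦ.trans hθ).le hx)
  rw [mul_add, mul_one, Real.exp_add] at h1
  nlinarith

/-- Some ξ in (x, x + 1) has p(ξ) = W(x + 1) - W(x), and p cannot rise above p(ξ) by more than
|p₁(0)| going back to x, because p₁ ≥ p₁(0). -/
theorem expBounded₀ (h : IsRegularScale Φ W p p₁ p₂ p₃) : ExpBounded Φ p := by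
  refine expBounded_of_le_shift (neg_pos.2 h.deriv_zero_neg).le h.Phi_pos h.expBounded
    fun x hx => ?_
  obtain ⟨ξ, hξ, e⟩ := exists_hasDerivAt_eq_slope W p (show x < x + 1 by linarith)
    (h.continuousOn.mono fun y hy => hx.trans hy.1) (fun y hy => h.deriv₀ y (hx.trans_lt hy.1))
  obtain ⟨η, hη, e'⟩ := exists_hasDerivAt_eq_slope p p₁ hξ.1 h.cont₀.continuousOn
    (fun y hy => h.deriv₁ y (hx.trans_lt hy.1))
  have hξx : 0 < ξ - x := sub_pos.2 hξ.1
  rw [add_sub_cancel_left, div_one] at e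
  rw [eq_div_iff hξx.ne'] at e'
  have h1 := h.deriv_ge (hx.trans hη.1.le)
  have h2 := h.nonneg hx
  rw [abs_of_pos (h.pos x hx), abs_of_nonneg (h.nonneg (by linarith))]
  have h3 : ξ - x ≤ 1 := by linarith [hξ.2]
  nlinarith [h.deriv_zero_neg]

/-- As p₁ is nondecreasing, p₁(0) ≤ p₁(x) ≤ p(x + 1) - p(x). -/
theorem expBounded₁ (h : IsRegularScale Φ W p p₁ p₂ p₃) : ExpBounded Φ p₁ := by
  refine expBounded_of_le_shift (neg_pos.2 h.deriv_zero_neg).le h.Phi_pos h.expBounded₀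
    fun x hx => ?_
  obtain ⟨ξ, hξ, e⟩ := exists_hasDerivAt_eq_slope p p₁ (show x < x + 1 by linarith)
    h.cont₀.continuousOn (fun y hy => h.deriv₁ y (hx.trans_lt hy.1))
  rw [add_sub_cancel_left, div_one] at e
  have h1 := h.deriv_mono hx hξ.1.le
  have h2 := h.pos x hx
  have h3 := h.deriv_ge hx
  have h4 := h.pos (x + 1) (by linarith)
  rw [abs_of_pos h4, abs_le]
  constructor <;> linarith [h.deriv_zero_neg]

theorem scaleDeriv_one (h : IsRegularScale Φ W p p₁ p₂ p₃) {x : ℝ} (hx : 0 ≤ x) :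
    scaleDeriv W 1 x = p x :=
  extendAtZero_eq h.cont₀.continuousWithinAt
    (fun y hy => by rw [iteratedDeriv_one, (h.deriv₀ y hy).deriv]) hx

theorem scaleDeriv_two (h : IsRegularScale Φ W p p₁ p₂ p₃) {x : ℝ} (hx : 0 ≤ x) :
    scaleDeriv W 2 x = p₁ x := by
  refine extendAtZero_eq h.cont₁.continuousWithinAt (fun y hy => ?_) hx
  rw [iteratedDeriv_succ, iteratedDeriv_one]
  have : deriv W =ᶠ[𝓝 y] p := (eventually_gt_nhds hy).mono fun z hz => (h.deriv₀ z hz).deriv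
  rw [this.deriv_eq, (h.deriv₁ y hy).deriv]

/-! ### The thresholds. -/

variable {T : LevyTriplet} {S δ q : ℝ}

theorem continuous_ratio (h : IsRegularScale Φ W p p₁ p₂ p₃) (κ : ℝ) :
    ContinuousOn (fun x => (1 - κ * p₁ x) / p x) (Ici 0) := by
  have h0 := h.cont₀
  have h1 := h.cont₁
  exact ContinuousOn.div (by fun_prop) (by fun_prop) fun x hx => (h.pos x hx).ne'

theorem hasDerivAt_ratio (h : IsRegularScale Φ W p p₁ p₂ p₃) (κ : ℝ) {x : ℝ} (hx : 0 < x) :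
    HasDerivAt (fun x => (1 - κ * p₁ x) / p x) (slope κ p p₁ p₂ x / p x ^ 2) x := by
  refine ((((h.deriv₂ x hx).const_mul κ).const_sub 1).div (h.deriv₁ x hx)
    (h.pos x hx.le).ne').congr_deriv ?_
  congr 1
  simp only [slope]; ring

theorem thetaFun_eq (h : IsRegularScale Φ W p p₁ p₂ p₃) {x : ℝ} (hx : 0 ≤ x) :
    thetaFun T S W x = (1 - S * (T.σ ^ 2 / 2) * p₁ x) / p x :=
  extendAtZero_eq (g := fun x => (1 - S * (T.σ ^ 2 / 2) * p₁ x) / p x)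
    (h.continuous_ratio _ 0 self_mem_Ici)
    (fun y hy => by rw [h.scaleDeriv_one (le_of_lt hy), h.scaleDeriv_two (le_of_lt hy)]) hx

theorem deriv_thetaFun (h : IsRegularScale Φ W p p₁ p₂ p₃) {x : ℝ} (hx : 0 < x) :
    HasDerivAt (thetaFun T S W) (slope (S * (T.σ ^ 2 / 2)) p p₁ p₂ x / p x ^ 2) x :=
  (h.hasDerivAt_ratio _ hx).congr_of_eventuallyEq
    ((eventually_gt_nhds hx).mono fun _ hy => h.thetaFun_eq (le_of_lt hy))

theorem extend_deriv_thetaFun (h : IsRegularScale Φ W p p₁ p₂ p₃) {x : ℝ} (hx : 0 ≤ x) :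
    extendAtZero (deriv (thetaFun T S W)) x
      = slope (S * (T.σ ^ 2 / 2)) p p₁ p₂ x / p x ^ 2 := by
  refine extendAtZero_eq (g := fun x => slope (S * (T.σ ^ 2 / 2)) p p₁ p₂ x / p x ^ 2) ?_
    (fun y hy => (h.deriv_thetaFun hy).deriv) hx
  have h0 := h.cont₀
  have h1 := h.cont₁
  have h2 := h.cont₂
  unfold slope
  exact ContinuousWithinAt.div (by fun_prop) (by fun_prop) (pow_pos (h.pos 0 le_rfl) 2).ne'

theorem integrableOn_num (h : IsRegularScale Φ W p p₁ p₂ p₃) {φ : ℝ} (hφ : Φ < φ) (κ : ℝ) :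
    IntegrableOn (fun y => Real.exp (-φ * y) * (1 - κ * p₁ y)) (Ioi 0) := by
  have h1 := laplaceIntegrable_one (h.Phi_pos.trans hφ)
  have h2 := h.expBounded₁.laplaceIntegrable h.cont₁.continuousOn hφ
  refine (h1.add (h2.const_mul (-κ))).congr_fun (fun y _ => ?_) measurableSet_Ioi
  simp only; ring

theorem AFun_eq (h : IsRegularScale Φ W p p₁ p₂ p₃) {b : ℝ} (hb : 0 ≤ b) :
    AFun T δ q S W b = (∫ y in Ioi b, Real.exp (-(T.phi δ q) * y) * (1 - S * (T.σ ^ 2 / 2) * p₁ y))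
      / ∫ y in Ioi b, Real.exp (-(T.phi δ q) * y) * p y := by
  unfold AFun
  congr 1
  · refine setIntegral_congr_fun measurableSet_Ioi fun y hy => ?_
    rw [h.scaleDeriv_two (hb.trans (le_of_lt hy))]
  · refine setIntegral_congr_fun measurableSet_Ioi fun y hy => ?_
    rw [h.scaleDeriv_one (hb.trans (le_of_lt hy))]

theorem integrableOn_den (h : IsRegularScale Φ W p p₁ p₂ p₃) {φ : ℝ} (hφ : Φ < φ) :
    IntegrableOn (fun y => Real.exp (-φ * y) * p y) (Ioi 0) :=
  h.expBounded₀.laplaceIntegrable h.cont₀.continuousOn hφ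

theorem den_pos (h : IsRegularScale Φ W p p₁ p₂ p₃) {φ : ℝ} (hφ : Φ < φ) {b : ℝ} (hb : 0 ≤ b) :
    0 < ∫ y in Ioi b, Real.exp (-φ * y) * p y := by
  have hpos : ∀ y ∈ Ioi b, 0 < Real.exp (-φ * y) * p y := fun y hy =>
    mul_pos (Real.exp_pos _) (h.pos y (hb.trans (le_of_lt hy)))
  rw [setIntegral_pos_iff_support_of_nonneg_ae
    ((ae_restrict_iff' measurableSet_Ioi).2 (Eventually.of_forall fun y hy => (hpos y hy).le))
    ((h.integrableOn_den hφ).mono_set (Ioi_subset_Ioi hb))]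
  have : (Function.support fun y => Real.exp (-φ * y) * p y) ∩ Ioi b = Ioi b :=
    inter_eq_right.2 fun y hy => (hpos y hy).ne'
  rw [this, Real.volume_Ioi]
  exact ENNReal.zero_lt_top

theorem continuousOn_AFun (h : IsRegularScale Φ W p p₁ p₂ p₃) (hφ : Φ < T.phi δ q) :
    ContinuousOn (AFun T δ q S W) (Ici 0) := by
  have h0 := h.cont₀
  have h1 := h.cont₁
  refine ContinuousOn.congr ?_ fun b hb => h.AFun_eq hb
  exact (continuousOn_integral_Ioi (by fun_prop) (h.integrableOn_num hφ _)).div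
    (continuousOn_integral_Ioi (by fun_prop) (h.integrableOn_den hφ))
    fun b hb => (h.den_pos hφ hb).ne'

/-- A quotient of tail integrals whose integrands at b have ratio `thetaFun`: the average increases
exactly when the value dropped at b lies below it. -/
theorem deriv_AFun (h : IsRegularScale Φ W p p₁ p₂ p₃) (hφ : Φ < T.phi δ q) {b : ℝ} (hb : 0 < b) :
    HasDerivAt (AFun T δ q S W) (Real.exp (-(T.phi δ q) * b) * p b *
      (AFun T δ q S W b - thetaFun T S W b) / ∫ y in Ioi b, Real.exp (-(T.phi δ q) * y) * p y) b := by
  have h0 := h.cont₀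
  have h1 := h.cont₁
  have hD := (h.den_pos hφ hb.le).ne'
  have hp := (h.pos b hb.le).ne'
  have := ((hasDerivAt_integral_Ioi (by fun_prop) (h.integrableOn_num hφ (S * (T.σ ^ 2 / 2))) hb).div
    (hasDerivAt_integral_Ioi (by fun_prop) (h.integrableOn_den hφ) hb) hD)
  refine (this.congr_of_eventuallyEq
    ((eventually_gt_nhds hb).mono fun y hy => h.AFun_eq (le_of_lt hy))).congr_deriv ?_
  rw [h.AFun_eq hb.le, h.thetaFun_eq hb.le]
  generalize (∫ y in Ioi b, Real.exp (-(T.phi δ q) * y) * p y) = D at hD ⊢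
  generalize (∫ y in Ioi b, Real.exp (-(T.phi δ q) * y) * (1 - S * (T.σ ^ 2 / 2) * p₁ y)) = N
  field_simp
  ring

theorem continuousOn_thetaFun (h : IsRegularScale Φ W p p₁ p₂ p₃) :
    ContinuousOn (thetaFun T S W) (Ici 0) :=
  (h.continuous_ratio _).congr fun _ hx => h.thetaFun_eq hx

theorem extend_deriv_AFun_nonpos_iff (h : IsRegularScale Φ W p p₁ p₂ p₃) (hφ : Φ < T.phi δ q)
    {b : ℝ} (hb : 0 ≤ b) : extendAtZero (deriv (AFun T δ q S W)) b ≤ 0 ↔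
      AFun T δ q S W b ≤ thetaFun T S W b := by
  have h0 := h.cont₀
  rw [extendAtZero_eq (g := fun b => Real.exp (-(T.phi δ q) * b) * p b *
      (AFun T δ q S W b - thetaFun T S W b) / ∫ y in Ioi b, Real.exp (-(T.phi δ q) * y) * p y)
    ?_ (fun y hy => (h.deriv_AFun hφ hy).deriv) hb]
  · rw [div_le_iff₀ (h.den_pos hφ hb), zero_mul, ← sub_nonpos (a := AFun T δ q S W b)]
    have hpos : 0 < Real.exp (-(T.phi δ q) * b) * p b := mul_pos (Real.exp_pos _) (h.pos b hb)
    constructor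
    · intro hle
      by_contra hcon
      exact hle.not_gt (mul_pos hpos (not_le.1 hcon))
    · exact fun hle => mul_nonpos_of_nonneg_of_nonpos hpos.le hle
  · have c1 := h.continuousOn_AFun (S := S) hφ
    have c2 := h.continuousOn_thetaFun (T := T) (S := S)
    have c3 := continuousOn_integral_Ioi (g := fun y => Real.exp (-(T.phi δ q) * y) * p y)
      (by fun_prop) (h.integrableOn_den hφ)
    have c4 : ContinuousOn (fun b => Real.exp (-(T.phi δ q) * b) * p b *
      (AFun T δ q S W b - thetaFun T S W b) / ∫ y in Ioi b, Real.exp (-(T.phi δ q) * y) * p y)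
      (Ici 0) := ContinuousOn.div (by fun_prop) c3 fun b hb => (h.den_pos hφ hb).ne'
    exact c4 0 self_mem_Ici

/-- Both functions are continuous at 0 from the right, so a strict inequality there persists on some
[0, ε); otherwise 0 itself belongs to the set. -/
theorem bStar_pos_iff (h : IsRegularScale Φ W p p₁ p₂ p₃) (hφ : Φ < T.phi δ q) :
    0 < bStar T δ q S W ↔ thetaFun T S W 0 < AFun T δ q S W 0 := by
  constructor
  · intro hb
    by_contra hcon
    have : bStar T δ q S W ≤ ((0 : ℝ) : EReal) := infReal_le ⟨le_rfl, not_lt.1 hcon⟩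
    exact absurd hb (not_lt.2 this)
  · intro hlt
    have h1 : ∀ᶠ b in 𝓝[≥] (0 : ℝ), thetaFun T S W b < AFun T δ q S W b :=
      (h.continuousOn_thetaFun 0 self_mem_Ici).eventually_lt
        (h.continuousOn_AFun hφ 0 self_mem_Ici) hlt
    obtain ⟨ε, hε, hs⟩ := (mem_nhdsGE_iff_exists_Ico_subset).1 h1
    have hε' : (0 : ℝ) < ε := hε
    have : (ε : EReal) ≤ bStar T δ q S W := by
      refine le_sInf ?_
      rintro _ ⟨b, ⟨hb0, hb⟩, rfl⟩
      refine EReal.coe_le_coe_iff.2 (not_lt.1 fun hcon => ?_)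
      exact hb.not_gt (hs ⟨hb0, hcon⟩)
    exact (EReal.coe_lt_coe_iff.2 hε').trans_le this

/-- By unimodality `thetaFun` is nonincreasing on [a, ∞), and a weighted average of its values there
is at most its value at a. -/
theorem AFun_le_thetaFun (h : IsRegularScale Φ W p p₁ p₂ p₃) (hφ : Φ < T.phi δ q)
    (hκ : 0 < S * (T.σ ^ 2 / 2)) (h0 : 0 < slope (S * (T.σ ^ 2 / 2)) p p₁ p₂ 0) {a : ℝ}
    (ha : 0 < a) (hs : slope (S * (T.σ ^ 2 / 2)) p p₁ p₂ a ≤ 0) :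
    AFun T δ q S W a ≤ thetaFun T S W a := by
  have hanti : AntitoneOn (thetaFun T S W) (Ici a) := by
    refine antitoneOn_of_deriv_nonpos (convex_Ici a)
      (h.continuousOn_thetaFun.mono (Ici_subset_Ici.2 ha.le)) ?_ ?_
    · intro x hx
      rw [interior_Ici] at hx
      exact (h.deriv_thetaFun (ha.trans hx)).differentiableAt.differentiableWithinAt
    · intro x hx
      rw [interior_Ici] at hx
      rw [(h.deriv_thetaFun (ha.trans hx)).deriv]
      exact div_nonpos_of_nonpos_of_nonneg (h.slope_nonpos_of_le hκ h0 ha (le_of_lt hx) hs)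
        (sq_nonneg _)
  rw [h.AFun_eq ha.le, div_le_iff₀ (h.den_pos hφ ha.le), ← integral_const_mul]
  have hsub : Ioi a ⊆ Ioi (0 : ℝ) := Ioi_subset_Ioi ha.le
  refine setIntegral_mono_on ((h.integrableOn_num hφ _).mono_set hsub)
    (((h.integrableOn_den hφ).mono_set hsub).const_mul _) measurableSet_Ioi fun y hy => ?_
  have hy0 : 0 ≤ y := ha.le.trans (le_of_lt hy)
  have h1 := hanti self_mem_Ici (le_of_lt hy : a ≤ y) (le_of_lt hy)
  rw [h.thetaFun_eq hy0, div_le_iff₀ (h.pos y hy0)] at h1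
  have := mul_le_mul_of_nonneg_left h1 (Real.exp_pos (-(T.phi δ q) * y)).le
  linarith

/-- W'' is nondecreasing, starts negative and becomes positive, so it has a zero a. Beyond a it is
strictly positive, since e^{-Φx} W'' strictly increases; so a minimises W' and no later point does.
-/
theorem exists_isAStar (h : IsRegularScale Φ W p p₁ p₂ p₃) :
    ∃ a, 0 < a ∧ p₁ a = 0 ∧ IsAStar W a := by
  obtain ⟨x₁, hx₁, hp⟩ := h.exists_deriv_pos
  obtain ⟨a, ha, e⟩ := intermediate_value_Icc hx₁.le h.cont₁.continuousOn
    ⟨h.deriv_zero_neg.le, hp.le⟩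
  have ha0 : 0 < a := by
    refine ha.1.lt_of_ne ?_
    rintro rfl
    exact h.deriv_zero_neg.ne e
  have hanti : AntitoneOn p (Icc 0 a) := by
    refine antitoneOn_of_deriv_nonpos (convex_Icc 0 a) h.cont₀.continuousOn ?_ ?_
    · intro x hx
      rw [interior_Icc] at hx
      exact (h.deriv₁ x hx.1).differentiableAt.differentiableWithinAt
    · intro x hx
      rw [interior_Icc] at hx
      rw [(h.deriv₁ x hx.1).deriv, ← e]
      exact h.deriv_mono hx.1.le hx.2.le
  have hmono : StrictMonoOn p (Ici a) := by
    refine strictMonoOn_of_deriv_pos (convex_Ici a) h.cont₀.continuousOn fun x hx => ?_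
    rw [interior_Ici] at hx
    rw [(h.deriv₁ x (ha0.trans hx)).deriv]
    exact h.deriv_pos_of_lt ha0.le hx e.ge
  refine ⟨a, ha0, e, ⟨ha0.le, ?_⟩, ?_⟩
  · rw [isMinOn_iff]
    intro y hy
    rw [h.scaleDeriv_one ha0.le, h.scaleDeriv_one hy]
    rcases le_total y a with hya | hya
    · exact hanti ⟨hy, hya⟩ ⟨ha0.le, le_rfl⟩ hya
    · exact hmono.monotoneOn self_mem_Ici hya hya
  · rintro x ⟨hx, hmin⟩
    by_contra hcon
    have hax := not_le.1 hcon
    have h1 := isMinOn_iff.1 hmin a ha0.le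
    rw [h.scaleDeriv_one ha0.le, h.scaleDeriv_one hx] at h1
    exact h1.not_gt (hmono self_mem_Ici hax.le hax)

/-- The conclusions on the thresholds, in terms of values at the origin. -/
theorem thresholds (h : IsRegularScale Φ W p p₁ p₂ p₃) (hφ : Φ < T.phi δ q)
    (hκ : 0 < S * (T.σ ^ 2 / 2)) (h0 : 0 < slope (S * (T.σ ^ 2 / 2)) p p₁ p₂ 0) :
    infReal {b : ℝ | 0 ≤ b ∧ extendAtZero (deriv (AFun T δ q S W)) b ≤ 0} = bStar T δ q S W ∧
    (0 < bStar T δ q S W ↔ thetaFun T S W 0 < AFun T δ q S W 0) ∧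
    ∃ aStar : ℝ, IsAStar W aStar ∧
      bStar T δ q S W ≤ aSStar T S W ∧ aSStar T S W ≤ (aStar : EReal) := by
  refine ⟨?_, h.bStar_pos_iff hφ, ?_⟩
  · unfold bStar
    congr 1
    ext b
    exact and_congr_right fun hb => h.extend_deriv_AFun_nonpos_iff hφ hb
  · obtain ⟨a, ha, e, hA⟩ := h.exists_isAStar
    refine ⟨a, hA, ?_, ?_⟩
    · refine le_sInf ?_
      rintro _ ⟨b, ⟨hb, hb'⟩, rfl⟩
      rw [h.extend_deriv_thetaFun hb] at hb'
      have hs : slope (S * (T.σ ^ 2 / 2)) p p₁ p₂ b ≤ 0 := by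
        by_contra hcon
        exact hb'.not_gt (div_pos (not_le.1 hcon) (pow_pos (h.pos b hb) 2))
      have hb0 : 0 < b := by
        refine hb.lt_of_ne ?_
        rintro rfl
        exact hs.not_gt h0
      exact infReal_le ⟨hb, h.AFun_le_thetaFun hφ hκ h0 hb0 hs⟩
    -- Where p₁ = 0 the slope reduces to -κ p p₂ ≤ 0.
    · refine infReal_le ⟨ha.le, ?_⟩
      rw [h.extend_deriv_thetaFun ha.le]
      refine div_nonpos_of_nonpos_of_nonneg ?_ (sq_nonneg _)
      have := mul_nonneg hκ.le (mul_nonneg (h.pos a ha.le).le (h.second_nonneg ha))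
      simp only [slope, e]
      linarith

end IsRegularScale

/-! ### The Laplace exponent and its right inverses. -/

/-- As f tends to infinity, every point with f < q has a root to its right. The set of roots is thus
nonempty, and it is bounded and closed, so `sSup` is the genuine largest root and f > q beyond it.
-/
theorem sSup_level_spec {f : ℝ → ℝ} {q : ℝ} (hf : ContinuousOn f (Ici 0))
    (htop : Tendsto f atTop atTop) (h0 : f 0 < q) {m : ℝ}
    (hm : m = sSup {θ : ℝ | 0 ≤ θ ∧ f θ = q}) :
    0 < m ∧ f m = q ∧ (∀ θ > m, q < f θ) ∧ ∀ θ, 0 ≤ θ → f θ < q → θ < m := by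
  set Z := {θ : ℝ | 0 ≤ θ ∧ f θ = q} with hZ
  have hroot : ∀ θ, 0 ≤ θ → f θ < q → ∃ η ∈ Z, θ < η := by
    intro θ hθ hlt
    obtain ⟨B, hB1, hB2⟩ := ((htop.eventually_ge_atTop q).and (eventually_ge_atTop θ)).exists
    obtain ⟨η, hη, e⟩ := intermediate_value_Icc hB2 (hf.mono fun x hx => hθ.trans hx.1)
      ⟨hlt.le, hB1⟩
    refine ⟨η, ⟨hθ.trans hη.1, e⟩, hη.1.lt_of_ne ?_⟩
    rintro rfl
    exact hlt.ne e
  obtain ⟨B, hB⟩ := eventually_atTop.1 (htop.eventually_gt_atTop q)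
  have hbdd : BddAbove Z := ⟨B, fun θ hθ => by
    by_contra hcon
    exact (hB θ (not_le.1 hcon).le).ne' hθ.2⟩
  obtain ⟨η, hη, hη0⟩ := hroot 0 le_rfl h0
  have hclosed : IsClosed Z := by
    have : Z = Ici 0 ∩ f ⁻¹' {q} := by ext; simp [hZ]
    rw [this]
    exact hf.preimage_isClosed_of_isClosed isClosed_Ici isClosed_singleton
  have hmem : m ∈ Z := hm ▸ hclosed.csSup_mem ⟨η, hη⟩ hbdd
  have hle : ∀ θ ∈ Z, θ ≤ m := fun θ hθ => hm ▸ le_csSup hbdd hθ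
  refine ⟨hη0.trans_le (hle η hη), hmem.2, fun θ hθ => ?_, fun θ hθ hlt => ?_⟩
  · have hθ0 := hmem.1.trans hθ.le
    rcases lt_trichotomy (f θ) q with h | h | h
    · obtain ⟨ξ, hξ, hlt⟩ := hroot θ hθ0 h
      linarith [hle ξ hξ]
    · linarith [hle θ ⟨hθ0, h⟩]
    · exact h
  · obtain ⟨ξ, hξ, hlt⟩ := hroot θ hθ hlt
    exact hlt.trans_le (hle ξ hξ)

theorem continuousOn_laplaceTransform {ρ : ℝ → ℝ} (hint : IntegrableOn ρ (Ioi 0)) :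
    ContinuousOn (laplaceTransform ρ) (Ici 0) := by
  unfold laplaceTransform
  refine continuousOn_of_dominated (bound := fun x => ‖ρ x‖) ?_ ?_ hint.norm ?_
  · intro θ hθ
    exact (laplaceIntegrable_of_integrableOn hint hθ).aestronglyMeasurable
  · intro θ hθ
    refine (ae_restrict_iff' measurableSet_Ioi).2 (Eventually.of_forall fun x hx => ?_)
    rw [norm_mul]
    refine mul_le_of_le_one_left (norm_nonneg _) ?_
    rw [Real.norm_eq_abs, abs_of_pos (Real.exp_pos _), Real.exp_le_one_iff, neg_mul, neg_nonpos]
    exact mul_nonneg hθ (le_of_lt hx)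
  · exact Eventually.of_forall fun x => by fun_prop

namespace LevyTriplet

variable {T : LevyTriplet} {ρ : ℝ → ℝ}

theorem lintegral_density (h : T.jump = (volume.restrict (Ioi 0)).withDensity
    (fun x => ENNReal.ofReal (ρ x))) :
    T.jump (Ioi 0) = ∫⁻ x in Ioi (0 : ℝ), ENNReal.ofReal (ρ x) := by
  rw [h, withDensity_apply _ measurableSet_Ioi, Measure.restrict_restrict measurableSet_Ioi,
    inter_self]

theorem integrableOn_density (hρ : IsCompletelyMonotone ρ)
    (h : T.jump = (volume.restrict (Ioi 0)).withDensity (fun x => ENNReal.ofReal (ρ x)))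
    (hfin : T.jump (Ioi 0) < ⊤) : IntegrableOn ρ (Ioi 0) := by
  refine (lintegral_ofReal_ne_top_iff_integrable
    (hρ.continuousOn.aestronglyMeasurable measurableSet_Ioi) ?_).1 ?_
  · exact (ae_restrict_iff' measurableSet_Ioi).2 (Eventually.of_forall fun x hx => hρ.nonneg hx)
  · rw [← lintegral_density h]; exact hfin.ne

theorem jump_toReal (hρ : IsCompletelyMonotone ρ)
    (h : T.jump = (volume.restrict (Ioi 0)).withDensity (fun x => ENNReal.ofReal (ρ x))) :
    (T.jump (Ioi 0)).toReal = laplaceTransform ρ 0 := by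
  rw [lintegral_density h, laplaceTransform]
  simp only [neg_zero, zero_mul, Real.exp_zero, one_mul]
  rw [integral_eq_lintegral_of_nonneg_ae]
  · exact (ae_restrict_iff' measurableSet_Ioi).2 (Eventually.of_forall fun x hx => hρ.nonneg hx)
  · exact hρ.continuousOn.aestronglyMeasurable measurableSet_Ioi

theorem integral_exp_jump (hρ : IsCompletelyMonotone ρ)
    (h : T.jump = (volume.restrict (Ioi 0)).withDensity (fun x => ENNReal.ofReal (ρ x))) (θ : ℝ) :
    ∫ z in Ioi (0 : ℝ), Real.exp (-θ * z) ∂T.jump = laplaceTransform ρ θ := by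
  rw [h, restrict_withDensity measurableSet_Ioi, Measure.restrict_restrict measurableSet_Ioi,
    inter_self, integral_withDensity_eq_integral_toReal_smul₀, laplaceTransform]
  · refine setIntegral_congr_fun measurableSet_Ioi fun z hz => ?_
    rw [ENNReal.toReal_ofReal (hρ.nonneg hz), smul_eq_mul, mul_comm]
  · exact (hρ.continuousOn.aemeasurable measurableSet_Ioi).ennreal_ofReal
  · exact Eventually.of_forall fun _ => ENNReal.ofReal_lt_top

/-- For a finite jump measure the compensator θz on (0, 1) is separately integrable and merges with
γ into the drift. -/
theorem psi_eq (hρ : IsCompletelyMonotone ρ)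
    (h : T.jump = (volume.restrict (Ioi 0)).withDensity (fun x => ENNReal.ofReal (ρ x)))
    (hfin : T.jump (Ioi 0) < ⊤) {θ : ℝ} (hθ : 0 ≤ θ) :
    T.psi θ = T.drift * θ + T.σ ^ 2 / 2 * θ ^ 2
      - (laplaceTransform ρ 0 - laplaceTransform ρ θ) := by
  have : IsFiniteMeasure (T.jump.restrict (Ioi 0)) := ⟨by simpa using hfin⟩
  have i1 : Integrable (fun _ : ℝ => (1 : ℝ)) (T.jump.restrict (Ioi 0)) := integrable_const _
  have i2 : Integrable (fun z => Real.exp (-θ * z)) (T.jump.restrict (Ioi 0)) := by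
    refine i1.mono' (Continuous.aestronglyMeasurable (by fun_prop)) ?_
    refine (ae_restrict_iff' measurableSet_Ioi).2 (Eventually.of_forall fun x hx => ?_)
    rw [Real.norm_eq_abs, abs_of_pos (Real.exp_pos _), Real.exp_le_one_iff, neg_mul, neg_nonpos]
    exact mul_nonneg hθ (le_of_lt hx)
  have i3 : Integrable ((Ioo (0 : ℝ) 1).indicator fun z => θ * z) (T.jump.restrict (Ioi 0)) := by
    refine (integrable_const θ).mono' ?_ (Eventually.of_forall fun z => ?_)
    · exact ((measurable_const.mul measurable_id).indicator measurableSet_Ioo).aestronglyMeasurable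
    · rw [indicator_apply]
      split_ifs with hz
      · rw [Real.norm_eq_abs, abs_of_nonneg (mul_nonneg hθ hz.1.le)]
        exact mul_le_of_le_one_right hθ hz.2.le
      · simpa using hθ
  have e3 : ∫ z in Ioi (0 : ℝ), (Ioo (0 : ℝ) 1).indicator (fun z => θ * z) z ∂T.jump
      = θ * ∫ z in Ioo (0 : ℝ) 1, z ∂T.jump := by
    rw [setIntegral_indicator measurableSet_Ioo, integral_const_mul,
      inter_eq_right.2 Ioo_subset_Ioi_self]
  unfold psi drift
  have i12 : Integrable (fun z => 1 - Real.exp (-θ * z)) (T.jump.restrict (Ioi 0)) := i1.sub i2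
  rw [integral_sub i12 i3, integral_sub i1 i2, e3, integral_exp_jump hρ h,
    ← jump_toReal hρ h]
  simp [Measure.real]
  ring

end LevyTriplet

/-! ### Derivatives of the scale function and their log-convexity. -/

section Construction

/-- Second derivatives are controlled only on (0, ∞); the inequalities are carried to the origin
because `pos_of_sq_le` starts from positivity there. -/
theorem nonneg_and_sq_le_of_continuous {K : ℝ → ℝ} (hK : Continuous K)
    (h : ∀ x > 0, ∀ y > 0, 0 ≤ K (x + x) ∧ K (x + y) ^ 2 ≤ K (x + x) * K (y + y)) :
    ∀ x ≥ 0, ∀ y ≥ 0, 0 ≤ K (x + x) ∧ K (x + y) ^ 2 ≤ K (x + x) * K (y + y) := by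
  intro x hx y hy
  have hlim {F : ℝ → ℝ} (hF : Continuous F) : Tendsto F (𝓝[>] 0) (𝓝 (F 0)) :=
    (hF.tendsto 0).mono_left nhdsWithin_le_nhds
  have hpos : ∀ᶠ ε : ℝ in 𝓝[>] 0, 0 < x + ε ∧ 0 < y + ε := by
    filter_upwards [self_mem_nhdsWithin] with ε hε
    have : (0 : ℝ) < ε := hε
    constructor <;> positivity
  constructor
  · have h1 := hlim (F := fun ε => K (x + ε + (x + ε))) (by fun_prop)
    simp only [add_zero] at h1
    exact ge_of_tendsto h1 (hpos.mono fun ε hε => (h _ hε.1 _ hε.2).1)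
  · have h1 := hlim (F := fun ε => K (x + ε + (y + ε)) ^ 2) (by fun_prop)
    have h2 := hlim (F := fun ε => K (x + ε + (x + ε)) * K (y + ε + (y + ε))) (by fun_prop)
    simp only [add_zero] at h1 h2
    exact le_of_tendsto_of_tendsto h1 h2 (hpos.mono fun ε hε => (h _ hε.1 _ hε.2).2)

variable {ρ W ψ : ℝ → ℝ} {s c q Φ : ℝ}

/-- The scale function of the Laplace exponent `ψ(θ) = c θ + s θ² - ∫ (1 - e^{-θz}) ρ(z) dz` with
`ρ` completely monotone and integrable. -/
theorem exists_isRegularScale (hρ : IsCompletelyMonotone ρ) (hint : IntegrableOn ρ (Ioi 0))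
    (hs : 0 < s) (hc : 0 < c) (hq : 0 < q) (hΦ : 0 < Φ)
    (hψ : ∀ θ, 0 ≤ θ → ψ θ = c * θ + s * θ ^ 2 - (laplaceTransform ρ 0 - laplaceTransform ρ θ))
    (hψΦ : ψ Φ = q) (hψq : ∀ θ > Φ, q < ψ θ) (hWc : ContinuousOn W (Ici 0))
    (hWi : ∀ θ > Φ, LaplaceIntegrable W θ)
    (hWl : ∀ θ > Φ, laplaceTransform W θ = 1 / (ψ θ - q)) :
    ∃ p p₁ p₂ p₃ : ℝ → ℝ, IsRegularScale Φ W p p₁ p₂ p₃ ∧ p 0 = s⁻¹ ∧ p₁ 0 = s⁻¹ * -(c / s) ∧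
      p₂ 0 = s⁻¹ * ((c / s) ^ 2 + s⁻¹ * (q + laplaceTransform ρ 0)) := by
  have hρ0 : ∀ t > 0, 0 ≤ ρ t := fun t ht => hρ.nonneg ht
  have hρc := hρ.continuousOn
  set w : ℝ → ℝ := fun x => W (max x 0) with hw
  have hwW : ∀ x, 0 ≤ x → w x = W x := fun x hx => by simp only [hw, max_eq_left hx]
  have hwc : Continuous w :=
    hWc.comp_continuous (by fun_prop) fun x => le_max_right x 0
  have hwi : ∀ θ > Φ, LaplaceIntegrable w θ := fun θ hθ =>
    (hWi θ hθ).congr_fun (fun x hx => by simp only [hwW x (le_of_lt hx)]) measurableSet_Ioi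
  have hwl : ∀ θ > Φ, laplaceTransform w θ = 1 / (ψ θ - q) := fun θ hθ => by
    rw [← hWl θ hθ]
    exact setIntegral_congr_fun measurableSet_Ioi fun x hx => by simp only [hwW x (le_of_lt hx)]
  -- the equation for `W'`
  set r : ℝ → ℝ := fun x => q * 1 + expTail ρ 0 x with hr
  have htc := expTail_continuous hint le_rfl
  have hrc : Continuous r := by fun_prop
  have hri : ∀ θ > Φ, LaplaceIntegrable r θ := fun θ hθ =>
    ((laplaceIntegrable_one (hΦ.trans hθ)).const_mul q).add
      (expTail_laplaceIntegrable hint hρ0 le_rfl (hΦ.trans hθ))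
  have hrl : ∀ θ > Φ, (s * θ + c - laplaceTransform r θ) * laplaceTransform w θ = 1 / θ := by
    intro θ hθ
    have hθ0 := hΦ.trans hθ
    have h1 := laplaceTransform_expTail hint hρc hρ0 le_rfl hθ0
    have h2 : laplaceTransform r θ = q * (1 / θ) + laplaceTransform (expTail ρ 0) θ := by
      rw [← laplaceTransform_one hθ0, ← laplaceTransform_const_mul]
      exact laplaceTransform_add ((laplaceIntegrable_one hθ0).const_mul q)
        (expTail_laplaceIntegrable hint hρ0 le_rfl hθ0)
    have h3 : ψ θ - q = θ * (s * θ + c - laplaceTransform r θ) := by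
      rw [h2, hψ θ hθ0.le]
      field_simp
      linarith
    have h4 := sub_pos.2 (hψq θ hθ)
    rw [hwl θ hθ, eq_div_iff hθ0.ne', mul_one_div, div_mul_eq_mul_div, mul_comm _ θ, ← h3,
      div_self h4.ne']
  obtain ⟨u, hu, hwu⟩ := exists_isMemorySolution hs hwc hrc fun x hx =>
    integral_equation_of_laplaceTransform hΦ.le hwc hrc hwi hri hrl hx
  have hsrc : Continuous fun x => s⁻¹ * r x := by fun_prop
  obtain ⟨u₁, u₂, u₃, cu₁, cu₂, eu₁, eu₂, du, du₁, du₂⟩ := hu.exists_derivs hsrc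
    (r' := fun x => s⁻¹ * (0 * expTail ρ 0 x - ρ x)) fun x hx =>
      ((expTail_hasDerivAt hint hρc le_rfl hx).const_add (q * 1)).const_mul s⁻¹
  -- The constant q is q times the exponential of rate 0, and the rest is a tail of ρ.
  have hpos_r : IsPosKernel (hankelForm (fun x => s⁻¹ * r x) u) := by
    have h1 := ((isPosKernel_hankelForm_exp u 0).const_mul hq.le).add
      (isPosKernel_hankelForm_expTail hρ hint le_rfl hu.continuous)
    refine (h1.const_mul (inv_pos.2 hs).le).congr fun x y _ _ => ?_
    rw [hankelForm_const_mul, hr, hankelForm_add (by fun_prop) htc hu.continuous,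
      hankelForm_const_mul]
    simp
  have hKp : IsPosKernel fun x y => s⁻¹ * u (x + y) :=
    (hu.isPosKernel hsrc hpos_r).const_mul (inv_pos.2 hs).le
  -- the equation for `W' - Φ W`
  set v : ℝ → ℝ := fun x => w x + (-Φ) * causalConv (fun _ => 1) w x with hv
  have hvc : Continuous v := by fun_prop
  have hoi : ∀ θ > Φ, LaplaceIntegrable (causalConv (fun _ => 1) w) θ := fun θ hθ =>
    (laplaceIntegrable_one (hΦ.trans hθ)).causalConv (hwi θ hθ)
  have hvi : ∀ θ > Φ, LaplaceIntegrable v θ := fun θ hθ =>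
    (hwi θ hθ).add ((hoi θ hθ).const_mul (-Φ))
  set t : ℝ → ℝ := expTail ρ Φ with ht
  have htc' : Continuous t := expTail_continuous hint hΦ.le
  have htl : ∀ θ > Φ, (s * θ + (c + s * Φ) - laplaceTransform t θ) * laplaceTransform v θ
      = 1 / θ := by
    intro θ hθ
    have hθ0 := hΦ.trans hθ
    have h1 := laplaceTransform_expTail hint hρc hρ0 hΦ.le hθ0
    have h2 : laplaceTransform v θ = (θ - Φ) / θ * (1 / (ψ θ - q)) := by
      simp only [hv]
      rw [laplaceTransform_add (hwi θ hθ) ((hoi θ hθ).const_mul (-Φ)), laplaceTransform_const_mul,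
        laplaceTransform_causalConv (laplaceIntegrable_one hθ0) (hwi θ hθ),
        laplaceTransform_one hθ0, hwl θ hθ]
      field_simp
      ring
    -- Subtracting ψ(Φ) = q divides the root Φ out of the exponent; `expTail ρ Φ` accounts for the
    -- jump part.
    have h3 : ψ θ - q = (θ - Φ) * (s * θ + (c + s * Φ) - laplaceTransform t θ) := by
      rw [mul_sub (θ - Φ), h1, ← hψΦ, hψ θ hθ0.le, hψ Φ hΦ.le]
      ring
    have h4 := sub_pos.2 (hψq θ hθ)
    rw [h2, mul_comm, eq_div_iff hθ0.ne']
    have : (θ - Φ) / θ * (1 / (ψ θ - q)) * (s * θ + (c + s * Φ) - laplaceTransform t θ) * θ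
        = ((θ - Φ) * (s * θ + (c + s * Φ) - laplaceTransform t θ)) / (ψ θ - q) := by
      field_simp
    rw [this, ← h3, div_self h4.ne']
  obtain ⟨y, hy, hvy⟩ := exists_isMemorySolution hs hvc htc' fun x hx =>
    integral_equation_of_laplaceTransform hΦ.le hvc htc' hvi (fun θ hθ =>
      expTail_laplaceIntegrable hint hρ0 hΦ.le (hΦ.trans hθ)) htl hx
  have hstc : Continuous fun x => s⁻¹ * t x := by fun_prop
  obtain ⟨y₁, y₂, y₃, cy₁, cy₂, ey₁, ey₂, dy, dy₁, dy₂⟩ := hy.exists_derivs hstc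
    (r' := fun x => s⁻¹ * (Φ * expTail ρ Φ x - ρ x)) fun x hx =>
      (expTail_hasDerivAt hint hρc hΦ.le hx).const_mul s⁻¹
  have hpos_t : IsPosKernel (hankelForm (fun x => s⁻¹ * t x) y) :=
    ((isPosKernel_hankelForm_expTail hρ hint hΦ.le hy.continuous).const_mul
      (inv_pos.2 hs).le).congr fun _ _ _ _ => hankelForm_const_mul _ _ _ _ _
  have hKy := hy.isPosKernel hstc hpos_t
  have hy₂ : ∀ x > 0, ∀ z > 0, 0 ≤ y₂ (x + x) ∧ y₂ (x + z) ^ 2 ≤ y₂ (x + x) * y₂ (z + z) :=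
    fun x hx z hz => hKy.second_deriv dy dy₁ cy₂.continuousOn hx hz
  have ht0 : 0 ≤ t 0 := expTail_nonneg hρ0 0
  -- y₂(0) = a² + t(0)/s with a = (c + sΦ)/s > 0.
  have hy₂0 : 0 < y₂ 0 := by rw [ey₂]; positivity
  have hy₂pos : ∀ x > 0, 0 < y₂ x := fun x hx =>
    pos_of_sq_le cy₂ hy₂0 (nonneg_and_sq_le_of_continuous cy₂ hy₂) (le_of_lt hx)
  -- matching the derivatives
  have dw : ∀ x > 0, HasDerivAt w (s⁻¹ * u x) x := fun x hx =>
    (hasDerivAt_of_eq_integral (c := 0) hu.continuous (f := fun x => s * w x) (fun z hz => by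
      rw [hwu z hz, mul_inv_cancel_left₀ hs.ne', zero_add]) hx).const_mul s⁻¹ |>.congr_of_eventuallyEq
      (Eventually.of_forall fun z => by simp only [inv_mul_cancel_left₀ hs.ne'])
  have m₀ : ∀ x > 0, s⁻¹ * u x - Φ * w x = s⁻¹ * y x := by
    intro x hx
    have h1 : HasDerivAt v (s⁻¹ * u x + (-Φ) * w x) x := by
      refine (dw x hx).add (HasDerivAt.const_mul (-Φ) ?_)
      exact hasDerivAt_of_eq_integral (c := 0) hwc
        (fun z _ => by rw [causalConv_one_left, zero_add]) hx
    have h2 : HasDerivAt v (s⁻¹ * y x) x :=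
      (hasDerivAt_of_eq_integral (c := 0) hy.continuous (f := fun x => s * v x) (fun z hz => by
        rw [hvy z hz, mul_inv_cancel_left₀ hs.ne', zero_add]) hx).const_mul s⁻¹
        |>.congr_of_eventuallyEq
        (Eventually.of_forall fun z => by simp only [inv_mul_cancel_left₀ hs.ne'])
    rw [← h1.unique h2]; ring
  have step : ∀ {f f' g g' k k' : ℝ → ℝ}, (∀ x > 0, HasDerivAt f (f' x) x) →
      (∀ x > 0, HasDerivAt g (g' x) x) → (∀ x > 0, HasDerivAt k (k' x) x) →
      (∀ x > 0, f x - Φ * g x = k x) → ∀ x > 0, f' x - Φ * g' x = k' x := by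
    intro f f' g g' k k' df dg dk e x hx
    have h1 := (df x hx).sub ((dg x hx).const_mul Φ)
    refine h1.unique ((dk x hx).congr_of_eventuallyEq ?_)
    exact (eventually_gt_nhds hx).mono fun z hz => e z hz
  have dp : ∀ x > 0, HasDerivAt (fun x => s⁻¹ * u x) (s⁻¹ * u₁ x) x :=
    fun x hx => (du x hx).const_mul _
  have dp₁ : ∀ x > 0, HasDerivAt (fun x => s⁻¹ * u₁ x) (s⁻¹ * u₂ x) x :=
    fun x hx => (du₁ x hx).const_mul _
  have dp₂ : ∀ x > 0, HasDerivAt (fun x => s⁻¹ * u₂ x) (s⁻¹ * u₃ x) x :=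
    fun x hx => (du₂ x hx).const_mul _
  have m₁ := step dp dw (fun x hx => (dy x hx).const_mul s⁻¹) m₀
  have m₂ := step dp₁ dp (fun x hx => (dy₁ x hx).const_mul s⁻¹) m₁
  have m₃ := step dp₂ dp₁ (fun x hx => (dy₂ x hx).const_mul s⁻¹) m₂
  have cu := hu.continuous
  have hs' : 0 < s⁻¹ := inv_pos.2 hs
  have hppos : ∀ x, 0 ≤ x → 0 < s⁻¹ * u x := fun x hx =>
    pos_of_sq_le (K := fun x => s⁻¹ * u x) (by fun_prop) (by simpa [hu.apply_zero] using hs)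
      (fun x hx z hz => IsPosKernel.nonneg_and_sq_le (f := fun x => s⁻¹ * u x) hKp hx hz) hx
  have dW : ∀ x > 0, HasDerivAt W (s⁻¹ * u x) x := fun x hx =>
    (dw x hx).congr_of_eventuallyEq
      ((eventually_gt_nhds hx).mono fun z hz => (hwW z (le_of_lt hz)).symm)
  have hW0 : W 0 = 0 := by rw [← hwW 0 le_rfl, hwu 0 le_rfl]; simp
  refine ⟨fun x => s⁻¹ * u x, fun x => s⁻¹ * u₁ x, fun x => s⁻¹ * u₂ x, fun x => s⁻¹ * u₃ x,
    ⟨hΦ, hWc, hW0, by fun_prop, by fun_prop, by fun_prop, dW, dp, dp₁, dp₂, hppos, ?_, ?_, ?_, hWi,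
      ?_, ?_⟩, ?_, ?_, ?_⟩
  · intro x hx
    exact sq_deriv_le_of_log_convex (fun z hz => hppos z (le_of_lt hz)) dp dp₁
      (fun z hz z' hz' => (IsPosKernel.nonneg_and_sq_le (f := fun x => s⁻¹ * u x) hKp
        (le_of_lt hz) (le_of_lt hz')).2) hx
  · intro x hx
    rw [m₂ x hx]
    exact mul_pos hs' (hy₂pos x hx)
  · intro x hx z hxz
    rw [m₂ x hx, m₃ x hx, m₂ z (hx.trans_le hxz), m₃ z (hx.trans_le hxz)]
    have := mul_le_mul_of_nonneg_left
      (deriv_mul_le_of_sq_le hy₂pos dy₂ (fun a ha b hb => (hy₂ a ha b hb).2) hx hxz)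
      (mul_pos hs' hs').le
    linarith
  · simp only [eu₁]
    have : 0 < c / s := div_pos hc hs
    nlinarith
  -- If W'' ≤ 0 throughout, then W(x) ≤ x/s, so its transform stays bounded as θ decreases to Φ; but
  -- it equals 1/(ψ(θ) - q), which blows up there because ψ(Φ) = q.
  · by_contra hcon
    push Not at hcon
    have hanti : AntitoneOn (fun x => s⁻¹ * u x) (Ici 0) := by
      refine antitoneOn_of_deriv_nonpos (convex_Ici 0) (by fun_prop) ?_ ?_
      · intro x hx
        rw [interior_Ici] at hx
        exact (dp x hx).differentiableAt.differentiableWithinAt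
      · intro x hx
        rw [interior_Ici] at hx
        rw [(dp x hx).deriv]
        exact hcon x hx
    have hle : ∀ x, 0 ≤ x → W x ≤ s⁻¹ * causalConv (fun _ => 1) (fun _ => 1) x := by
      intro x hx
      rw [← hwW x hx, hwu x hx, causalConv_one_left]
      refine mul_le_mul_of_nonneg_left (intervalIntegral.integral_mono_on hx
        (cu.intervalIntegrable _ _) (continuous_const.intervalIntegrable _ _) fun z hz => ?_) hs'.le
      have := hanti self_mem_Ici hz.1 hz.1
      simp only [hu.apply_zero] at this
      exact le_of_mul_le_mul_left this hs'
    have hW_nonneg : ∀ x, 0 ≤ x → 0 ≤ W x := by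
      intro x hx
      rw [← hwW x hx, hwu x hx]
      exact mul_nonneg hs'.le (intervalIntegral.integral_nonneg hx fun z hz =>
        (pos_of_mul_pos_right (hppos z hz.1) hs'.le).le)
    have hi1 := laplaceIntegrable_one hΦ
    have hi : LaplaceIntegrable (fun x => s⁻¹ * causalConv (fun _ => 1) (fun _ => 1) x) Φ :=
      (hi1.causalConv hi1).const_mul s⁻¹
    set B := laplaceTransform (fun x => s⁻¹ * causalConv (fun _ => 1) (fun _ => 1) x) Φ
    have hB : ∀ θ > Φ, 1 / (ψ θ - q) ≤ B := by
      intro θ hθ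
      rw [← hWl θ hθ]
      refine setIntegral_mono_on (hWi θ hθ) hi measurableSet_Ioi fun x hx => ?_
      have hx' : (0 : ℝ) ≤ x := le_of_lt hx
      refine mul_le_mul (Real.exp_le_exp.2 ?_) (hle x hx') (hW_nonneg x hx') (Real.exp_pos _).le
      nlinarith
    have hB' : ∀ θ > Φ, 1 ≤ B * (ψ θ - q) := fun θ hθ =>
      (div_le_iff₀ (sub_pos.2 (hψq θ hθ))).1 (hB θ hθ)
    have hψc : ContinuousOn ψ (Ici 0) := by
      have := continuousOn_laplaceTransform hint
      refine ContinuousOn.congr (f := fun θ => c * θ + s * θ ^ 2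
        - (laplaceTransform ρ 0 - laplaceTransform ρ θ)) (by fun_prop) fun θ hθ => hψ θ hθ
    have hlim : Tendsto (fun θ => B * (ψ θ - q)) (𝓝[>] Φ) (𝓝 0) := by
      have h1 := (hψc.continuousAt (Ici_mem_nhds hΦ)).tendsto.mono_left
        (nhdsWithin_le_nhds (s := Ioi Φ))
      have h2 := (h1.sub_const q).const_mul B
      rwa [hψΦ, sub_self, mul_zero] at h2
    have := ge_of_tendsto hlim (b := 1) (by
      filter_upwards [self_mem_nhdsWithin] with θ hθ using hB' θ hθ)
    linarith
  · simp [hu.apply_zero]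
  · simp only [eu₁]
  · simp only [eu₂, hr, expTail_zero, mul_one]

end Construction

/-! ### Values at the origin and conclusion. -/

theorem laplaceTransform_nonneg {ρ : ℝ → ℝ} (hρ : ∀ x > 0, 0 ≤ ρ x) (θ : ℝ) :
    0 ≤ laplaceTransform ρ θ :=
  setIntegral_nonneg measurableSet_Ioi fun x hx => mul_nonneg (Real.exp_pos _).le (hρ x hx)

theorem laplaceTransform_le_zero {ρ : ℝ → ℝ} (hint : IntegrableOn ρ (Ioi 0))
    (hρ : ∀ x > 0, 0 ≤ ρ x) {θ : ℝ} (hθ : 0 ≤ θ) :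
    laplaceTransform ρ θ ≤ laplaceTransform ρ 0 := by
  refine setIntegral_mono_on (laplaceIntegrable_of_integrableOn hint hθ)
    (laplaceIntegrable_of_integrableOn hint le_rfl) measurableSet_Ioi fun x hx => ?_
  refine mul_le_mul_of_nonneg_right (Real.exp_le_exp.2 ?_) (hρ x hx)
  rw [neg_zero, zero_mul, neg_mul, neg_nonpos]
  exact mul_nonneg hθ (le_of_lt hx)

theorem tendsto_quadratic_sub {f : ℝ → ℝ} {c s L : ℝ} (hs : 0 < s)
    (hf : ∀ θ, 0 ≤ θ → c * θ + s * θ ^ 2 - L ≤ f θ) : Tendsto f atTop atTop := by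
  have h1 : Tendsto (fun θ : ℝ => c + s * θ) atTop atTop :=
    tendsto_atTop_add_const_left _ c (tendsto_id.const_mul_atTop hs)
  have h2 := tendsto_atTop_add_const_right atTop (-L) (tendsto_id.atTop_mul_atTop₀ h1)
  refine tendsto_atTop_mono' _ ?_ h2
  filter_upwards [eventually_ge_atTop 0] with θ hθ
  refine le_trans (le_of_eq ?_) (hf θ hθ)
  simp only [id]; ring

namespace IsRegularScale

variable {Φ : ℝ} {W p p₁ p₂ p₃ : ℝ → ℝ} {T : LevyTriplet} {S δ q : ℝ}

/-- The transforms of W' and W'' at φ follow from that of W by Ŵ' = φ Ŵ = 1/δ and Ŵ'' = φ/δ - W'(0).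
-/
theorem AFun_zero (h : IsRegularScale Φ W p p₁ p₂ p₃) (hφ : Φ < T.phi δ q) (hδ : 0 < δ)
    (hl : laplaceTransform W (T.phi δ q) = 1 / (δ * T.phi δ q)) :
    AFun T δ q S W 0 = δ / T.phi δ q - S * (T.σ ^ 2 / 2) * (T.phi δ q - δ * p 0) := by
  have hφ0 := h.Phi_pos.trans hφ
  have hden : laplaceTransform p (T.phi δ q) = 1 / δ := by
    rw [h.expBounded.laplaceTransform_deriv h.expBounded₀ h.continuousOn h.cont₀.continuousOn
      h.deriv₀ hφ, h.apply_zero, hl]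
    field_simp
    ring
  have hnum := h.expBounded₀.laplaceTransform_deriv h.expBounded₁ h.cont₀.continuousOn
    h.cont₁.continuousOn h.deriv₁ hφ
  have hi := laplaceIntegrable_one hφ0
  have hi₁ := (h.expBounded₁.laplaceIntegrable h.cont₁.continuousOn hφ).const_mul
    (-(S * (T.σ ^ 2 / 2)))
  have hsum := laplaceTransform_add hi hi₁
  rw [laplaceTransform_const_mul, laplaceTransform_one hφ0, hnum, hden] at hsum
  have e : (∫ y in Ioi (0 : ℝ), Real.exp (-(T.phi δ q) * y) * (1 - S * (T.σ ^ 2 / 2) * p₁ y))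
      = laplaceTransform (fun x => 1 + -(S * (T.σ ^ 2 / 2)) * p₁ x) (T.phi δ q) := by
    unfold laplaceTransform
    congr 1
    ext y; ring
  rw [h.AFun_eq le_rfl, e, hsum]
  change _ / laplaceTransform p (T.phi δ q) = _
  rw [hden]
  field_simp
  ring

end IsRegularScale

theorem proposition3 (T : LevyTriplet) (q δ S : ℝ)
    (hq : 0 < q) (hδ : 0 < δ) (hS : 0 < S)
    (hσ : 0 < T.σ)
    (hphi : T.phi δ q < 2 * δ / T.σ ^ 2)
    (hfin : T.jump (Ioi 0) < ⊤)
    (hcm : T.HasCompletelyMonotoneDensity)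
    (hSc : S < T.drift / ((T.jump (Ioi 0)).toReal + q))
    (W : ℝ → ℝ) (hW : T.IsScaleFunction q W) :
    infReal {b : ℝ | 0 ≤ b ∧ extendAtZero (deriv (AFun T δ q S W)) b ≤ 0} = bStar T δ q S W ∧
    (0 < bStar T δ q S W ↔
      S < (δ / T.phi δ q - T.σ ^ 2 / 2) / (T.drift - δ + T.phi δ q * (T.σ ^ 2 / 2))) ∧
    ∃ aStar : ℝ, IsAStar W aStar ∧
      bStar T δ q S W ≤ aSStar T S W ∧ aSStar T S W ≤ (aStar : EReal) := by
  obtain ⟨ρ, hcd, hsign, hjump⟩ := hcm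
  have hρ : IsCompletelyMonotone ρ := ⟨hcd, hsign⟩
  have hint := LevyTriplet.integrableOn_density hρ hjump hfin
  have hψ : ∀ θ, 0 ≤ θ → T.psi θ = T.drift * θ + T.σ ^ 2 / 2 * θ ^ 2
      - (laplaceTransform ρ 0 - laplaceTransform ρ θ) :=
    fun θ hθ => LevyTriplet.psi_eq hρ hjump hfin hθ
  have hL := laplaceTransform_nonneg fun x hx => hρ.nonneg hx
  have hL0 := hL 0
  rw [LevyTriplet.jump_toReal hρ hjump, lt_div_iff₀ (by positivity)] at hSc
  set c := T.drift with hc_def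
  have hc : 0 < c := lt_of_le_of_lt (by positivity) hSc
  have hs : 0 < T.σ ^ 2 / 2 := by positivity
  set s := T.σ ^ 2 / 2 with hs_def
  have hψc : ContinuousOn T.psi (Ici 0) := by
    have := continuousOn_laplaceTransform hint
    exact ContinuousOn.congr (f := fun θ => c * θ + s * θ ^ 2
      - (laplaceTransform ρ 0 - laplaceTransform ρ θ)) (by fun_prop) fun θ hθ => hψ θ hθ
  have hψ0 : T.psi 0 = 0 := by rw [hψ 0 le_rfl]; ring
  obtain ⟨hΦ, hψΦ, hψq, -⟩ := sSup_level_spec hψc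
    (tendsto_quadratic_sub (c := c) (L := laplaceTransform ρ 0) hs fun θ hθ => by
      rw [hψ θ hθ]; linarith [hL θ]) (hψ0.trans_lt hq) (rfl : T.Phi q = _)
  obtain ⟨hφ, hψφ, -, hlt⟩ := sSup_level_spec (f := fun θ => T.psi θ - δ * θ) (by fun_prop)
    (tendsto_quadratic_sub (c := c - δ) (L := laplaceTransform ρ 0) hs fun θ hθ => by
      rw [hψ θ hθ]; linarith [hL θ]) (by simpa [hψ0] using hq) (rfl : T.phi δ q = _)
  -- At Φ the exponent of Y is q - δΦ < q, so the largest root φ lies to the right.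
  have hΦφ : T.Phi q < T.phi δ q :=
    hlt _ hΦ.le (by rw [hψΦ]; linarith [mul_pos hδ hΦ])
  obtain ⟨p, p₁, p₂, p₃, h, e₀, e₁, e₂⟩ := exists_isRegularScale hρ hint hs hc hq hΦ hψ hψΦ hψq
    hW.continuousOn hW.integrableOn hW.laplace
  -- With the values of the derivatives at 0, the terms in c² cancel and positivity becomes the
  -- hypothesis bounding S.
  have hslope : 0 < IsRegularScale.slope (S * s) p p₁ p₂ 0 := by
    have : IsRegularScale.slope (S * s) p p₁ p₂ 0
        = (c - S * (laplaceTransform ρ 0 + q)) / s ^ 2 := by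
      simp only [IsRegularScale.slope, e₀, e₁, e₂]
      field_simp
      ring
    rw [this]
    exact div_pos (sub_pos.2 hSc) (by positivity)
  obtain ⟨t₁, t₂, t₃⟩ := h.thresholds hΦφ (mul_pos hS hs) hslope
  refine ⟨t₁, t₂.trans ?_, t₃⟩
  have hl : laplaceTransform W (T.phi δ q) = 1 / (δ * T.phi δ q) := by
    refine (hW.laplace _ hΦφ).trans ?_
    congr 1; linarith
  rw [h.AFun_zero hΦφ hδ hl, h.thetaFun_eq le_rfl, e₀, e₁, ← hs_def]
  -- Multiplied by φ, the equation ψ(φ) - δφ = q makes this q + ρ̂(0) - ρ̂(φ), which is positive.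
  have hD : 0 < c - δ + T.phi δ q * s := by
    have h1 := laplaceTransform_le_zero hint (fun x hx => hρ.nonneg hx) hφ.le
    have h2 := hψ _ hφ.le
    refine pos_of_mul_pos_right (a := T.phi δ q) ?_ hφ.le
    nlinarith
  rw [lt_div_iff₀ hD]
  have hθ : (1 - S * s * (s⁻¹ * -(c / s))) / s⁻¹ = s + S * c := by field_simp; ring
  have hA : S * s * (T.phi δ q - δ * s⁻¹) = S * (T.phi δ q * s - δ) := by field_simp
  rw [hθ, hA]
  constructor <;> intro <;> linarith
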